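/- Let $k$ be an algebraically closed field of arbitrary characteristic, let $X$ be a smooth projective integral surface over $k$ with tangent sheaf $T_X$ and canonical divisor $K_X$, and let $C\subseteq X$ be an integral rational curve whose only singularities are ordinary double points (points where $C$ has multiplicity two with two distinct tangent directions in $X$). Let $\deg_{-K_X}C$ denote the intersection number of $C$ with the anticanonical divisor $-K_X$, that is, the degree on $C$ of the line bundle $\omega_X^{-1}|_C$, and let $h:\mathbb{P}^1\to C\subseteq X$ be the normalization of $C$ (a $k$-morphism). Then $h$ is very free on $X$, that is, $H^1(\mathbb{P}^1,(h^*T_X)(-2))=0$, if and only if $\deg_{-K_X}C\ge 3$. -/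

import Mathlib

open CategoryTheory AlgebraicGeometry TopologicalSpace Opposite
open scoped TensorProduct

universe u

namespace FreeCurves

noncomputable section

/-! ### Restriction of sections -/

/-- Restriction of functions from `V` to `W ≤ V`. -/
abbrev res {X : Scheme.{u}} {V W : X.Opens} (h : W ≤ V) : Γ(X, V) →+* Γ(X, W) :=
  (X.presheaf.map (homOfLE h).op).hom

/-- Restriction of sections of an `𝒪_X`-module from `V` to `W ≤ V`. -/
abbrev mres {X : Scheme.{u}} (M : X.Modules) {V W : X.Opens} (h : W ≤ V) : Γ(M, V) →+ Γ(M, W) :=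
  (M.presheaf.map (homOfLE h).op).hom

theorem res_res {X : Scheme.{u}} {U V W : X.Opens} (h : V ≤ U) (h' : W ≤ V) (a : Γ(X, U)) :
    res h' (res h a) = res (h'.trans h) a := by
  rw [res, res, res, ← CommRingCat.comp_apply, ← Functor.map_comp]; rfl

theorem mres_mres {X : Scheme.{u}} (M : X.Modules) {U V W : X.Opens} (h : V ≤ U) (h' : W ≤ V)
    (a : Γ(M, U)) : mres M h' (mres M h a) = mres M (h'.trans h) a := by
  rw [mres, mres, mres, ← AddCommGrpCat.comp_apply, ← Functor.map_comp]; rfl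

theorem mres_smul {X : Scheme.{u}} (M : X.Modules) {V W : X.Opens} (h : W ≤ V)
    (r : Γ(X, V)) (a : Γ(M, V)) : mres M h (r • a) = res h r • mres M h a :=
  M.map_smul (homOfLE h) r a

theorem res_ext {X : Scheme.{u}} {ι : Type*} {V : X.Opens} (W : ι → X.Opens) (hW : ∀ i, W i ≤ V)
    (hc : V ≤ iSup W) (a b : Γ(X, V)) (h : ∀ i, res (hW i) a = res (hW i) b) : a = b :=
  X.sheaf.eq_of_locally_eq' W V (fun i ↦ homOfLE (hW i)) hc a b h

theorem res_glue {X : Scheme.{u}} {ι : Type*} {V : X.Opens} (W : ι → X.Opens) (hW : ∀ i, W i ≤ V)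
    (hc : V ≤ iSup W) (a : ∀ i, Γ(X, W i))
    (h : ∀ i j, res (inf_le_left : W i ⊓ W j ≤ W i) (a i) = res inf_le_right (a j)) :
    ∃ b : Γ(X, V), ∀ i, res (hW i) b = a i :=
  (X.sheaf.existsUnique_gluing' W V (fun i ↦ homOfLE (hW i)) hc a h).exists

theorem mres_ext {X : Scheme.{u}} (M : X.Modules) {ι : Type*} {V : X.Opens} (W : ι → X.Opens)
    (hW : ∀ i, W i ≤ V) (hc : V ≤ iSup W) (a b : Γ(M, V))
    (h : ∀ i, mres M (hW i) a = mres M (hW i) b) : a = b :=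
  TopCat.Sheaf.eq_of_locally_eq' ⟨M.presheaf, M.isSheaf⟩ W V (fun i ↦ homOfLE (hW i)) hc a b h

theorem mres_glue {X : Scheme.{u}} (M : X.Modules) {ι : Type*} {V : X.Opens} (W : ι → X.Opens)
    (hW : ∀ i, W i ≤ V) (hc : V ≤ iSup W) (a : ∀ i, Γ(M, W i))
    (h : ∀ i j, mres M (inf_le_left : W i ⊓ W j ≤ W i) (a i) = mres M inf_le_right (a j)) :
    ∃ b : Γ(M, V), ∀ i, mres M (hW i) b = a i :=
  (TopCat.Sheaf.existsUnique_gluing' ⟨M.presheaf, M.isSheaf⟩ W V (fun i ↦ homOfLE (hW i))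
    hc a h).exists

/-! ### The tangent sheaf -/

/-- Sections over `U` of the relative tangent sheaf of `s : X ⟶ S`: the derivations of the sheaf
of rings `𝒪_U` into itself (families of derivations of `Γ(X, V)`, `V ≤ U`, compatible with
restriction) that vanish on functions coming from `S`. -/
def tangentSections {S X : Scheme.{u}} (s : X ⟶ S) (U : X.Opens) :
    AddSubgroup (∀ V : {V : X.Opens // V ≤ U}, Γ(X, V.1) →+ Γ(X, V.1)) where
  carrier := {D |
    (∀ V a b, D V (a * b) = a * D V b + b * D V a) ∧
    (∀ (V W : {V : X.Opens // V ≤ U}) (h : W.1 ≤ V.1) (a : Γ(X, V.1)),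
      res h (D V a) = D W (res h a)) ∧
    (∀ (V : {V : X.Opens // V ≤ U}) (T : S.Opens) (h : V.1 ≤ s ⁻¹ᵁ T) (c : Γ(S, T)),
      D V (s.appLE T V.1 h c) = 0)}
  zero_mem' := by simp
  add_mem' := by
    rintro D E ⟨h1, h2, h3⟩ ⟨h1', h2', h3'⟩
    refine ⟨fun V a b ↦ ?_, fun V W h a ↦ ?_, fun V T h c ↦ ?_⟩
    · simp [h1, h1']; ring
    · simp [h2, h2']
    · simp [h3, h3']
  neg_mem' := by
    rintro D ⟨h1, h2, h3⟩
    refine ⟨fun V a b ↦ ?_, fun V W h a ↦ ?_, fun V T h c ↦ ?_⟩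
    · simp [h1]; ring
    · simp [h2]
    · simp [h3]

/-- A function `r` on `U` multiplies a derivation `D` pointwise: `(r D)(a) = r · D(a)`. -/
instance {S X : Scheme.{u}} (s : X ⟶ S) (U : X.Opens) :
    Module Γ(X, U) (tangentSections s U) where
  smul r D := ⟨fun V ↦ (AddMonoidHom.mulLeft (res V.2 r)).comp (D.1 V), by
    obtain ⟨D, h1, h2, h3⟩ := D
    refine ⟨fun V a b ↦ ?_, fun V W h a ↦ ?_, fun V T h c ↦ ?_⟩
    · simp [h1]; ring
    · simp [h2, res_res]
    · simp [h3]⟩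
  one_smul D := by
    ext V a; change res V.2 1 * D.1 V a = D.1 V a; simp
  mul_smul r r' D := by
    ext V a
    change res V.2 (r * r') * D.1 V a = res V.2 r * (res V.2 r' * D.1 V a)
    simp [mul_assoc]
  smul_zero r := by
    ext V a; change res V.2 r * 0 = 0; simp
  smul_add r D E := by
    ext V a
    change res V.2 r * (D.1 V a + E.1 V a) = res V.2 r * D.1 V a + res V.2 r * E.1 V a
    ring
  add_smul r r' D := by
    ext V a
    change res V.2 (r + r') * D.1 V a = res V.2 r * D.1 V a + res V.2 r' * D.1 V a
    rw [map_add]; ring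
  zero_smul D := by
    ext V a; change res V.2 0 * D.1 V a = 0; simp

/-- The presheaf of abelian groups underlying the tangent sheaf. -/
def tangentPresheaf {S X : Scheme.{u}} (s : X ⟶ S) : TopCat.Presheaf Ab.{u} X where
  obj U := AddCommGrpCat.of (tangentSections s U.unop)
  map {U U'} f := AddCommGrpCat.ofHom
    { toFun := fun D ↦ ⟨fun V ↦ D.1 ⟨V.1, V.2.trans f.unop.le⟩,
        fun V ↦ D.2.1 ⟨V.1, V.2.trans f.unop.le⟩,
        fun V W ↦ D.2.2.1 ⟨V.1, V.2.trans f.unop.le⟩ ⟨W.1, W.2.trans f.unop.le⟩,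
        fun V ↦ D.2.2.2 ⟨V.1, V.2.trans f.unop.le⟩⟩
      map_zero' := rfl
      map_add' := fun _ _ ↦ rfl }

theorem tangentPresheaf_isSheaf {S X : Scheme.{u}} (s : X ⟶ S) :
    (tangentPresheaf s).IsSheaf := by
  rw [TopCat.Presheaf.isSheaf_iff_isSheafUniqueGluing]
  intro ι U sf hsf
  -- values of the given derivations agree on common smaller opens
  have key : ∀ (i j : ι) (W : X.Opens) (hi : W ≤ U i) (hj : W ≤ U j) (a : Γ(X, W)),
      (sf i).1 ⟨W, hi⟩ a = (sf j).1 ⟨W, hj⟩ a := fun i j W hi hj a ↦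
    congrArg (fun D : tangentSections s (U i ⊓ U j) ↦ D.1 ⟨W, le_inf hi hj⟩ a) (hsf i j)
  have cov : ∀ V : X.Opens, V ≤ iSup U → V ≤ ⨆ i, V ⊓ U i := fun V hV ↦ by
    rw [← inf_iSup_eq]; exact le_inf le_rfl hV
  have ex : ∀ (V : {V : X.Opens // V ≤ iSup U}) (a : Γ(X, V.1)), ∃ b : Γ(X, V.1), ∀ i,
      res (inf_le_left : V.1 ⊓ U i ≤ V.1) b = (sf i).1 ⟨V.1 ⊓ U i, inf_le_right⟩ (res inf_le_left a) := by
    intro V a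
    refine res_glue (fun i ↦ V.1 ⊓ U i) (fun i ↦ inf_le_left) (cov V.1 V.2) _ fun i j ↦ ?_
    rw [(sf i).2.2.1 ⟨_, inf_le_right⟩ ⟨(V.1 ⊓ U i) ⊓ (V.1 ⊓ U j), inf_le_left.trans inf_le_right⟩,
      (sf j).2.2.1 ⟨_, inf_le_right⟩ ⟨(V.1 ⊓ U i) ⊓ (V.1 ⊓ U j), inf_le_right.trans inf_le_right⟩,
      res_res, res_res]
    exact key _ _ _ _ _ _
  choose D hD using ex
  have ext : ∀ (V : {V : X.Opens // V ≤ iSup U}) (a b : Γ(X, V.1)),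
      (∀ i, res (inf_le_left : V.1 ⊓ U i ≤ V.1) a = res (inf_le_left : V.1 ⊓ U i ≤ V.1) b) →
        a = b := fun V a b h ↦
    res_ext (fun i ↦ V.1 ⊓ U i) (fun i ↦ inf_le_left) (cov V.1 V.2) a b h
  -- value of a glued derivation on an open contained in one of the members
  have small : ∀ (V : {V : X.Opens // V ≤ iSup U}) (i : ι) (h : V.1 ≤ U i) (a : Γ(X, V.1)),
      D V a = (sf i).1 ⟨V.1, h⟩ a := by
    intro V i h a
    refine ext _ _ _ fun j ↦ ?_
    rw [hD, (sf i).2.2.1 ⟨V.1, h⟩ ⟨V.1 ⊓ U j, inf_le_left.trans h⟩]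
    exact key _ _ _ _ _ _
  refine ⟨⟨fun V ↦ ⟨⟨D V, ?_⟩, ?_⟩, ?_, ?_, ?_⟩, ?_, ?_⟩
  · exact ext _ _ _ fun i ↦ by simp [hD]
  · exact fun a b ↦ ext _ _ _ fun i ↦ by simp [hD]
  · exact fun V a b ↦ ext _ _ _ fun i ↦ by
      simp only [AddMonoidHom.coe_mk, ZeroHom.coe_mk, map_mul, map_add, hD, (sf i).2.1]
  · intro V W h a
    refine ext _ _ _ fun i ↦ ?_
    simp only [AddMonoidHom.coe_mk, ZeroHom.coe_mk]
    rw [hD, res_res, ← res_res inf_le_left (inf_le_inf_right (U i) h), hD,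
      (sf i).2.2.1 ⟨_, inf_le_right⟩ ⟨W.1 ⊓ U i, inf_le_right⟩, res_res, res_res]
  · intro V T h c
    refine ext _ _ _ fun i ↦ ?_
    simp only [AddMonoidHom.coe_mk, ZeroHom.coe_mk]
    rw [hD, map_zero]
    have := (sf i).2.2.2 ⟨V.1 ⊓ U i, inf_le_right⟩ T (inf_le_left.trans h) c
    rw [← this]
    congr 1
    rw [res, ← CommRingCat.comp_apply, Scheme.Hom.appLE_map]
  · intro i
    refine Subtype.ext (funext fun V ↦ AddMonoidHom.ext fun a ↦ ?_)
    exact small ⟨V.1, _⟩ i V.2 a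
  · intro E hE
    refine Subtype.ext (funext fun V ↦ AddMonoidHom.ext fun a ↦ ext _ _ _ fun i ↦ ?_)
    refine Eq.trans ?_ (hD V a i).symm
    have := congrArg (fun D' : tangentSections s (U i) ↦
      D'.1 ⟨V.1 ⊓ U i, inf_le_right⟩ (res inf_le_left a)) (hE i)
    exact (E.2.2.1 V ⟨V.1 ⊓ U i, inf_le_left.trans V.2⟩ inf_le_left a).trans this

instance {S X : Scheme.{u}} (s : X ⟶ S) (U : X.Opensᵒᵖ) :
    Module (X.ringCatSheaf.obj.obj U) ((tangentPresheaf s).obj U) :=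
  inferInstanceAs (Module Γ(X, U.unop) (tangentSections s U.unop))

/-- The tangent sheaf `T_{X/S}` of `s : X ⟶ S`, as an `𝒪_X`-module. -/
def tangentSheaf {S X : Scheme.{u}} (s : X ⟶ S) : X.Modules where
  val := PresheafOfModules.ofPresheaf (tangentPresheaf s) (by
    intro U U' f r D
    refine Subtype.ext (funext fun V ↦ AddMonoidHom.ext fun a ↦ ?_)
    exact congrArg (· * D.1 ⟨V.1, V.2.trans f.unop.le⟩ a) (res_res f.unop.le V.2 r).symm)
  isSheaf := tangentPresheaf_isSheaf s

/-! ### Twisting by a transition function -/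

/-- Sections over `U` of the twist of `M` by the line bundle that is trivial on `U₀` and `U₁` with
transition function `g`: pairs of sections of `M` over `U ⊓ U₀` and `U ⊓ U₁` with `a = g b` on
`U ⊓ U₀ ⊓ U₁`. -/
def twistSections {Y : Scheme.{u}} (M : Y.Modules) (U₀ U₁ : Y.Opens) (g : Γ(Y, U₀ ⊓ U₁)ˣ)
    (U : Y.Opens) : AddSubgroup (Γ(M, U ⊓ U₀) × Γ(M, U ⊓ U₁)) where
  carrier := {p |
    mres M (inf_le_inf_left U inf_le_left) p.1 =
      res (inf_le_right : U ⊓ (U₀ ⊓ U₁) ≤ U₀ ⊓ U₁) (g : Γ(Y, U₀ ⊓ U₁)) •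
        mres M (inf_le_inf_left U inf_le_right) p.2}
  zero_mem' := by simp
  add_mem' := by
    intro p q hp hq
    simp only [Set.mem_ofPred_eq, Prod.fst_add, Prod.snd_add, map_add, smul_add] at *
    rw [hp, hq]
  neg_mem' := by
    intro p hp
    simp only [Set.mem_ofPred_eq, Prod.fst_neg, Prod.snd_neg, map_neg, smul_neg] at *
    rw [hp]

/-- The abelian presheaf with sections `twistSections`. -/
def twistPresheaf {Y : Scheme.{u}} (M : Y.Modules) (U₀ U₁ : Y.Opens) (g : Γ(Y, U₀ ⊓ U₁)ˣ) :
    TopCat.Presheaf Ab.{u} Y where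
  obj U := AddCommGrpCat.of (twistSections M U₀ U₁ g U.unop)
  map {U U'} f := AddCommGrpCat.ofHom
    { toFun := fun p ↦ ⟨(mres M (inf_le_inf_right U₀ f.unop.le) p.1.1,
          mres M (inf_le_inf_right U₁ f.unop.le) p.1.2), by
        have := congrArg (mres M (inf_le_inf_right (U₀ ⊓ U₁) f.unop.le)) p.2
        rw [mres_smul, res_res, mres_mres, mres_mres] at this
        change mres M _ (mres M _ _) = _ • mres M _ (mres M _ _)
        rw [mres_mres, mres_mres]
        exact this⟩
      map_zero' := by ext <;> simp
      map_add' := fun p q ↦ by ext <;> simp }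
  map_id U := by
    refine AddCommGrpCat.hom_ext (AddMonoidHom.ext fun p ↦ Subtype.ext (Prod.ext ?_ ?_))
    · exact congr($(M.presheaf.map_id _) p.1.1)
    · exact congr($(M.presheaf.map_id _) p.1.2)
  map_comp f g := by
    refine AddCommGrpCat.hom_ext (AddMonoidHom.ext fun p ↦ Subtype.ext (Prod.ext ?_ ?_))
    · exact (mres_mres M _ _ p.1.1).symm
    · exact (mres_mres M _ _ p.1.2).symm

theorem twistPresheaf_isSheaf {Y : Scheme.{u}} (M : Y.Modules) (U₀ U₁ : Y.Opens)
    (g : Γ(Y, U₀ ⊓ U₁)ˣ) : (twistPresheaf M U₀ U₁ g).IsSheaf := by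
  rw [TopCat.Presheaf.isSheaf_iff_isSheafUniqueGluing]
  intro ι U sf hsf
  have le : ∀ (U' : Y.Opens) (i : ι), U i ⊓ U' ≤ iSup U ⊓ U' := fun U' i ↦
    inf_le_inf_right U' (le_iSup U i)
  have cov : ∀ U' : Y.Opens, iSup U ⊓ U' ≤ ⨆ i, U i ⊓ U' := fun U' ↦ (iSup_inf_eq U U').le
  have aux : ∀ (U' : Y.Opens) (i j : ι), (U i ⊓ U') ⊓ (U j ⊓ U') ≤ (U i ⊓ U j) ⊓ U' :=
    fun U' i j ↦ le_inf (inf_le_inf inf_le_left inf_le_left) (inf_le_left.trans inf_le_right)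
  obtain ⟨a, ha⟩ := mres_glue M (fun i ↦ U i ⊓ U₀) (le U₀) (cov U₀) (fun i ↦ (sf i).1.1)
    fun i j ↦ by
      have := congrArg (fun p : twistSections M U₀ U₁ g (U i ⊓ U j) ↦
        mres M (aux U₀ i j) p.1.1) (hsf i j)
      refine Eq.trans (mres_mres M _ _ _).symm (this.trans (mres_mres M _ _ _))
  obtain ⟨b, hb⟩ := mres_glue M (fun i ↦ U i ⊓ U₁) (le U₁) (cov U₁) (fun i ↦ (sf i).1.2)
    fun i j ↦ by
      have := congrArg (fun p : twistSections M U₀ U₁ g (U i ⊓ U j) ↦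
        mres M (aux U₁ i j) p.1.2) (hsf i j)
      refine Eq.trans (mres_mres M _ _ _).symm (this.trans (mres_mres M _ _ _))
  refine ⟨⟨(a, b), ?_⟩, ?_, ?_⟩
  · refine mres_ext M (fun i ↦ U i ⊓ (U₀ ⊓ U₁)) (le _) (cov _) _ _ fun i ↦ ?_
    have := (sf i).2
    change mres M _ (sf i).1.1 = _ • mres M _ (sf i).1.2 at this
    rw [← ha, ← hb, mres_mres, mres_mres] at this
    rw [mres_smul, res_res, mres_mres, mres_mres]
    exact this
  · exact fun i ↦ Subtype.ext (Prod.ext (ha i) (hb i))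
  · intro p hp
    refine Subtype.ext (Prod.ext ?_ ?_)
    · refine mres_ext M (fun i ↦ U i ⊓ U₀) (le U₀) (cov U₀) _ _ fun i ↦ Eq.trans ?_ (ha i).symm
      exact congrArg (fun p : twistSections M U₀ U₁ g (U i) ↦ p.1.1) (hp i)
    · refine mres_ext M (fun i ↦ U i ⊓ U₁) (le U₁) (cov U₁) _ _ fun i ↦ Eq.trans ?_ (hb i).symm
      exact congrArg (fun p : twistSections M U₀ U₁ g (U i) ↦ p.1.2) (hp i)

/-- The twist of `M` by the line bundle that is trivial on `U₀` and on `U₁`, with transition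
function `g` on `U₀ ⊓ U₁`, as an abelian sheaf. -/
def twist {Y : Scheme.{u}} (M : Y.Modules) (U₀ U₁ : Y.Opens) (g : Γ(Y, U₀ ⊓ U₁)ˣ) :
    TopCat.Sheaf Ab.{u} Y :=
  ⟨twistPresheaf M U₀ U₁ g, twistPresheaf_isSheaf M U₀ U₁ g⟩

/-! ### Projective space and twists on the projective line -/

attribute [local instance] MvPolynomial.gradedAlgebra

/-- Projective `n`-space over `k`, i.e. `Proj k[X₀, …, Xₙ]`. -/
abbrev projSpace (k : Type u) [Field k] (n : ℕ) : Scheme.{u} :=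
  Proj (MvPolynomial.homogeneousSubmodule (Fin (n + 1)) k)

/-- The structure morphism of projective space. -/
def projSpaceToSpec (k : Type u) [Field k] (n : ℕ) :
    projSpace k n ⟶ Spec (CommRingCat.of k) :=
  Proj.toSpecZero (MvPolynomial.homogeneousSubmodule (Fin (n + 1)) k) ≫
    Spec.map (CommRingCat.ofHom
      (algebraMap k (MvPolynomial.homogeneousSubmodule (Fin (n + 1)) k 0)))

/-- The projective line. -/
abbrev projLine (k : Type u) [Field k] : Scheme.{u} := projSpace k 1

/-- The standard affine open `Xᵢ ≠ 0` of the projective line. -/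
def chart (k : Type u) [Field k] (i : Fin 2) : (projLine k).Opens :=
  Proj.basicOpen (MvPolynomial.homogeneousSubmodule (Fin 2) k) (MvPolynomial.X i)

theorem X_mul_X_mem (k : Type u) [Field k] (i j : Fin 2) :
    (MvPolynomial.X i * MvPolynomial.X j : MvPolynomial (Fin 2) k) ∈
      MvPolynomial.homogeneousSubmodule (Fin 2) k 2 :=
  (MvPolynomial.isHomogeneous_X k i).mul (MvPolynomial.isHomogeneous_X k j)

/-- The fraction `Xᵢ² / (X₀ X₁)`, a function on the complement of `X₀ X₁ = 0`. -/
def ratio (k : Type u) [Field k] (i : Fin 2) :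
    HomogeneousLocalization.Away (MvPolynomial.homogeneousSubmodule (Fin 2) k)
      (MvPolynomial.X 0 * MvPolynomial.X 1) :=
  .mk _ (X_mul_X_mem k 0 1) 1 (MvPolynomial.X i * MvPolynomial.X i) (X_mul_X_mem k i i)

theorem ratio_mul_ratio (k : Type u) [Field k] : ratio k 1 * ratio k 0 = 1 := by
  apply HomogeneousLocalization.val_injective
  rw [HomogeneousLocalization.val_mul, HomogeneousLocalization.val_one, ratio, ratio,
    HomogeneousLocalization.Away.val_mk, HomogeneousLocalization.Away.val_mk, Localization.mk_mul,
    ← Localization.mk_one, Localization.mk_eq_mk_iff, Localization.r_iff_exists]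
  refine ⟨1, ?_⟩
  simp
  ring

theorem chart_inf_chart_le (k : Type u) [Field k] :
    chart k 0 ⊓ chart k 1 ≤ Proj.basicOpen (MvPolynomial.homogeneousSubmodule (Fin 2) k)
      (MvPolynomial.X 0 * MvPolynomial.X 1) :=
  (Proj.basicOpen_mul _ _ _).ge

/-- Fractions with denominator a power of `X₀ X₁`, as functions on the intersection of the two
charts. -/
def awayToChartInter (k : Type u) [Field k] :
    HomogeneousLocalization.Away (MvPolynomial.homogeneousSubmodule (Fin 2) k)
      (MvPolynomial.X 0 * MvPolynomial.X 1) →+* Γ(projLine k, chart k 0 ⊓ chart k 1) :=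
  (res (chart_inf_chart_le k)).comp
    (Proj.awayToSection (MvPolynomial.homogeneousSubmodule (Fin 2) k)
      (MvPolynomial.X 0 * MvPolynomial.X 1)).hom

/-- The coordinate `X₁ / X₀ = X₁² / (X₀ X₁)`, a unit on the intersection of the two charts, with
inverse `X₀ / X₁ = X₀² / (X₀ X₁)`. -/
def coordinate (k : Type u) [Field k] : Γ(projLine k, chart k 0 ⊓ chart k 1)ˣ where
  val := awayToChartInter k (ratio k 1)
  inv := awayToChartInter k (ratio k 0)
  val_inv := by rw [← map_mul, ratio_mul_ratio, map_one]
  inv_val := by rw [mul_comm, ← map_mul, ratio_mul_ratio, map_one]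

/-- The twist `M(n)` of a module `M` on the projective line. A section `σ` of `M(n)` corresponds
to the pair of sections `σ / X₀ⁿ` and `σ / X₁ⁿ` of `M` over the charts, and
`σ / X₀ⁿ = (X₁ / X₀)ⁿ · σ / X₁ⁿ`. -/
def serreTwist {k : Type u} [Field k] (M : (projLine k).Modules) (n : ℤ) :
    TopCat.Sheaf Ab.{u} (projLine k) :=
  twist M (chart k 0) (chart k 1) (coordinate k ^ n)

/-! ### Very free curves -/

/-- A morphism `f : ℙ¹ ⟶ X` to a scheme `s : X ⟶ Spec k` is very free if
`H¹(ℙ¹, (f^* T_X)(-2)) = 0`. -/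
def VeryFree {k : Type u} [Field k] {X : Scheme.{u}} (s : X ⟶ Spec (CommRingCat.of k))
    (f : projLine k ⟶ X) : Prop :=
  Subsingleton (Sheaf.H (serreTwist ((Scheme.Modules.pullback f).obj (tangentSheaf s)) (-2)) 1)

/-! ### Curves on a surface -/

/-- `X` is projective over `k`: it is a closed subscheme of some projective space. -/
def IsProjective {k : Type u} [Field k] {X : Scheme.{u}} (s : X ⟶ Spec (CommRingCat.of k)) :
    Prop :=
  ∃ (n : ℕ) (j : X ⟶ projSpace k n), IsClosedImmersion j ∧ j ≫ projSpaceToSpec k n = s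

/-- `h : Y ⟶ C` is the normalization of `C`: `Y` is normal and integral, and `h` is integral and
birational (an isomorphism over a nonempty open subset). -/
structure IsNormalization {Y C : Scheme.{u}} (h : Y ⟶ C) : Prop where
  isIntegral : IsIntegral Y
  isNormal : ∀ y : Y, IsIntegrallyClosed (Y.presheaf.stalk y)
  isIntegralHom : IsIntegralHom h
  birational : ∃ U : C.Opens, (U : Set C).Nonempty ∧ IsIso (h ∣_ U)

/-- The curve `i : C ⟶ X` on a smooth surface has an ordinary double point at `c`: near
`i c` it is defined by an equation `f = u v + (terms of order ≥ 3)`, where `u, v` generate the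
maximal ideal; that is, it has multiplicity two and two distinct tangent directions. -/
def IsOrdinaryDoublePoint {C X : Scheme.{u}} (i : C ⟶ X) (c : C) : Prop :=
  ∃ f u v : X.presheaf.stalk (i c),
    RingHom.ker (i.stalkMap c).hom = Ideal.span {f} ∧
    IsLocalRing.maximalIdeal (X.presheaf.stalk (i c)) = Ideal.span {u, v} ∧
    f - u * v ∈ IsLocalRing.maximalIdeal (X.presheaf.stalk (i c)) ^ 3

/-- All singularities of the curve `i : C ⟶ X` are ordinary double points. -/
def IsNodal {C X : Scheme.{u}} (i : C ⟶ X) : Prop :=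
  ∀ c : C, IsRegularLocalRing (C.presheaf.stalk c) ∨ IsOrdinaryDoublePoint i c

/-! ### Degree with respect to the anticanonical divisor -/

section degree

variable {S X C : Scheme.{u}} (s : X ⟶ S) (i : C ⟶ X) [IsIntegral C]

/-- The generic fibre on `C` of `i^* Ω_{X/S}`, a vector space over the function field of `C`. -/
def genericCotangent : ModuleCat.{u} C.functionField :=
  (ModuleCat.extendScalars (i.stalkMap (genericPoint C)).hom).obj
    (CommRingCat.KaehlerDifferential (s.stalkMap (i (genericPoint C))))

/-- The restriction to `C` of the differential `da` of a function `a` near `i c`. -/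
def restrictedDiff (c : C) (a : X.presheaf.stalk (i c)) : genericCotangent s i :=
  letI := (i.stalkMap (genericPoint C)).hom.toAlgebra
  (1 : C.functionField) ⊗ₜ[X.presheaf.stalk (i (genericPoint C))]
    CommRingCat.KaehlerDifferential.d (f := s.stalkMap (i (genericPoint C)))
      (X.presheaf.stalkSpecializes ((genericPoint_specializes c).map i.continuous) a)

/-- Rational sections of the restriction to `C` of the canonical bundle `ω_X = ⋀² Ω_X` of a
surface `X`. -/
abbrev RationalTwoForm : Type u := ⋀[C.functionField]^2 (genericCotangent s i)

/-- The restriction of `du ∧ dv` to `C`. -/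
def restrictedTwoForm (c : C) (u v : X.presheaf.stalk (i c)) : RationalTwoForm s i :=
  exteriorPower.ιMulti C.functionField 2 ![restrictedDiff s i c u, restrictedDiff s i c v]

/-- `u, v` are local coordinates of the smooth surface `X` at `x`: `du, dv` generate the stalk of
`Ω_{X/S}` (which is free of rank two), so that `du ∧ dv` generates the stalk of `ω_X`. -/
def IsLocalCoordinates (x : X) (u v : X.presheaf.stalk x) : Prop :=
  Submodule.span (X.presheaf.stalk x)
    {CommRingCat.KaehlerDifferential.d (f := s.stalkMap x) u,
      CommRingCat.KaehlerDifferential.d (f := s.stalkMap x) v} = ⊤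

open Classical in
/-- The order at `c` of a nonzero rational section `ω` of `ω_X|_C`: if `ω = a · du ∧ dv` with local
coordinates `u, v` of `X` at `i c` and a rational function `a` on `C`, it is the order of `a`
at `c`, i.e. `length (𝒪_{C,c} / p) - length (𝒪_{C,c} / q)` for `a = p / q`. -/
def formOrd [IsLocallyNoetherian C] (ω : RationalTwoForm s i) (c : C) : ℤ :=
  if h : ∃ a : C.functionField, ∃ u v : X.presheaf.stalk (i c),
      IsLocalCoordinates s (i c) u v ∧ ω = a • restrictedTwoForm s i c u v
  then C.ord h.choose c else 0

/-- The degree on `C` of the canonical divisor `K_X` of the surface `X`: the degree of the divisor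
of any nonzero rational section of `ω_X|_C`. (Over an algebraically closed field all closed points
have degree one.) -/
def canonicalDegree [IsLocallyNoetherian C] : ℤ :=
  ∑ᶠ c : C, formOrd s i (Classical.epsilon fun ω : RationalTwoForm s i ↦ ω ≠ 0) c

end degree

theorem curve_isLocallyNoetherian {k : Type u} [Field k] {X C : Scheme.{u}}
    (s : X ⟶ Spec (CommRingCat.of k)) [SmoothOfRelativeDimension 2 s] (i : C ⟶ X)
    [IsClosedImmersion i] : IsLocallyNoetherian C := by
  have : Smooth s := SmoothOfRelativeDimension.smooth 2 s
  exact LocallyOfFiniteType.isLocallyNoetherian (i ≫ s)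

/-- `deg_{-K_X} C`: the intersection number of the integral curve `i : C ⟶ X` with the anticanonical
divisor `-K_X` of the smooth surface `s : X ⟶ Spec k`. -/
def anticanonicalDegree {k : Type u} [Field k] {X C : Scheme.{u}}
    (s : X ⟶ Spec (CommRingCat.of k)) [SmoothOfRelativeDimension 2 s] (i : C ⟶ X)
    [IsIntegral C] [IsClosedImmersion i] : ℤ :=
  haveI := curve_isLocallyNoetherian s i;
  -canonicalDegree s i

end

end FreeCurves

/-! Write f = h ≫ i, E = f^*T_X and d = deg_{-K_X} C, so that E is a rank two bundle of degree d on
ℙ¹. The branches of C at a node are smooth, so f is unramified in every characteristic and df embeds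
T_{ℙ¹} = 𝒪(2) in E as a subbundle, with quotient 𝒪(d - 2). Twisting gives 0 → 𝒪 → E(-2) → 𝒪(d - 4) →
0. As H¹(𝒪) = H²(𝒪) = 0, H¹(E(-2)) = H¹(𝒪(d - 4)), which vanishes exactly when d - 4 ≥ -1.

The proof carries this out inside the function field K = k(t). Coordinates of X at the image of the
generic point identify rational sections of E with K². Sections of E(-2) over an open V are the
vectors lying, for each closed point q of V, in a lattice cut out by a valuation and a transition
matrix M_q (`sumSurjective_twistedTangent_iff`). The subbundle 𝒪 is spanned by D = (d(f^*w_j)/dt)_j,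
the quotient map is the wedge product with D, and the degree d is the sum of the orders of det M_q.
For such lattices the criterion is `three_le_latticeDegree_iff`, which rests on partial fractions.

H¹ enters only through decompositions of sections. If sections over every V ⊓ W are sums of sections
over V and over W, then H¹ = 0 (`subsingleton_H_one_of_sumSurjective`); conversely H¹ = 0 gives such
sums for any two opens covering the space, by Mayer–Vietoris
(`sumSurjective_of_subsingleton_H_one`).

Two geometric inputs concern C. The degree is defined by lengths over the local rings of C;
`ord_eq_sum` rewrites it as a sum over the points of the normalization, the singularity cancelling
because its conductor has finite colength. And `valuation_eq_exp_neg_one_of_le` shows, by blowing up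
the node, that a local equation uv + ... forces u or v to be a uniformizer on each branch, which
makes D nowhere zero. -/

namespace FreeCurves

noncomputable section

section


/-! ### First cohomology of abelian sheaves on a compact space -/

section Cohomology

open Abelian Limits

/-- Abelian sheaves on a topological space. -/
abbrev AbSheaf (X : TopCat.{u}) := Sheaf (Opens.grothendieckTopology X) AddCommGrpCat.{u}

variable {X : TopCat.{u}}

/-- Restriction of sections of an abelian sheaf. -/
abbrev sres (F : AbSheaf X) {V W : Opens X} (h : W ≤ V) :
    F.obj.obj (op V) →+ F.obj.obj (op W) :=
  (F.obj.map (homOfLE h).op).hom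

theorem sres_sres (F : AbSheaf X) {U V W : Opens X} (h : V ≤ U) (h' : W ≤ V)
    (a : F.obj.obj (op U)) : sres F h' (sres F h a) = sres F (h'.trans h) a := by
  rw [sres, sres, sres, ← AddCommGrpCat.comp_apply, ← Functor.map_comp]; rfl

theorem sres_self (F : AbSheaf X) {U : Opens X} (h : U ≤ U)
    (a : F.obj.obj (op U)) : sres F h a = a := by
  have : (homOfLE h).op = 𝟙 (op U) := rfl
  rw [sres, this, F.obj.map_id]; rfl

theorem sres_hom {F G : AbSheaf X} (g : F ⟶ G) {V W : Opens X} (h : W ≤ V)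
    (a : F.obj.obj (op V)) : sres G h (g.hom.app _ a) = g.hom.app _ (sres F h a) :=
  congr($(g.hom.naturality (homOfLE h).op) a).symm

/-- Sections over `V ⊓ W` are sums of sections over `V` and over `W`. -/
def SumSurjective (F : AbSheaf X) (V W : Opens X) : Prop :=
  ∀ x : F.obj.obj (op (V ⊓ W)), ∃ (a : F.obj.obj (op V)) (b : F.obj.obj (op W)),
    x = sres F inf_le_left a + sres F inf_le_right b

theorem sheaf_ext (F : AbSheaf X) {ι : Type*} {V : Opens X} (W : ι → Opens X)
    (hW : ∀ i, W i ≤ V) (hc : V ≤ iSup W) (a b : F.obj.obj (op V))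
    (h : ∀ i, sres F (hW i) a = sres F (hW i) b) : a = b :=
  TopCat.Sheaf.eq_of_locally_eq' F W V (fun i ↦ homOfLE (hW i)) hc a b h

/-- A section of a quotient that lifts over `V` and over `W` lifts over `V ⊔ W`. -/
theorem exists_lift_sup {S : ShortComplex (AbSheaf X)} (hS : S.ShortExact)
    {U V W : Opens X} (hVW : SumSurjective S.X₁ V W) (s : S.X₃.obj.obj (op U))
    (hV : V ≤ U) (hW : W ≤ U)
    (a : S.X₂.obj.obj (op V)) (ha : S.g.hom.app _ a = sres _ hV s)
    (b : S.X₂.obj.obj (op W)) (hb : S.g.hom.app _ b = sres _ hW s) :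
    ∃ c : S.X₂.obj.obj (op (V ⊔ W)), S.g.hom.app _ c = sres _ (sup_le hV hW) s := by
  -- On V ⊓ W the two lifts differ by a section of `S.X₁`. It splits as d₁ + d₂, and the corrected
  -- lifts a - d₁ and b + d₂ agree and glue.
  obtain ⟨d, hd⟩ := TopCat.Sheaf.sections_exact_of_left_exact hS.1 hS.2
    (sres S.X₂ (inf_le_left : V ⊓ W ≤ V) a - sres S.X₂ (inf_le_right : V ⊓ W ≤ W) b) (by
      rw [map_sub, ← sres_hom, ← sres_hom, ha, hb, sres_sres, sres_sres, sub_self])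
  obtain ⟨d₁, d₂, rfl⟩ := hVW d
  have hz : ∀ (V : Opens X) (x : S.X₁.obj.obj (op V)), S.g.hom.app _ (S.f.hom.app _ x) = 0 :=
    fun V x ↦ by
      have : (S.f ≫ S.g).hom.app (op V) x = 0 := by rw [S.zero]; rfl
      exact this
  rw [map_add, ← sres_hom, ← sres_hom] at hd
  let Us : Bool → Opens X := fun i ↦ cond i V W
  let sf : ∀ i, S.X₂.obj.obj (op (Us i)) := fun i ↦ match i with
    | true => a - S.f.hom.app _ d₁
    | false => b + S.f.hom.app _ d₂
  have key : sres S.X₂ (inf_le_left : V ⊓ W ≤ V) (a - S.f.hom.app _ d₁) =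
      sres S.X₂ (inf_le_right : V ⊓ W ≤ W) (b + S.f.hom.app _ d₂) := by
    rw [map_sub, map_add, sub_eq_iff_eq_add, add_assoc, add_comm (sres _ _ _) (sres _ _ _), hd]
    abel
  have hle : ∀ i, Us i ≤ V ⊔ W := fun i ↦ by cases i; exacts [le_sup_right, le_sup_left]
  have hcov : V ⊔ W ≤ iSup Us := sup_le (le_iSup Us true) (le_iSup Us false)
  obtain ⟨c, hc, -⟩ := TopCat.Sheaf.existsUnique_gluing' S.X₂ Us (V ⊔ W)
    (fun i ↦ homOfLE (hle i)) hcov sf (by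
      intro i j
      cases i <;> cases j
      · rfl
      · have := congrArg (sres S.X₂ (le_inf inf_le_right inf_le_left : W ⊓ V ≤ V ⊓ W)) key
        rw [sres_sres, sres_sres] at this
        exact this.symm
      · exact key
      · rfl)
  refine ⟨c, sheaf_ext _ Us hle hcov _ _ fun i ↦ ?_⟩
  rw [sres_hom, sres_sres]
  have hi : sres S.X₂ (hle i) c = sf i := hc i
  rw [hi]
  cases i
  · change S.g.hom.app _ (b + S.f.hom.app _ d₂) = _
    rw [map_add, hz, add_zero, hb]
  · change S.g.hom.app _ (a - S.f.hom.app _ d₁) = _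
    rw [map_sub, hz, sub_zero, ha]

/-- On a compact space, if the first sheaf of a short exact sequence has the property that sections
over intersections are sums of sections, then global sections lift. -/
theorem exists_lift_top [CompactSpace X] {S : ShortComplex (AbSheaf X)}
    (hS : S.ShortExact) (h : ∀ V W, SumSurjective S.X₁ V W) (s : S.X₃.obj.obj (op ⊤)) :
    ∃ t : S.X₂.obj.obj (op ⊤), S.g.hom.app _ t = s := by
  -- Lifts exist locally because `S.g` is an epimorphism. Compactness leaves finitely many opens,
  -- which are joined one at a time by `exists_lift_sup`; the unions that arise are arbitrary, so
  -- the splitting is needed for all pairs.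
  let P : Opens X → Prop := fun V ↦ ∃ a : S.X₂.obj.obj (op V), S.g.hom.app _ a = sres _ le_top s
  have hloc : ∀ x : X, ∃ V : Opens X, x ∈ V ∧ P V := by
    intro x
    have := (TopCat.Sheaf.isLocallySurjective_iff_epi S.g).mpr hS.epi_g
    obtain ⟨V, hV, ⟨t, ht⟩, hx⟩ :=
      (TopCat.Presheaf.isLocallySurjective_iff S.g.hom).mp this ⊤ s x trivial
    exact ⟨V, hx, t, ht⟩
  choose V hxV hV using hloc
  have hsup : ∀ I : Finset X, P (I.sup V) := by
    classical
    intro I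
    induction I using Finset.induction with
    | empty =>
      refine ⟨0, sheaf_ext _ (Empty.elim : Empty → Opens X) (fun i ↦ i.elim) ?_ _ _ fun i ↦ i.elim⟩
      simp
    | insert x I _ ih =>
      rw [Finset.sup_insert]
      obtain ⟨a, ha⟩ := hV x
      obtain ⟨b, hb⟩ := ih
      exact exists_lift_sup hS (h _ _) s le_top le_top a ha b hb
  obtain ⟨I, hI⟩ := isCompact_univ.elim_finite_subcover (fun x : X ↦ (V x : Set X))
    (fun x ↦ (V x).isOpen) (fun x _ ↦ Set.mem_iUnion.2 ⟨x, hxV x⟩)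
  have htop : (⊤ : Opens X) ≤ I.sup V := by
    intro x hx
    obtain ⟨y, hy, hxy⟩ := Set.mem_iUnion₂.1 (hI hx)
    exact (Finset.le_sup (f := V) hy) hxy
  obtain ⟨a, ha⟩ := hsup I
  refine ⟨sres _ htop a, ?_⟩
  rw [← sres_hom, ha, sres_sres, sres_self]

/-- Embed F in an injective sheaf. A class in H¹(F) is the connecting image of a global section of
the quotient; that section lifts by `exists_lift_top`, so the class is zero. -/
theorem subsingleton_H_one_of_sumSurjective [CompactSpace X] (F : AbSheaf X)
    (h : ∀ V W, SumSurjective F V W) : Subsingleton (Sheaf.H F 1) := by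
  let S : ShortComplex (AbSheaf X) :=
    ShortComplex.mk (Injective.ι F) (cokernel.π (Injective.ι F)) (cokernel.condition _)
  have hS : S.ShortExact :=
    { exact := ShortComplex.exact_of_g_is_cokernel _ (cokernelIsCokernel _) }
  refine subsingleton_of_forall_eq 0 fun x ↦ ?_
  obtain ⟨y, rfl⟩ := Ext.covariant_sequence_exact₁ _ hS x (Ext.eq_zero_of_injective _) rfl
  obtain ⟨z, hz⟩ : ∃ z : Sheaf.H S.X₂ 0, Sheaf.H.map S.g 0 z = y := by
    obtain ⟨t, ht⟩ := exists_lift_top hS h (Sheaf.H.equiv₀ S.X₃ isTerminalTop y)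
    refine ⟨(Sheaf.H.equiv₀ S.X₂ isTerminalTop).symm t, ?_⟩
    rw [Sheaf.H.equiv₀_symm_naturality, ht, AddEquiv.symm_apply_apply]
  rw [← hz, Sheaf.H.map_apply, Ext.comp_assoc_of_second_deg_zero,
    ShortComplex.ShortExact.comp_extClass, Ext.comp_zero]

/-! ### Free abelian sheaves on opens and the Mayer–Vietoris sequence -/

/-- Morphisms from the free abelian sheaf on an open set are sections. -/
def freeHomEquiv (F : AbSheaf X) (U : Opens X) :
    ((presheafToSheaf (Opens.grothendieckTopology X) _).obj
      (yoneda.obj U ⋙ AddCommGrpCat.free) ⟶ F) ≃ F.obj.obj (op U) :=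
  ((sheafificationAdjunction _ _).homEquiv _ _).trans
    (((AddCommGrpCat.adj.whiskerRight _).homEquiv (yoneda.obj U) F.obj).trans yonedaEquiv)

theorem freeHomEquiv_naturality (F : AbSheaf X) {U V : Opens X} (h : U ≤ V)
    (φ : (presheafToSheaf (Opens.grothendieckTopology X) _).obj
      (yoneda.obj V ⋙ AddCommGrpCat.free) ⟶ F) :
    freeHomEquiv F U ((presheafToSheaf (Opens.grothendieckTopology X) _).map
      (Functor.whiskerRight (yoneda.map (homOfLE h)) AddCommGrpCat.free) ≫ φ) =
      sres F h (freeHomEquiv F V φ) := by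
  simp only [freeHomEquiv, Equiv.trans_apply]
  rw [Adjunction.homEquiv_naturality_left]
  erw [Adjunction.homEquiv_naturality_left (AddCommGrpCat.adj.whiskerRight _)]
  exact (yonedaEquiv_naturality _ _).symm

/-- The correspondence is evaluation at the tautological section, which shows that it is additive.
-/
theorem freeHomEquiv_apply (F : AbSheaf X) (U : Opens X)
    (φ : (presheafToSheaf (Opens.grothendieckTopology X) _).obj
      (yoneda.obj U ⋙ AddCommGrpCat.free) ⟶ F) :
    freeHomEquiv F U φ = φ.hom.app _ ((toSheafify (Opens.grothendieckTopology X)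
      (yoneda.obj U ⋙ AddCommGrpCat.free)).app (op U) (FreeAbelianGroup.of (𝟙 U))) := by
  simp only [freeHomEquiv, Equiv.trans_apply]
  rw [Adjunction.homEquiv_unit, Adjunction.homEquiv_unit]
  rfl

theorem freeHomEquiv_sub (F : AbSheaf X) (U : Opens X)
    (φ ψ : (presheafToSheaf (Opens.grothendieckTopology X) _).obj
      (yoneda.obj U ⋙ AddCommGrpCat.free) ⟶ F) :
    freeHomEquiv F U (φ - ψ) = freeHomEquiv F U φ - freeHomEquiv F U ψ := by
  simp only [freeHomEquiv_apply]
  rfl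

instance uniqueYonedaTop (U : (Opens X)ᵒᵖ) : Unique ((yoneda.obj (⊤ : Opens X)).obj U) where
  default := homOfLE le_top
  uniq := fun _ ↦ Subsingleton.elim (α := (unop U ⟶ ⊤)) _ _

/-- The constant sheaf `ℤ` is the free abelian sheaf on the whole space. -/
def freeTopIso : (presheafToSheaf (Opens.grothendieckTopology X) AddCommGrpCat.{u}).obj
      (yoneda.obj (⊤ : Opens X) ⋙ AddCommGrpCat.free) ≅
    (constantSheaf (Opens.grothendieckTopology X) AddCommGrpCat.{u}).obj
      (AddCommGrpCat.of (ULift ℤ)) :=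
  (presheafToSheaf _ _).mapIso (NatIso.ofComponents
    (fun U ↦
      ((FreeAbelianGroup.uniqueEquiv ((yoneda.obj (⊤ : Opens X)).obj U)).trans
        AddEquiv.ulift.symm).toAddCommGrpIso)
    (fun {U V} f ↦ by
      refine AddCommGrpCat.hom_ext (FreeAbelianGroup.lift_ext _ _ fun x ↦ ?_)
      have h : ∀ (W : (Opens X)ᵒᵖ)
          (y : (yoneda.obj (⊤ : Opens X)).obj W),
          FreeAbelianGroup.uniqueEquiv _ (FreeAbelianGroup.of y) = 1 := fun W y ↦
        FreeAbelianGroup.lift_apply_of (fun _ ↦ (1 : ℤ)) y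
      change ULift.up (FreeAbelianGroup.uniqueEquiv _
          (AddCommGrpCat.free.map ((yoneda.obj (⊤ : Opens X)).map f) (FreeAbelianGroup.of x))) =
        ULift.up (FreeAbelianGroup.uniqueEquiv _ (FreeAbelianGroup.of x))
      rw [AddCommGrpCat.free_map_coe]
      erw [FreeAbelianGroup.map_of]
      rw [h, h]))

theorem shortComplex_f_comp (S : (Opens.grothendieckTopology X).MayerVietorisSquare)
    {F : AbSheaf X} (ψ : S.shortComplex.X₂ ⟶ F) : S.shortComplex.f ≫ ψ =
      (presheafToSheaf _ _).map (Functor.whiskerRight (yoneda.map S.f₁₂) AddCommGrpCat.free) ≫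
        (biprod.inl ≫ ψ) -
      (presheafToSheaf _ _).map (Functor.whiskerRight (yoneda.map S.f₁₃) AddCommGrpCat.free) ≫
        (biprod.inr ≫ ψ) := by
  dsimp [GrothendieckTopology.MayerVietorisSquare.shortComplex] at ψ ⊢
  rw [biprod.lift_eq]
  simp only [sub_eq_add_neg, Preadditive.add_comp, Category.assoc]
  congr 1
  exact Preadditive.neg_comp _ _

/-- The free sheaves on V ⊓ W, on V and W together, and on V ⊔ W form a short exact sequence.
Applying Hom(-, F), the obstruction to extending a section x over V ⊓ W to a pair of sections lies
in Ext¹ of the last term. -/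
theorem sumSurjective_of_subsingleton_H_one (F : AbSheaf X)
    [Subsingleton (Sheaf.H F 1)] {V W : Opens X} (hVW : V ⊔ W = ⊤) : SumSurjective F V W := by
  intro x
  let S := Opens.mayerVietorisSquare V W
  let φ := (freeHomEquiv F (V ⊓ W)).symm x
  have hsub : Subsingleton (Ext S.shortComplex.X₃ F 1) := by
    -- Since V ⊔ W is the whole space, the last term is the constant sheaf ℤ, and its Ext¹ into F is
    -- H¹(F) = 0.
    have e : S.shortComplex.X₃ ≅ (constantSheaf (Opens.grothendieckTopology X) AddCommGrpCat.{u}).obj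
      (AddCommGrpCat.of (ULift ℤ)) := by
      have : S.X₄ = ⊤ := hVW
      change (presheafToSheaf (Opens.grothendieckTopology X) AddCommGrpCat.{u}).obj
        (yoneda.obj S.X₄ ⋙ AddCommGrpCat.free) ≅ _
      rw [this]
      exact freeTopIso
    refine subsingleton_of_forall_eq 0 fun y ↦ ?_
    have : (Ext.mk₀ e.inv).comp y (zero_add 1) = 0 := Subsingleton.elim (α := Sheaf.H F 1) _ _
    have h2 := congrArg (fun z ↦ (Ext.mk₀ e.hom).comp z (zero_add 1)) this
    simpa using h2
  obtain ⟨ψ, hψ⟩ := Ext.contravariant_sequence_exact₁ S.shortComplex_shortExact F (Ext.mk₀ φ)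
    (zero_add 1) (Subsingleton.elim _ _)
  obtain ⟨ψ, rfl⟩ := Ext.addEquiv₀.symm.surjective ψ
  have hψ' : S.shortComplex.f ≫ ψ = φ := by
    apply (Ext.mk₀_bijective _ _).injective
    rw [← hψ, ← Ext.mk₀_comp_mk₀]
    rfl
  have h3 := shortComplex_f_comp S ψ
  have h4 : x = freeHomEquiv F (V ⊓ W) φ := by simp [φ]
  rw [← hψ', h3] at h4
  -- The first map of the sequence is a difference of two inclusions, whence the sign of the second
  -- summand.
  refine ⟨freeHomEquiv F V (biprod.inl ≫ ψ), - freeHomEquiv F W (biprod.inr ≫ ψ), ?_⟩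
  rw [h4, map_neg, ← sub_eq_add_neg, ← freeHomEquiv_naturality, ← freeHomEquiv_naturality]
  exact freeHomEquiv_sub _ _ _ _

end Cohomology

end

section


/-! ### Pullback of modules -/

section Pullback

open Scheme.Modules

theorem mres_self {X : Scheme.{u}} (M : X.Modules) {V : X.Opens} (h : V ≤ V) (a : Γ(M, V)) :
    mres M h a = a := by
  have : (homOfLE h).op = 𝟙 (op V) := rfl
  rw [mres, this, M.presheaf.map_id]; rfl

theorem res_self {X : Scheme.{u}} {V : X.Opens} (h : V ≤ V) (a : Γ(X, V)) :
    res h a = a := by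
  have : (homOfLE h).op = 𝟙 (op V) := rfl
  rw [res, this, X.presheaf.map_id]; rfl

theorem mres_app {X : Scheme.{u}} {M N : X.Modules} (φ : M ⟶ N) {V W : X.Opens} (h : W ≤ V)
    (a : Γ(M, V)) : mres N h (φ.app V a) = φ.app W (mres M h a) :=
  congr($(φ.mapPresheaf.naturality (homOfLE h).op) a).symm

/-- A morphism of `𝒪_X`-modules from its action on sections. -/
def modulesHomMk {X : Scheme.{u}} {M N : X.Modules} (φ : ∀ U : X.Opens, Γ(M, U) →+ Γ(N, U))
    (hres : ∀ (U V : X.Opens) (h : V ≤ U) (a : Γ(M, U)), mres N h (φ U a) = φ V (mres M h a))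
    (hsmul : ∀ (U : X.Opens) (r : Γ(X, U)) (a : Γ(M, U)), φ U (r • a) = r • φ U a) : M ⟶ N :=
  (fullyFaithfulToPresheafOfModules).preimage
    (X := M) (Y := N)
    (PresheafOfModules.homMk (M₁ := M.val) (M₂ := N.val)
      { app := fun U ↦ AddCommGrpCat.ofHom (φ U.unop)
        naturality := fun U V i ↦ by
          refine AddCommGrpCat.hom_ext (AddMonoidHom.ext fun a ↦ ?_)
          exact (hres U.unop V.unop i.unop.le a).symm }
      (fun U r a ↦ hsmul U.unop r a))

theorem modulesHomMk_app {X : Scheme.{u}} {M N : X.Modules} (φ : ∀ U : X.Opens, Γ(M, U) →+ Γ(N, U))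
    (hres : ∀ (U V : X.Opens) (h : V ≤ U) (a : Γ(M, U)), mres N h (φ U a) = φ V (mres M h a))
    (hsmul : ∀ (U : X.Opens) (r : Γ(X, U)) (a : Γ(M, U)), φ U (r • a) = r • φ U a)
    (U : X.Opens) (a : Γ(M, U)) : (modulesHomMk φ hres hsmul).app U a = φ U a := rfl

/-- The module `V ↦ Γ(M, U ⊓ V)`. -/
abbrev extendFrom {X : Scheme.{u}} (M : X.Modules) (U : X.Opens) : X.Modules :=
  (pushforward U.ι).obj (M.restrict U.ι)

abbrev traceOn {X : Scheme.{u}} (U V : X.Opens) : X.Opens := U.ι ''ᵁ (U.ι ⁻¹ᵁ V)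

theorem traceOn_eq {X : Scheme.{u}} (U V : X.Opens) : traceOn U V = U ⊓ V := by
  rw [traceOn, Scheme.Hom.image_preimage_eq_opensRange_inf, Scheme.Opens.opensRange_ι]

theorem traceOn_le_left {X : Scheme.{u}} (U V : X.Opens) : traceOn U V ≤ U :=
  (traceOn_eq U V).le.trans inf_le_left

theorem traceOn_le_right {X : Scheme.{u}} (U V : X.Opens) : traceOn U V ≤ V :=
  (traceOn_eq U V).le.trans inf_le_right

theorem le_traceOn {X : Scheme.{u}} {U V W : X.Opens} (h : W ≤ U) (h' : W ≤ V) :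
    W ≤ traceOn U V :=
  (le_inf h h').trans (traceOn_eq U V).ge

/-- Sections of `extendFrom M U`. -/
def toExtend {X : Scheme.{u}} (M : X.Modules) (U V : X.Opens) :
    Γ(M, traceOn U V) ≃+ Γ(extendFrom M U, V) := AddEquiv.refl _

theorem mres_toExtend {X : Scheme.{u}} (M : X.Modules) (U : X.Opens) {V W : X.Opens} (h : W ≤ V)
    (a : Γ(M, traceOn U V)) : mres (extendFrom M U) h (toExtend M U V a) =
      toExtend M U W (mres M (le_traceOn (traceOn_le_left _ _)
        ((traceOn_le_right _ _).trans h)) a) := rfl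

theorem toExtend_smul {X : Scheme.{u}} (M : X.Modules) (U V : X.Opens) (r : Γ(X, V))
    (a : Γ(M, traceOn U V)) :
    toExtend M U V (res (traceOn_le_right U V) r • a) = r • toExtend M U V a := by
  have : res (traceOn_le_right U V) r = (U.ι.appIso _).inv (U.ι.app V r) := by
    have := U.ι.app_appIso_inv V
    exact congr($this r).symm
  rw [this]
  rfl

variable {X Y : Scheme.{u}} (f : Y ⟶ X) (M : X.Modules)

/-- Pullback of sections. -/
def pullSec (U : X.Opens) : Γ(M, U) →+ Γ((pullback f).obj M, f ⁻¹ᵁ U) :=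
  (((pullbackPushforwardAdjunction f).unit.app M).app U).hom

theorem mres_pullSec {U V : X.Opens} (h : V ≤ U) (m : Γ(M, U)) :
    mres _ (f.preimage_mono h) (pullSec f M U m) = pullSec f M V (mres M h m) :=
  mres_app ((pullbackPushforwardAdjunction f).unit.app M) h m

theorem pullSec_smul (U : X.Opens) (r : Γ(X, U)) (m : Γ(M, U)) :
    pullSec f M U (r • m) = f.app U r • pullSec f M U m :=
  ((pullbackPushforwardAdjunction f).unit.app M).app_smul r m

variable {M}

/-- The pullback is used only through its adjunction with the pushforward: a morphism out of it is
the same as a morphism M → f_*N, hence is known from its values on pulled back sections. -/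
theorem pullback_hom_ext {N : Y.Modules} (φ ψ : (pullback f).obj M ⟶ N)
    (h : ∀ (U : X.Opens) (m : Γ(M, U)),
      φ.app _ (pullSec f M U m) = ψ.app _ (pullSec f M U m)) : φ = ψ := by
  apply ((pullbackPushforwardAdjunction f).homEquiv _ _).injective
  rw [Adjunction.homEquiv_unit, Adjunction.homEquiv_unit]
  apply Scheme.Modules.hom_ext
  intro U
  exact AddCommGrpCat.hom_ext (AddMonoidHom.ext fun m ↦ h U m)

theorem exists_pullback_hom {N : Y.Modules} (θ : ∀ U : X.Opens, Γ(M, U) →+ Γ(N, f ⁻¹ᵁ U))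
    (hres : ∀ (U V : X.Opens) (h : V ≤ U) (m : Γ(M, U)),
      mres N (f.preimage_mono h) (θ U m) = θ V (mres M h m))
    (hsmul : ∀ (U : X.Opens) (r : Γ(X, U)) (m : Γ(M, U)), θ U (r • m) = f.app U r • θ U m) :
    ∃ φ : (pullback f).obj M ⟶ N, ∀ (U : X.Opens) (m : Γ(M, U)),
      φ.app _ (pullSec f M U m) = θ U m := by
  let ψ : M ⟶ (pushforward f).obj N := modulesHomMk (fun U ↦ θ U) hres hsmul
  refine ⟨((pullbackPushforwardAdjunction f).homEquiv _ _).symm ψ, fun U m ↦ ?_⟩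
  have h : (pullbackPushforwardAdjunction f).unit.app M ≫
      (pushforward f).map (((pullbackPushforwardAdjunction f).homEquiv _ _).symm ψ) = ψ := by
    exact (Adjunction.homEquiv_unit ..).symm.trans (Equiv.apply_symm_apply _ _)
  exact congr(($h).app U m)

/-- The structure sheaf as a module. -/
abbrev unitModule (Y : Scheme.{u}) : Y.Modules := SheafOfModules.unit Y.ringCatSheaf

/-- Sections of the structure sheaf as a module. -/
def toUnit (V : Y.Opens) : Γ(Y, V) ≃+ Γ(unitModule Y, V) := AddEquiv.refl _

theorem mres_toUnit {V W : Y.Opens} (h : W ≤ V) (a : Γ(Y, V)) :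
    mres (unitModule Y) h (toUnit V a) = toUnit W (res h a) := rfl

theorem smul_toUnit (V : Y.Opens) (r a : Γ(Y, V)) :
    r • toUnit V a = toUnit V (r * a) := rfl

theorem app_res {U V : X.Opens} (h : V ≤ U) (a : Γ(X, U)) :
    f.app V (res h a) = res (f.preimage_mono h) (f.app U a) :=
  congr($(f.naturality (homOfLE h).op) a)

/-- A linear functional on the restriction of `M` to `U`. -/
structure LocalFunctional {X : Scheme.{u}} (M : X.Modules) (U : X.Opens) where
  toFun : ∀ V : X.Opens, V ≤ U → Γ(M, V) →+ Γ(X, V)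
  map_res : ∀ (V W : X.Opens) (hV : V ≤ U) (h : W ≤ V) (m : Γ(M, V)),
    res h (toFun V hV m) = toFun W (h.trans hV) (mres M h m)
  map_smul : ∀ (V : X.Opens) (hV : V ≤ U) (r : Γ(X, V)) (m : Γ(M, V)),
    toFun V hV (r • m) = r * toFun V hV m

/-- Functionals pull back. -/
theorem LocalFunctional.exists_pullback {U : X.Opens} (l : LocalFunctional M U) :
    ∃ l' : LocalFunctional ((pullback f).obj M) (f ⁻¹ᵁ U), ∀ (V : X.Opens) (hV : V ≤ U)
      (m : Γ(M, V)), l'.toFun _ (f.preimage_mono hV) (pullSec f M V m) = f.app V (l.toFun V hV m) := by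
  -- The functional lives only over U, whereas the adjunction needs a morphism of sheaves on all of
  -- X. Taking W ↦ Γ(Y, f⁻¹U ⊓ W) as target turns it into one.
  let N := extendFrom (unitModule Y) (f ⁻¹ᵁ U)
  have hle : ∀ V : X.Opens, traceOn (f ⁻¹ᵁ U) (f ⁻¹ᵁ V) ≤ f ⁻¹ᵁ (U ⊓ V) := fun V ↦
    (traceOn_eq _ _).le
  let θ : ∀ V : X.Opens, Γ(M, V) →+ Γ(N, f ⁻¹ᵁ V) := fun V ↦
    (toExtend (unitModule Y) (f ⁻¹ᵁ U) (f ⁻¹ᵁ V)).toAddMonoidHom.comp <|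
      (toUnit (traceOn (f ⁻¹ᵁ U) (f ⁻¹ᵁ V))).toAddMonoidHom.comp <|
        (res (hle V)).toAddMonoidHom.comp <|
          (f.app (U ⊓ V)).hom.toAddMonoidHom.comp <|
            (l.toFun (U ⊓ V) inf_le_left).comp (mres M inf_le_right)
  have hθ : ∀ (V : X.Opens) (m : Γ(M, V)), θ V m = toExtend (unitModule Y) (f ⁻¹ᵁ U) (f ⁻¹ᵁ V)
      (toUnit _ (res (hle V) (f.app (U ⊓ V) (l.toFun (U ⊓ V) inf_le_left
        (mres M inf_le_right m))))) := fun _ _ ↦ rfl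
  obtain ⟨φ, hφ⟩ := exists_pullback_hom f (N := N) θ
    (fun V W h m ↦ by
      rw [hθ, hθ, mres_toExtend, mres_toUnit, res_res, mres_mres,
        ← mres_mres M inf_le_right (inf_le_inf_left U h), ← l.map_res _ _ inf_le_left, app_res,
        res_res])
    (fun V r m ↦ by
      rw [hθ, hθ, mres_smul, l.map_smul, map_mul, map_mul, app_res, res_res, ← smul_toUnit,
        ← toExtend_smul])
  let F : ∀ V : Y.Opens, V ≤ f ⁻¹ᵁ U → Γ((pullback f).obj M, V) →+ Γ(Y, V) := fun V hV ↦
    (res (le_traceOn hV le_rfl)).toAddMonoidHom.comp <|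
        (toUnit _).symm.toAddMonoidHom.comp <|
          (toExtend (unitModule Y) (f ⁻¹ᵁ U) V).symm.toAddMonoidHom.comp (φ.app V).hom
  have hF : ∀ (V : Y.Opens) (hV) (s) (a), φ.app V s = toExtend (unitModule Y) (f ⁻¹ᵁ U) V
      (toUnit _ a) → F V hV s = res (le_traceOn hV le_rfl) a := fun V hV s a h ↦
    congrArg (fun z ↦ res (le_traceOn hV le_rfl) ((toUnit _).symm
      ((toExtend (unitModule Y) (f ⁻¹ᵁ U) V).symm z))) h
  have hsurj : ∀ (V : Y.Opens) (s), ∃ a, φ.app V s = toExtend (unitModule Y) (f ⁻¹ᵁ U) V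
      (toUnit _ a) := fun V s ↦ ⟨(toUnit _).symm ((toExtend _ _ _).symm (φ.app V s)), by
      rw [AddEquiv.apply_symm_apply]; exact (AddEquiv.apply_symm_apply (toExtend _ _ _) _).symm⟩
  refine ⟨⟨F, fun V W hV h m ↦ ?_, fun V hV r m ↦ ?_⟩, fun V hV m ↦ ?_⟩
  · obtain ⟨a, ha⟩ := hsurj V m
    have hb : φ.app W (mres _ h m) = toExtend (unitModule Y) (f ⁻¹ᵁ U) W (toUnit _
        (res (le_traceOn (traceOn_le_left _ _) ((traceOn_le_right _ _).trans h)) a)) := by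
      rw [← mres_app, ha, mres_toExtend, mres_toUnit]
    rw [hF _ hV _ _ ha, hF _ (h.trans hV) _ _ hb, res_res, res_res]
  · obtain ⟨a, ha⟩ := hsurj V m
    have hb : φ.app V (r • m) = toExtend (unitModule Y) (f ⁻¹ᵁ U) V
        (toUnit _ (res (traceOn_le_right _ _) r * a)) := by
      rw [Scheme.Modules.Hom.app_smul, ha, ← toExtend_smul, smul_toUnit]
    rw [hF _ hV _ _ ha, hF _ hV _ _ hb, map_mul, res_res, res_self]
  have hVU : V ≤ U ⊓ V := le_inf hV le_rfl
  have : l.toFun V hV m = res hVU (l.toFun (U ⊓ V) inf_le_left (mres M inf_le_right m)) := by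
    rw [l.map_res, mres_mres, mres_self]
  rw [this, app_res]
  exact (hF _ (f.preimage_mono hV) _ _ ((hφ V m).trans (hθ V m))).trans (res_res _ _ _)

/-- Sections generating a module near a point generate its pullback. -/
theorem eq_sum_of_pullback {ι : Type*} [Fintype ι] {U : X.Opens} (e : ι → Γ(M, U))
    (l : ι → LocalFunctional M U)
    (hl : ∀ (V : X.Opens) (hV : V ≤ U) (m : Γ(M, V)),
      m = ∑ j, (l j).toFun V hV m • mres M hV (e j))
    (l' : ι → LocalFunctional ((pullback f).obj M) (f ⁻¹ᵁ U))
    (hl' : ∀ (j : ι) (V : X.Opens) (hV : V ≤ U) (m : Γ(M, V)),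
      (l' j).toFun _ (f.preimage_mono hV) (pullSec f M V m) = f.app V ((l j).toFun V hV m))
    (V : Y.Opens) (hV : V ≤ f ⁻¹ᵁ U) (s : Γ((pullback f).obj M, V)) :
    s = ∑ j, (l' j).toFun V hV s • mres _ hV (pullSec f M U (e j)) := by
  let E := (pullback f).obj M
  let N := extendFrom E (f ⁻¹ᵁ U)
  -- The claim says that two morphisms E → N agree: the restriction r, and the expansion r' in the
  -- pulled back generators. By the adjunction this may be tested on pulled back sections, where it
  -- is the pullback of `hl`.
  let r : E ⟶ N := modulesHomMk
    (fun W ↦ (toExtend E (f ⁻¹ᵁ U) W).toAddMonoidHom.comp (mres E (traceOn_le_right _ _)))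
    (fun W W' h a ↦ by
      simp only [AddMonoidHom.comp_apply, AddEquiv.coe_toAddMonoidHom]
      rw [mres_toExtend, mres_mres, mres_mres])
    (fun W c a ↦ by
      simp only [AddMonoidHom.comp_apply, AddEquiv.coe_toAddMonoidHom]
      rw [mres_smul, toExtend_smul])
  let w : ∀ W : Y.Opens, Γ(E, W) →+ Γ(N, W) := fun W ↦
    (toExtend E (f ⁻¹ᵁ U) W).toAddMonoidHom.comp
      { toFun := fun a ↦ ∑ j, (l' j).toFun _ (traceOn_le_left _ _)
          (mres E (traceOn_le_right (f ⁻¹ᵁ U) W) a) •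
            mres E (traceOn_le_left _ _) (pullSec f M U (e j))
        map_zero' := by simp
        map_add' := fun a b ↦ by simp only [map_add, add_smul, Finset.sum_add_distrib] }
  have hw : ∀ W a, w W a = toExtend E (f ⁻¹ᵁ U) W (∑ j, (l' j).toFun _ (traceOn_le_left _ _)
          (mres E (traceOn_le_right (f ⁻¹ᵁ U) W) a) •
            mres E (traceOn_le_left _ _) (pullSec f M U (e j))) := fun _ _ ↦ rfl
  let r' : E ⟶ N := modulesHomMk w
    (fun W W' h a ↦ by
      rw [hw, hw, mres_toExtend, map_sum]
      congr 1
      refine Finset.sum_congr rfl fun j _ ↦ ?_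
      rw [mres_smul, (l' j).map_res, mres_mres, mres_mres, mres_mres])
    (fun W c a ↦ by
      rw [hw, hw, ← toExtend_smul, Finset.smul_sum]
      congr 1
      refine Finset.sum_congr rfl fun j _ ↦ ?_
      rw [mres_smul, (l' j).map_smul, mul_smul])
  have hr : r = r' := by
    refine pullback_hom_ext f _ _ fun W m ↦ ?_
    rw [modulesHomMk_app, modulesHomMk_app, hw]
    simp only [AddMonoidHom.comp_apply, AddEquiv.coe_toAddMonoidHom]
    congr 1
    have hWU : traceOn (f ⁻¹ᵁ U) (f ⁻¹ᵁ W) ≤ f ⁻¹ᵁ (U ⊓ W) := (traceOn_eq _ _).le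
    have key : mres E (traceOn_le_right (f ⁻¹ᵁ U) (f ⁻¹ᵁ W)) (pullSec f M W m) =
        mres E hWU (pullSec f M (U ⊓ W) (mres M inf_le_right m)) := by
      rw [← mres_pullSec, mres_mres]
    rw [key]
    conv_lhs => rw [hl (U ⊓ W) inf_le_left (mres M inf_le_right m)]
    rw [map_sum, map_sum]
    refine Finset.sum_congr rfl fun j _ ↦ ?_
    rw [← (l' j).map_res _ _ (f.preimage_mono inf_le_left) hWU, hl', pullSec_smul, mres_smul,
      ← mres_pullSec, mres_mres]
  have h1 : r.app V s = r'.app V s := by rw [hr]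
  rw [modulesHomMk_app, modulesHomMk_app, hw] at h1
  simp only [AddMonoidHom.comp_apply, AddEquiv.coe_toAddMonoidHom] at h1
  have h2 := congrArg (mres E (le_traceOn hV le_rfl)) ((toExtend E (f ⁻¹ᵁ U) V).injective h1)
  rw [mres_mres, mres_self, map_sum] at h2
  refine h2.trans (Finset.sum_congr rfl fun j _ ↦ ?_)
  rw [mres_smul, (l' j).map_res, mres_mres, mres_mres, mres_self]

end Pullback

end

section


/-! ### Coordinates on smooth algebras and smooth schemes -/

/-- The differentials of the elements `u j` form a basis of the Kähler differentials of the
algebra `φ : R →+* B`. -/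
def IsCoordinateSystem {R B : Type u} [CommRing R] [CommRing B] (φ : R →+* B) {ι : Type}
    (w : ι → B) : Prop :=
  let := φ.toAlgebra
  ∃ b : Module.Basis ι B (Ω[B⁄R]), ∀ j, b j = KaehlerDifferential.D R B (w j)

/-- Differentials base change along formally étale maps. This moves coordinates to smaller affine
opens, to stalks and to the function field. -/
theorem IsCoordinateSystem.map_of_formallyEtale {R B B' : Type u} [CommRing R] [CommRing B]
    [CommRing B'] {φ : R →+* B} {ι : Type} {w : ι → B} (h : IsCoordinateSystem φ w)
    (ρ : B →+* B') (hρ : ρ.FormallyEtale) :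
    IsCoordinateSystem (ρ.comp φ) (fun j ↦ ρ (w j)) := by
  algebraize [φ, ρ, ρ.comp φ]
  obtain ⟨b, hb⟩ := h
  refine ⟨(b.baseChange B').map (KaehlerDifferential.tensorKaehlerEquivOfFormallyEtale R B B'),
    fun j ↦ ?_⟩
  rw [Module.Basis.map_apply, Module.Basis.baseChange_apply, hb,
    KaehlerDifferential.tensorKaehlerEquivOfFormallyEtale_apply,
    KaehlerDifferential.mapBaseChange_tmul, one_smul, KaehlerDifferential.map_D]
  rfl

/-- Dual derivations of a coordinate system, together with the expansion of an arbitrary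
derivation. -/
theorem IsCoordinateSystem.exists_dual {R B : Type u} [CommRing R] [CommRing B] {φ : R →+* B}
    {ι : Type} [Fintype ι] [DecidableEq ι] {w : ι → B} (h : IsCoordinateSystem φ w) :
    ∃ e : ι → B →+ B, (∀ j a b, e j (a * b) = a * e j b + b * e j a) ∧
      (∀ j r, e j (φ r) = 0) ∧ (∀ i j, e i (w j) = if i = j then 1 else 0) ∧
      ∀ (M : Type u) [AddCommGroup M] [Module B M] (d : B →+ M),
        (∀ a b, d (a * b) = a • d b + b • d a) → (∀ r, d (φ r) = 0) →
        ∀ a, d a = ∑ j, e j a • d (w j) := by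
  classical
  let := φ.toAlgebra
  obtain ⟨b, hb⟩ := h
  refine ⟨fun j ↦ (b.coord j).toAddMonoidHom.comp
    (KaehlerDifferential.D R B).toLinearMap.toAddMonoidHom, ?_, ?_, ?_, ?_⟩
  · intro j a c
    simp
  · intro j r
    have : KaehlerDifferential.D R B (φ r) = 0 := (KaehlerDifferential.D R B).map_algebraMap r
    simp [this]
  · intro i j
    have : b.coord i (KaehlerDifferential.D R B (w j)) = if i = j then 1 else 0 := by
      rw [← hb, Module.Basis.coord_apply, b.repr_self, Finsupp.single_apply]
      simp [eq_comm]
    exact this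
  · intro M _ _ d hd hφ a
    let : Module R M := Module.compHom M φ
    have : IsScalarTower R B M := ⟨fun r x m ↦ by
      rw [Algebra.smul_def, mul_smul]; rfl⟩
    -- Such a d is an R-derivation, so it factors through a B-linear map on Ω; expanding the
    -- universal differential of a in the basis dw_j gives the formula.
    let D' : Derivation R B M := Derivation.mk' ⟨⟨d, d.map_add⟩, fun r x ↦ by
      change d (r • x) = φ r • d x
      rw [Algebra.smul_def]
      change d (φ r * x) = _
      rw [hd, hφ, smul_zero, add_zero]⟩ hd
    have h1 : ∀ x, d x = D'.liftKaehlerDifferential (KaehlerDifferential.D R B x) := fun x ↦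
      (D'.liftKaehlerDifferential_comp_D x).symm
    rw [h1 a]
    conv_lhs => rw [← b.sum_repr (KaehlerDifferential.D R B a), map_sum]
    refine Finset.sum_congr rfl fun j _ ↦ ?_
    rw [map_smul, hb, ← h1]
    rfl

/-- In a submersive presentation the differentials of the generators not matched with a relation
form a basis of Ω; their number is the relative dimension. -/
theorem exists_isCoordinateSystem_of_isStandardSmooth {R B : Type u} [CommRing R] [CommRing B]
    (φ : R →+* B) (n : ℕ) (h : φ.IsStandardSmoothOfRelativeDimension n) :
    ∃ w : Fin n → B, IsCoordinateSystem φ w := by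
  algebraize [φ]
  obtain ⟨ι, σ, _, _, P, hP⟩ := Algebra.IsStandardSmoothOfRelativeDimension.out (n := n) (R := R) (S := B)
  classical
  have := Fintype.ofFinite ι
  have := Fintype.ofFinite σ
  have hc : Fintype.card ((Set.range P.map)ᶜ : Set ι) = n := by
    rw [Fintype.card_compl_set, Set.card_range_of_injective P.map_inj, ← hP]
    simp [Algebra.Presentation.dimension, Nat.card_eq_fintype_card]
  let e : ((Set.range P.map)ᶜ : Set ι) ≃ Fin n := Fintype.equivFinOfCardEq hc
  refine ⟨fun j ↦ P.val (e.symm j), P.basisKaehler.reindex e, fun j ↦ ?_⟩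
  rw [Module.Basis.reindex_apply, P.basisKaehler_apply]

theorem le_preimage_top {S X : Scheme.{u}} (s : X ⟶ S) (V : X.Opens) : V ≤ s ⁻¹ᵁ ⊤ := le_top

/-- The structure map from functions on the base. -/
def baseMap {S X : Scheme.{u}} (s : X ⟶ S) (V : X.Opens) : Γ(S, ⊤) →+* Γ(X, V) :=
  (s.appLE ⊤ V (le_preimage_top s V)).hom

theorem res_baseMap {S X : Scheme.{u}} (s : X ⟶ S) {V W : X.Opens} (h : W ≤ V) :
    (res h).comp (baseMap s V) = baseMap s W := by
  rw [res, baseMap, ← CommRingCat.hom_comp, Scheme.Hom.appLE_map]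
  rfl

/-- The identity of X is étale, and restriction between affine opens is one of the ring maps it
induces. -/
theorem formallyEtale_res {X : Scheme.{u}} {V W : X.Opens} (hV : IsAffineOpen V)
    (hW : IsAffineOpen W) (h : W ≤ V) : (res h).FormallyEtale := by
  have := Scheme.Hom.etale_appLE (𝟙 X) hV hW h
  have e : (Scheme.Hom.appLE (𝟙 X) V W h) = X.presheaf.map (homOfLE h).op := by
    simp only [Scheme.Hom.appLE, Scheme.Hom.id_app]
    exact Category.id_comp _
  rw [e] at this
  exact this.formallyEtale

theorem formallyEtale_germ {X : Scheme.{u}} {V : X.Opens} (hV : IsAffineOpen V) (x : X)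
    (hx : x ∈ V) : (X.presheaf.germ V x hx).hom.FormallyEtale := by
  let : Algebra Γ(X, V) (X.presheaf.stalk x) := (X.presheaf.germ V x hx).hom.toAlgebra
  have : IsLocalization.AtPrime (X.presheaf.stalk x) (hV.primeIdealOf ⟨x, hx⟩).asIdeal :=
    hV.isLocalization_stalk ⟨x, hx⟩
  exact Algebra.FormallyEtale.of_isLocalization (hV.primeIdealOf ⟨x, hx⟩).asIdeal.primeCompl

theorem le_iSup_affineOpens {X : Scheme.{u}} (V : X.Opens) :
    V ≤ ⨆ W : {W : X.Opens // IsAffineOpen W ∧ W ≤ V}, W.1 := by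
  intro x hx
  obtain ⟨W, hW, hxW, h⟩ := exists_isAffineOpen_mem_and_subset hx
  exact Opens.mem_iSup.2 ⟨⟨W, hW, h⟩, hxW⟩

theorem IsCoordinateSystem.res {S X : Scheme.{u}} {s : X ⟶ S} {U W : X.Opens} {ι : Type}
    {w : ι → Γ(X, U)} (hw : IsCoordinateSystem (baseMap s U) w) (hU : IsAffineOpen U)
    (hW : IsAffineOpen W) (h : W ≤ U) :
    IsCoordinateSystem (baseMap s W) (fun j ↦ FreeCurves.res h (w j)) := by
  rw [← res_baseMap s h]
  exact hw.map_of_formallyEtale _ (formallyEtale_res hU hW h)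

theorem IsCoordinateSystem.germ {S X : Scheme.{u}} {s : X ⟶ S} {U : X.Opens} {ι : Type}
    {w : ι → Γ(X, U)} (hw : IsCoordinateSystem (baseMap s U) w) (hU : IsAffineOpen U)
    (x : X) (hx : x ∈ U) :
    IsCoordinateSystem ((X.presheaf.germ U x hx).hom.comp (baseMap s U))
      (fun j ↦ X.presheaf.germ U x hx (w j)) :=
  hw.map_of_formallyEtale _ (formallyEtale_germ hU x hx)

/-- The derivations dual to a coordinate system on an affine open `U`, as sections of the tangent
sheaf. -/
theorem exists_dual_tangentSections {S X : Scheme.{u}} [Subsingleton S] (s : X ⟶ S)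
    {U : X.Opens} (hU : IsAffineOpen U) {ι : Type} [Fintype ι] [DecidableEq ι] {w : ι → Γ(X, U)}
    (hw : IsCoordinateSystem (baseMap s U) w) :
    ∃ e : ι → tangentSections s U,
      (∀ i j (V : {V : X.Opens // V ≤ U}), (e i).1 V (res V.2 (w j)) = if i = j then 1 else 0) ∧
      ∀ (V : {V : X.Opens // V ≤ U}), IsAffineOpen V.1 →
        ∀ (M : Type u) [AddCommGroup M] [Module Γ(X, V.1) M] (d : Γ(X, V.1) →+ M),
        (∀ a b, d (a * b) = a • d b + b • d a) → (∀ r, d (baseMap s V.1 r) = 0) →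
        ∀ a, d a = ∑ j, (e j).1 V a • d (res V.2 (w j)) := by
  -- Dual derivations exist on each affine open of U. They are determined by their values on the
  -- coordinates, hence are compatible with restriction, and they glue to derivations over all opens
  -- of U.
  have hdual := fun W : {W : X.Opens // IsAffineOpen W ∧ W ≤ U} ↦
    (hw.res hU W.2.1 W.2.2).exists_dual
  choose e he1 he2 he3 he4 using hdual
  -- compatibility with restriction between affine opens
  have comp : ∀ (W W' : {W : X.Opens // IsAffineOpen W ∧ W ≤ U}) (h : W'.1 ≤ W.1) (i : ι)
      (a : Γ(X, W.1)), res h (e W i a) = e W' i (res h a) := by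
    intro W W' h i a
    let : Module Γ(X, W.1) Γ(X, W'.1) := Module.compHom _ (res h)
    have := he4 W Γ(X, W'.1) ((e W' i).comp (res h).toAddMonoidHom)
      (fun a b ↦ by
        change e W' i (res h (a * b)) = res h a * _ + res h b * _
        rw [map_mul, he1]; rfl)
      (fun r ↦ by
        change e W' i (res h (baseMap s W.1 r)) = 0
        rw [← RingHom.comp_apply, res_baseMap, he2]) a
    refine Eq.trans ?_ this.symm
    have h1 : ∀ j, ((e W' i).comp (res h).toAddMonoidHom) (res W.2.2 (w j)) =
        if i = j then 1 else 0 := fun j ↦ by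
      change e W' i (res h (res W.2.2 (w j))) = _
      rw [res_res, he3]
    rw [Finset.sum_eq_single i]
    · rw [h1, if_pos rfl]
      exact (mul_one _).symm
    · intro j _ hj
      rw [h1, if_neg (Ne.symm hj), smul_zero]
    · simp
  have ext : ∀ (V : X.Opens) (a b : Γ(X, V)), (∀ (W : X.Opens) (_ : IsAffineOpen W) (h : W ≤ V),
      res h a = res h b) → a = b := fun V a b hab ↦
    res_ext (fun W : {W : X.Opens // IsAffineOpen W ∧ W ≤ V} ↦ W.1) (fun W ↦ W.2.2)
      (le_iSup_affineOpens V) a b fun W ↦ hab W.1 W.2.1 W.2.2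
  have ex : ∀ (i : ι) (V : {V : X.Opens // V ≤ U}) (a : Γ(X, V.1)), ∃ b : Γ(X, V.1),
      ∀ (W : X.Opens) (hW : IsAffineOpen W) (h : W ≤ V.1),
        res h b = e ⟨W, hW, h.trans V.2⟩ i (res h a) := by
    intro i V a
    obtain ⟨b, hb⟩ := res_glue (fun W : {W : X.Opens // IsAffineOpen W ∧ W ≤ V.1} ↦ W.1)
      (fun W ↦ W.2.2) (le_iSup_affineOpens V.1)
      (fun W ↦ e ⟨W.1, W.2.1, W.2.2.trans V.2⟩ i (res W.2.2 a)) fun W W' ↦ by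
        refine ext _ _ _ fun Z hZ h ↦ ?_
        rw [res_res, res_res, comp ⟨W.1, _⟩ ⟨Z, hZ, (h.trans inf_le_left).trans (W.2.2.trans V.2)⟩,
          comp ⟨W'.1, _⟩ ⟨Z, hZ, (h.trans inf_le_left).trans (W.2.2.trans V.2)⟩, res_res, res_res]
    exact ⟨b, fun W hW h ↦ hb ⟨W, hW, h⟩⟩
  choose E hE using ex
  have hEaff : ∀ (i : ι) (V : {V : X.Opens // V ≤ U}) (hV : IsAffineOpen V.1) (a : Γ(X, V.1)),
      E i V a = e ⟨V.1, hV, V.2⟩ i a := fun i V hV a ↦ by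
    have := hE i V a V.1 hV le_rfl
    rwa [res_self, res_self] at this
  refine ⟨fun i ↦ ⟨fun V ↦ ⟨⟨E i V, ?_⟩, ?_⟩, ?_, ?_, ?_⟩, ?_, ?_⟩
  · exact ext _ _ _ fun W hW h ↦ by simp [hE i V _ W hW h]
  · exact fun a b ↦ ext _ _ _ fun W hW h ↦ by
      rw [map_add, hE i V _ W hW h, hE i V _ W hW h, hE i V _ W hW h, map_add, map_add]
  · exact fun V a b ↦ ext _ _ _ fun W hW h ↦ by
      simp only [AddMonoidHom.coe_mk, ZeroHom.coe_mk]
      rw [map_add, map_mul, map_mul, hE i V _ W hW h, hE i V _ W hW h, hE i V _ W hW h, map_mul,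
        he1]
  · intro V V' h a
    refine ext _ _ _ fun W hW h' ↦ ?_
    simp only [AddMonoidHom.coe_mk, ZeroHom.coe_mk]
    rw [res_res, hE i V _ W hW, hE i V' _ W hW, res_res]
  · intro V T h c
    refine ext _ _ _ fun W hW h' ↦ ?_
    simp only [AddMonoidHom.coe_mk, ZeroHom.coe_mk]
    rw [hE i V _ W hW, map_zero]
    have key : FreeCurves.res h' (s.appLE T V.1 h c) = s.appLE T W (h'.trans h) c := by
      rw [FreeCurves.res, ← CommRingCat.comp_apply, Scheme.Hom.appLE_map]
    rw [key]
    -- The base has one point, so a nonempty W forces T = ⊤, where the vanishing is known; for empty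
    -- W the ring is zero.
    by_cases hne : (W : Set X).Nonempty
    · obtain ⟨x, hx⟩ := hne
      have hT : T = ⊤ := by
        ext y
        simp only [Opens.coe_top, Set.mem_univ, iff_true, SetLike.mem_coe]
        rw [Subsingleton.elim y (s x)]
        exact h (h' hx)
      subst hT
      exact he2 _ i c
    · have : W = ⊥ := by
        ext y
        simpa using fun hy ↦ hne ⟨y, hy⟩
      subst this
      exact Subsingleton.elim _ _
  · intro i j V
    refine ext _ _ _ fun W hW h ↦ ?_
    simp only [AddMonoidHom.coe_mk, ZeroHom.coe_mk]
    rw [hE i V _ W hW h, res_res, he3]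
    split_ifs <;> simp
  · intro V hV M _ _ d hd hφ a
    refine (he4 ⟨V.1, hV, V.2⟩ M d hd hφ a).trans (Finset.sum_congr rfl fun j _ ↦ ?_)
    exact congrArg (· • d (FreeCurves.res V.2 (w j))) (hEaff j V hV a).symm

/-- An affine open of `X` with two coordinates and the dual vector fields. -/
structure Chart {S X : Scheme.{u}} (s : X ⟶ S) where
  /-- The domain of the chart. -/
  U : X.Opens
  isAffineOpen : IsAffineOpen U
  /-- The coordinates. -/
  w : Fin 2 → Γ(X, U)
  isCoordinateSystem : IsCoordinateSystem (baseMap s U) w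
  /-- The dual vector fields. -/
  e : Fin 2 → tangentSections s U
  dual : ∀ i j (V : {V : X.Opens // V ≤ U}),
    (e i).1 V (res V.2 (w j)) = if i = j then 1 else 0
  expand : ∀ (V : {V : X.Opens // V ≤ U}), IsAffineOpen V.1 →
    ∀ (M : Type u) [AddCommGroup M] [Module Γ(X, V.1) M] (d : Γ(X, V.1) →+ M),
    (∀ a b, d (a * b) = a • d b + b • d a) → (∀ r, d (baseMap s V.1 r) = 0) →
    ∀ a, d a = ∑ j, (e j).1 V a • d (res V.2 (w j))

theorem exists_chart {S X : Scheme.{u}} [Subsingleton S] (s : X ⟶ S)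
    [SmoothOfRelativeDimension 2 s] (x : X) : ∃ c : Chart s, x ∈ c.U := by
  obtain ⟨T, hT, V, hV, hx, e, hs⟩ :=
    SmoothOfRelativeDimension.exists_isStandardSmoothOfRelativeDimension (n := 2) (f := s) x
  obtain rfl : T = ⊤ := by
    ext y
    simp only [Opens.coe_top, Set.mem_univ, iff_true, SetLike.mem_coe]
    rw [Subsingleton.elim y (s x)]
    exact e hx
  obtain ⟨w, hw⟩ := exists_isCoordinateSystem_of_isStandardSmooth _ 2 hs
  obtain ⟨e, h1, h2⟩ := exists_dual_tangentSections s hV hw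
  exact ⟨⟨V, hV, w, hw, e, h1, h2⟩, hx⟩

variable {S X : Scheme.{u}} {s : X ⟶ S}

/-- Expansion of a derivation that takes values in a ring over functions on an affine open. -/
theorem Chart.expand_ringHom (c : Chart s) {V : X.Opens} (hV : IsAffineOpen V) (h : V ≤ c.U)
    {A : Type u} [CommRing A] (ρ : Γ(X, V) →+* A) (d : Γ(X, V) →+ A)
    (hd : ∀ a b, d (a * b) = ρ a * d b + ρ b * d a) (hφ : ∀ r, d (baseMap s V r) = 0)
    (a : Γ(X, V)) : d a = ∑ j, ρ ((c.e j).1 ⟨V, h⟩ a) * d (res h (c.w j)) := by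
  let : Module Γ(X, V) A := Module.compHom _ ρ
  exact c.expand ⟨V, h⟩ hV A d hd hφ a

/-- The expansion is available over affine opens; both sides commute with restriction, so an affine
cover of W suffices. -/
theorem Chart.expand_tangentSections (c : Chart s) {V : X.Opens} (h : V ≤ c.U)
    (D : tangentSections s V) (W : {W : X.Opens // W ≤ V}) (a : Γ(X, W.1)) :
    D.1 W a = ∑ j, (c.e j).1 ⟨W.1, W.2.trans h⟩ a * D.1 W (res (W.2.trans h) (c.w j)) := by
  refine res_ext (fun Z : {Z : X.Opens // IsAffineOpen Z ∧ Z ≤ W.1} ↦ Z.1) (fun Z ↦ Z.2.2)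
      (le_iSup_affineOpens W.1) _ _ fun Z ↦ ?_
  have hZ : Z.1 ≤ V := Z.2.2.trans W.2
  rw [D.2.2.1 W ⟨Z.1, hZ⟩ Z.2.2 a,
    c.expand_ringHom Z.2.1 (hZ.trans h) (RingHom.id _) (D.1 ⟨Z.1, hZ⟩) (D.2.1 ⟨Z.1, hZ⟩)
      (D.2.2.2 ⟨Z.1, hZ⟩ ⊤ (le_preimage_top s Z.1)), map_sum]
  refine Finset.sum_congr rfl fun j _ ↦ ?_
  rw [map_mul, D.2.2.1 W ⟨Z.1, hZ⟩ Z.2.2, (c.e j).2.2.1 ⟨W.1, W.2.trans h⟩ ⟨Z.1, hZ.trans h⟩ Z.2.2,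
    res_res]
  rfl

variable (s) in
/-- Evaluation of vector fields at a function, as a functional on the tangent sheaf. -/
def evalAt {U : X.Opens} (w : Γ(X, U)) : LocalFunctional (tangentSheaf s) U where
  toFun V hV :=
    { toFun := fun D : tangentSections s V ↦ D.1 ⟨V, le_rfl⟩ (res hV w)
      map_zero' := rfl
      map_add' := fun _ _ ↦ rfl }
  map_res V W hV h m := by
    have := (m : tangentSections s V).2.2.1 ⟨V, le_rfl⟩ ⟨W, h⟩ h (res hV w)
    rw [res_res] at this
    exact this
  map_smul V hV r m := by
    change res le_rfl r * _ = _
    rw [res_self]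
    rfl

/-- A vector field is the combination of the dual vector fields with coefficients its values on
the coordinates. -/
theorem Chart.eq_sum_evalAt (c : Chart s) (V : X.Opens) (hV : V ≤ c.U)
    (m : Γ(tangentSheaf s, V)) :
    m = ∑ j, (evalAt s (c.w j)).toFun V hV m • mres (tangentSheaf s) hV (c.e j) := by
  rw [Fin.sum_univ_two]
  refine Subtype.ext (funext fun W ↦ AddMonoidHom.ext fun a ↦ ?_)
  refine (c.expand_tangentSections hV m W a).trans ?_
  rw [Fin.sum_univ_two]
  have key : ∀ j, (c.e j).1 ⟨W.1, W.2.trans hV⟩ a *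
      (m : tangentSections s V).1 W (res (W.2.trans hV) (c.w j)) =
      res W.2 ((evalAt s (c.w j)).toFun V hV m) * (c.e j).1 ⟨W.1, W.2.trans hV⟩ a := by
    intro j
    rw [mul_comm]
    congr 1
    have := (m : tangentSections s V).2.2.1 ⟨V, le_rfl⟩ W W.2 (res hV (c.w j))
    rw [res_res] at this
    exact this.symm
  rw [key, key]
  rfl

theorem germ_res {V W : X.Opens} (h : W ≤ V) (x : X) (hx : x ∈ W) (a : Γ(X, V)) :
    X.presheaf.germ W x hx (res h a) = X.presheaf.germ V x (h hx) a :=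
  X.presheaf.germ_res_apply (homOfLE h) x hx a

/-- The dual vector fields of a chart act on stalks. -/
theorem Chart.exists_stalk_dual (c : Chart s) (x : X) (hx : x ∈ c.U) :
    ∃ d : Fin 2 → X.presheaf.stalk x →+ X.presheaf.stalk x,
      (∀ j a b, d j (a * b) = a * d j b + b * d j a) ∧
      (∀ i (V : X.Opens) (hV : V ≤ c.U) (hxV : x ∈ V) (a : Γ(X, V)),
        d i (X.presheaf.germ V x hxV a) = X.presheaf.germ V x hxV ((c.e i).1 ⟨V, hV⟩ a)) ∧
      ∀ (M : Type u) [AddCommGroup M] [Module (X.presheaf.stalk x) M]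
        (d' : X.presheaf.stalk x →+ M),
        (∀ a b, d' (a * b) = a • d' b + b • d' a) →
        (∀ r, d' (X.presheaf.germ c.U x hx (baseMap s c.U r)) = 0) →
        ∀ a, d' a = ∑ j, d j a • d' (X.presheaf.germ c.U x hx (c.w j)) := by
  obtain ⟨d, h1, h2, h3, h4⟩ := (c.isCoordinateSystem.germ c.isAffineOpen x hx).exists_dual
  refine ⟨d, h1, ?_, h4⟩
  intro i V hV hxV a
  -- Over an affine neighbourhood W, expand the composite of the germ map with the stalk derivation.
  -- Its values on the coordinates are 0 and 1, so only the term of `c.e i` survives.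
  obtain ⟨W, hW, hxW, hWV'⟩ := exists_isAffineOpen_mem_and_subset hxV
  have hWV : W ≤ V := hWV'
  have := c.expand_ringHom hW (hWV.trans hV) (X.presheaf.germ W x hxW).hom
    ((d i).comp (X.presheaf.germ W x hxW).hom.toAddMonoidHom)
    (fun a b ↦ by
      change d i (X.presheaf.germ W x hxW (a * b)) = _
      rw [map_mul, h1]
      rfl)
    (fun r ↦ by
      change d i (X.presheaf.germ W x hxW (baseMap s W r)) = _
      rw [← res_baseMap s (hWV.trans hV), RingHom.comp_apply, germ_res]
      exact h2 i r) (res hWV a)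
  have e1 : ∀ j, ((d i).comp (X.presheaf.germ W x hxW).hom.toAddMonoidHom)
      (res (hWV.trans hV) (c.w j)) = if i = j then 1 else 0 := fun j ↦ by
    change d i (X.presheaf.germ W x hxW _) = _
    rw [germ_res, h3]
  change d i (X.presheaf.germ W x hxW _) = _ at this
  rw [germ_res] at this
  rw [this, Finset.sum_eq_single i]
  · rw [e1, if_pos rfl, mul_one, ← (c.e i).2.2.1 ⟨V, hV⟩ ⟨W, hWV.trans hV⟩ hWV a]
    exact germ_res _ _ _ _
  · intro j _ hj
    rw [e1, if_neg hj.symm, mul_zero]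
  · simp

theorem germ_top_surjective [Subsingleton S] (y : S) :
    Function.Surjective (S.presheaf.germ ⊤ y (Opens.mem_top y)) := by
  intro a
  obtain ⟨T, hT, b, rfl⟩ := S.presheaf.exists_germ_eq a
  obtain rfl : T = ⊤ := by
    ext z
    simp only [Opens.coe_top, Set.mem_univ, iff_true, SetLike.mem_coe]
    rwa [Subsingleton.elim z y]
  exact ⟨b, rfl⟩

theorem stalkMap_germ_top (U : X.Opens) (x : X) (hx : x ∈ U) (r : Γ(S, ⊤)) :
    s.stalkMap x (S.presheaf.germ ⊤ (s x) (Opens.mem_top (s x)) r) =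
      X.presheaf.germ U x hx (baseMap s U r) := by
  rw [Scheme.Hom.germ_stalkMap_apply, baseMap, Scheme.Hom.appLE]
  exact (germ_res (le_preimage_top s U) x hx (s.app ⊤ r)).symm

/-- Expanding the universal derivation of the stalk writes every da through the two coordinate
differentials. The coordinates of a chart are thereby admissible in `formOrd`. -/
theorem Chart.isLocalCoordinates (c : Chart s) (x : X) (hx : x ∈ c.U) :
    IsLocalCoordinates s x (X.presheaf.germ c.U x hx (c.w 0))
      (X.presheaf.germ c.U x hx (c.w 1)) := by
  obtain ⟨d, h1, h2, h3⟩ := c.exists_stalk_dual x hx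
  rw [IsLocalCoordinates, eq_top_iff]
  let := (s.stalkMap x).hom.toAlgebra
  have hs : Submodule.span (X.presheaf.stalk x) (Set.range
      (KaehlerDifferential.D (S.presheaf.stalk (s x)) (X.presheaf.stalk x))) = ⊤ :=
    KaehlerDifferential.span_range_derivation _ _
  let N : Submodule (X.presheaf.stalk x) (Ω[X.presheaf.stalk x⁄S.presheaf.stalk (s x)]) :=
    Submodule.span (X.presheaf.stalk x)
      {KaehlerDifferential.D _ _ (X.presheaf.germ c.U x hx (c.w 0)),
        KaehlerDifferential.D _ _ (X.presheaf.germ c.U x hx (c.w 1))}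
  suffices h : ⊤ ≤ N from h
  refine hs.ge.trans (Submodule.span_le.2 ?_)
  rintro _ ⟨a, rfl⟩
  have := h3 (Ω[X.presheaf.stalk x⁄S.presheaf.stalk (s x)])
    (KaehlerDifferential.D (S.presheaf.stalk (s x)) (X.presheaf.stalk x)).toLinearMap.toAddMonoidHom
    (fun a b ↦ (KaehlerDifferential.D (S.presheaf.stalk (s x)) (X.presheaf.stalk x)).leibniz a b)
    (fun r ↦ by
      rw [← stalkMap_germ_top]
      exact (KaehlerDifferential.D (S.presheaf.stalk (s x)) (X.presheaf.stalk x)).map_algebraMap _)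
    a
  change KaehlerDifferential.D _ _ a = _ at this
  rw [Fin.sum_univ_two] at this
  have m0 : KaehlerDifferential.D _ _ (X.presheaf.germ c.U x hx (c.w 0)) ∈ N :=
    Submodule.subset_span (Or.inl rfl)
  have m1 : KaehlerDifferential.D _ _ (X.presheaf.germ c.U x hx (c.w 1)) ∈ N :=
    Submodule.subset_span (Or.inr rfl)
  rw [this]
  exact N.add_mem (N.smul_mem _ m0) (N.smul_mem _ m1)

end

section


/-! ### Valuations of a rational function field -/

open WithZero

/-- The field `K` is generated by `t` over the algebraically closed field `k`, and `v` is the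
family of valuations attached to the points of the projective line, `none` being the point at
infinity. -/
structure IsLineValuation {k K : Type*} [Field k] [Field K] [Algebra k K] (t : K)
    (v : Option k → Valuation K ℤᵐ⁰) : Prop where
  map_const : ∀ q (c : k), c ≠ 0 → v q (algebraMap k K c) = 1
  map_self : ∀ a : k, v (some a) (t - algebraMap k K a) = exp (-1)
  map_of_ne : ∀ a b : k, a ≠ b → v (some a) (t - algebraMap k K b) = 1
  map_infty : ∀ b : k, v none (t - algebraMap k K b) = exp 1
  exists_prod : ∀ x : K, x ≠ 0 → ∃ (c : k) (n : k →₀ ℤ), c ≠ 0 ∧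
    x = algebraMap k K c * n.prod fun a m ↦ (t - algebraMap k K a) ^ m

namespace IsLineValuation

variable {k K : Type*} [Field k] [Field K] [Algebra k K] {t : K} {v : Option k → Valuation K ℤᵐ⁰}
  (hv : IsLineValuation t v)

include hv

theorem sub_ne_zero (a : k) : t - algebraMap k K a ≠ 0 := by
  intro h
  have := hv.map_self a
  rw [h, map_zero] at this
  exact exp_ne_zero this.symm

theorem map_const_le (q : Option k) (c : k) : v q (algebraMap k K c) ≤ 1 := by
  rcases eq_or_ne c 0 with rfl | hc
  · simp
  · exact (hv.map_const q c hc).le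

theorem map_prod_some (n : k →₀ ℤ) (a : k) :
    v (some a) (n.prod fun b m ↦ (t - algebraMap k K b) ^ m) = exp (-n a) := by
  classical
  rw [Finsupp.prod, map_prod]
  by_cases ha : a ∈ n.support
  · rw [Finset.prod_eq_single_of_mem a ha]
    · rw [map_zpow₀, hv.map_self, ← exp_zsmul]; simp
    · intro b _ hb
      rw [map_zpow₀, hv.map_of_ne _ _ hb.symm, one_zpow]
  · rw [Finset.prod_eq_one]
    · rw [Finsupp.notMem_support_iff.1 ha]; simp
    · intro b hb
      rw [map_zpow₀, hv.map_of_ne _ _ (by rintro rfl; exact ha hb), one_zpow]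

theorem map_prod_none (n : k →₀ ℤ) :
    v none (n.prod fun b m ↦ (t - algebraMap k K b) ^ m) = exp (n.sum fun _ m ↦ m) := by
  classical
  rw [Finsupp.prod, map_prod, Finsupp.sum]
  induction n.support using Finset.induction_on with
  | empty => simp
  | insert a s ha ih =>
    rw [Finset.prod_insert ha, Finset.sum_insert ha, ih, map_zpow₀, hv.map_infty, exp_add,
      ← exp_zsmul]
    simp

/-- The divisor of a nonzero rational function. -/
theorem exists_divisor (x : K) (hx : x ≠ 0) : ∃ n : k →₀ ℤ,
    (∀ a, v (some a) x = exp (-n a)) ∧ v none x = exp (n.sum fun _ m ↦ m) := by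
  obtain ⟨c, n, hc, rfl⟩ := hv.exists_prod x hx
  refine ⟨n, fun a ↦ ?_, ?_⟩
  · rw [map_mul, hv.map_const _ _ hc, one_mul, hv.map_prod_some]
  · rw [map_mul, hv.map_const _ _ hc, one_mul, hv.map_prod_none]

theorem exists_of_divisor (n : k →₀ ℤ) : ∃ g : K, g ≠ 0 ∧
    (∀ a, v (some a) g = exp (-n a)) ∧ v none g = exp (n.sum fun _ m ↦ m) := by
  refine ⟨n.prod fun b m ↦ (t - algebraMap k K b) ^ m, ?_, hv.map_prod_some n, hv.map_prod_none n⟩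
  exact Finset.prod_ne_zero_iff.2 fun a _ ↦ zpow_ne_zero _ (hv.sub_ne_zero a)

theorem finite_one_lt (x : K) : {q | ¬ v q x ≤ 1}.Finite := by
  rcases eq_or_ne x 0 with rfl | hx
  · simp
  obtain ⟨n, hn, -⟩ := hv.exists_divisor x hx
  refine ((n.support.finite_toSet.image some).union (Set.finite_singleton none)).subset ?_
  rintro (_ | a) hq
  · simp
  · refine Or.inl ⟨a, ?_, rfl⟩
    rw [Finset.mem_coe, Finsupp.mem_support_iff]
    intro h
    exact hq (by rw [hn, h]; simp)

/-- A rational function without poles that vanishes at infinity is zero. -/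
theorem eq_zero_of_le (x : K) (h : ∀ a, v (some a) x ≤ 1) (h' : v none x < 1) : x = 0 := by
  by_contra hx
  obtain ⟨n, hn, hn'⟩ := hv.exists_divisor x hx
  rw [hn', ← exp_zero, exp_lt_exp] at h'
  refine absurd h' (not_lt.2 (Finset.sum_nonneg fun a _ ↦ ?_))
  have := h a
  rw [hn, ← exp_zero, exp_le_exp] at this
  change 0 ≤ n a
  omega

/-- Residue fields at the points of the line are `k`. -/
theorem exists_const_lt (q : Option k) (x : K) (hx : v q x ≤ 1) :
    ∃ c : k, v q (x - algebraMap k K c) ≤ exp (-1) := by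
  have hlt : ∀ y : ℤᵐ⁰, y < 1 ↔ y ≤ exp (-1) := by
    intro y
    rcases eq_or_ne y 0 with rfl | hy
    · simp
    · rw [← exp_log hy, ← exp_zero, exp_lt_exp, exp_le_exp]; omega
  simp only [← hlt]
  rcases hx.lt_or_eq with h | h
  · exact ⟨0, by simpa using h⟩
  -- the units with a residue form a group
  let P : K → Prop := fun x ↦ ∃ c : k, c ≠ 0 ∧ v q (x - algebraMap k K c) < 1
  have hP1 : ∀ {x}, P x → v q x = 1 := by
    rintro x ⟨c, hc, h⟩
    have := Valuation.map_add_eq_of_lt_right (v q) (x := x - algebraMap k K c)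
      (y := algebraMap k K c) (by rwa [hv.map_const q c hc])
    rw [sub_add_cancel, hv.map_const q c hc] at this
    exact this
  have hPm : ∀ {x y}, P x → P y → P (x * y) := by
    rintro x y hx ⟨d, hd, h'⟩
    have hx1 := hP1 hx
    obtain ⟨c, hc, h⟩ := hx
    refine ⟨c * d, mul_ne_zero hc hd, ?_⟩
    have e : x * y - algebraMap k K (c * d) =
        x * (y - algebraMap k K d) + (x - algebraMap k K c) * algebraMap k K d := by
      rw [map_mul]; ring
    rw [e]
    refine Valuation.map_add_lt _ ?_ ?_
    · rw [map_mul, hx1, one_mul]; exact h'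
    · rw [map_mul, hv.map_const q d hd, mul_one]; exact h
  have hPi : ∀ {x}, P x → P x⁻¹ := by
    rintro x hx
    have hx1 := hP1 hx
    obtain ⟨c, hc, h⟩ := hx
    have hx0 : x ≠ 0 := by rintro rfl; simp at hx1
    have hc0 : algebraMap k K c ≠ 0 := by simpa using hc
    refine ⟨c⁻¹, inv_ne_zero hc, ?_⟩
    have e : x⁻¹ - algebraMap k K c⁻¹ = -((x - algebraMap k K c) * (x⁻¹ * algebraMap k K c⁻¹)) := by
      rw [map_inv₀]; field_simp; ring
    rw [e, Valuation.map_neg, map_mul, map_mul, map_inv₀, hx1, hv.map_const q _ (inv_ne_zero hc)]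
    simpa using h
  have hPz : ∀ {x} (n : ℤ), P x → P (x ^ n) := by
    have h1 : P 1 := ⟨1, one_ne_zero, by simp⟩
    have hn : ∀ {x} (n : ℕ), P x → P (x ^ n) := by
      intro x n hx
      induction n with
      | zero => simpa using h1
      | succ n ih => rw [pow_succ]; exact hPm ih hx
    intro x n hx
    obtain ⟨n, rfl | rfl⟩ := n.eq_nat_or_neg
    · simpa using hn n hx
    · simpa using hPi (hn n hx)
  suffices hPx : P x by obtain ⟨c, -, h⟩ := hPx; exact ⟨c, h⟩
  have hx0 : x ≠ 0 := by rintro rfl; simp at h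
  obtain ⟨c, n, hc, rfl⟩ := hv.exists_prod x hx0
  rw [map_mul, hv.map_const q c hc, one_mul] at h
  refine hPm ⟨c, hc, by simp⟩ ?_
  have hPp : ∀ (s : Finset k) (f : k → K), (∀ a ∈ s, P (f a)) → P (∏ a ∈ s, f a) := by
    classical
    intro s f hs
    induction s using Finset.induction_on with
    | empty => exact ⟨1, one_ne_zero, by simp⟩
    | insert a s ha ih =>
      rw [Finset.prod_insert ha]
      exact hPm (hs a (by simp)) (ih fun b hb ↦ hs b (by simp [hb]))
  rcases q with _ | a
  · rw [hv.map_prod_none, ← exp_zero, exp_inj] at h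
    have ht : t ≠ 0 := by simpa using hv.sub_ne_zero 0
    have e : (n.prod fun a m ↦ (t - algebraMap k K a) ^ m) =
        n.prod fun a m ↦ (t⁻¹ * (t - algebraMap k K a)) ^ m := by
      have : (n.prod fun _ m ↦ t⁻¹ ^ m) = 1 := by
        have : (n.prod fun _ m ↦ t⁻¹ ^ m) = t⁻¹ ^ (n.sum fun _ m ↦ m) := by
          rw [Finsupp.prod, Finsupp.sum]
          classical
          induction n.support using Finset.induction_on with
          | empty => simp
          | insert a s ha ih =>
            rw [Finset.prod_insert ha, Finset.sum_insert ha, ih, zpow_add₀ (inv_ne_zero ht)]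
        rw [this, h, zpow_zero]
      simp only [mul_zpow]
      rw [Finsupp.prod_mul, this, one_mul]
    rw [e]
    refine hPp _ _ fun b _ ↦ hPz _ ⟨1, one_ne_zero, ?_⟩
    have e : t⁻¹ * (t - algebraMap k K b) - algebraMap k K 1 = -(t⁻¹ * algebraMap k K b) := by
      rw [map_one]; field_simp; ring
    have h1 : v none t = exp 1 := by simpa using hv.map_infty 0
    rw [e, Valuation.map_neg, map_mul, map_inv₀, h1, hlt, ← exp_neg]
    exact mul_le_of_le_one_right' (hv.map_const_le none b)
  · rw [hv.map_prod_some, ← exp_zero, exp_inj] at h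
    refine hPp _ _ fun b hb ↦ hPz _ ⟨a - b, ?_, ?_⟩
    · rintro h'
      rw [sub_eq_zero] at h'
      subst h'
      rw [Finsupp.mem_support_iff] at hb
      omega
    · have : t - algebraMap k K b - algebraMap k K (a - b) = t - algebraMap k K a := by
        rw [map_sub]; ring
      rw [this, hv.map_self, hlt]

/-- Principal parts: every rational function agrees up to a function regular at `q` with one which
has no pole outside `q`, and which vanishes at infinity if `q` is finite, while the difference
vanishes at `q` if `q` is the point at infinity. -/
theorem exists_principalPart (q : Option k) (β : K) : ∃ γ : K,
    v q (β - γ) ≤ 1 ∧ (∀ r, r ≠ q → v r γ ≤ 1) ∧ (q ≠ none → v none γ ≤ exp (-1)) ∧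
      (q = none → v none (β - γ) ≤ exp (-1)) := by
  rcases q with _ | a
  · suffices H : ∀ (n : ℕ) (β : K), v none β ≤ exp ((n : ℤ) - 1) → ∃ γ : K,
        (∀ r, r ≠ none → v r γ ≤ 1) ∧ v none (β - γ) ≤ exp (-1) by
      obtain ⟨n, hn⟩ : ∃ n : ℕ, v none β ≤ exp ((n : ℤ) - 1) := by
        rcases eq_or_ne β 0 with rfl | h
        · exact ⟨0, by simp⟩
        · refine ⟨(log (v none β) + 1).toNat, ?_⟩
          conv_lhs => rw [← exp_log ((v none).ne_zero_iff.2 h)]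
          rw [exp_le_exp]
          omega
      obtain ⟨γ, h1, h2⟩ := H n β hn
      refine ⟨γ, h2.trans ?_, h1, by simp, fun _ ↦ h2⟩
      rw [← exp_zero, exp_le_exp]; omega
    intro n
    have ht : t ≠ 0 := by simpa using hv.sub_ne_zero 0
    have h1 : v none t = exp 1 := by simpa using hv.map_infty 0
    induction n with
    | zero => exact fun β hβ ↦ ⟨0, by simp, by simpa using hβ⟩
    | succ n ih =>
      intro β hβ
      have hs : v none (β * t⁻¹ ^ n) ≤ 1 := by
        rw [map_mul, map_pow, map_inv₀, h1, ← exp_neg, ← exp_nsmul]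
        refine (mul_le_mul_left hβ _).trans ?_
        rw [← exp_add, ← exp_zero, exp_le_exp]
        simp
      obtain ⟨c, hc⟩ := hv.exists_const_lt none _ hs
      obtain ⟨γ, hγ, hγ'⟩ := ih (β - algebraMap k K c * t ^ n) (by
        have : β - algebraMap k K c * t ^ n = (β * t⁻¹ ^ n - algebraMap k K c) * t ^ n := by
          rw [inv_pow, sub_mul, inv_mul_cancel_right₀ (pow_ne_zero _ ht)]
        rw [this, map_mul, map_pow, h1, ← exp_nsmul]
        refine (mul_le_mul_left hc _).trans ?_
        rw [← exp_add, exp_le_exp]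
        simp)
      refine ⟨algebraMap k K c * t ^ n + γ, fun r hr ↦ ?_, by rwa [← sub_sub]⟩
      refine Valuation.map_add_le _ ?_ (hγ r hr)
      rw [map_mul, map_pow]
      obtain ⟨a, rfl⟩ := Option.ne_none_iff_exists'.1 hr
      have hta : v (some a) t ≤ 1 := by
        rcases eq_or_ne a 0 with rfl | ha
        · have := hv.map_self 0
          rw [map_zero, sub_zero] at this
          rw [this, ← exp_zero, exp_le_exp]; omega
        · have := hv.map_of_ne a 0 ha
          rw [map_zero, sub_zero] at this
          exact this.le
      exact mul_le_one' (hv.map_const_le _ _) (pow_le_one' hta n)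
  · suffices H : ∀ (n : ℕ) (β : K), v (some a) β ≤ exp (n : ℤ) → ∃ γ : K,
        v (some a) (β - γ) ≤ 1 ∧ (∀ r, r ≠ some a → v r γ ≤ 1) ∧ v none γ ≤ exp (-1) by
      obtain ⟨n, hn⟩ : ∃ n : ℕ, v (some a) β ≤ exp (n : ℤ) := by
        rcases eq_or_ne β 0 with rfl | h
        · exact ⟨0, by simp⟩
        · refine ⟨(log (v (some a) β)).toNat, ?_⟩
          conv_lhs => rw [← exp_log ((v (some a)).ne_zero_iff.2 h)]
          rw [exp_le_exp]
          omega
      obtain ⟨γ, h1, h2, h3⟩ := H n β hn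
      exact ⟨γ, h1, h2, fun _ ↦ h3, by simp⟩
    intro n
    have ht := hv.sub_ne_zero a
    induction n with
    | zero => exact fun β hβ ↦ ⟨0, by simpa using hβ, by simp⟩
    | succ n ih =>
      intro β hβ
      set π := t - algebraMap k K a
      have hs : v (some a) (β * π ^ (n + 1)) ≤ 1 := by
        rw [map_mul, map_pow, hv.map_self, ← exp_nsmul]
        refine (mul_le_mul_left hβ _).trans ?_
        rw [← exp_add, ← exp_zero, exp_le_exp]
        simp
      obtain ⟨c, hc⟩ := hv.exists_const_lt (some a) _ hs
      obtain ⟨γ, hγ1, hγ2, hγ3⟩ := ih (β - algebraMap k K c * π⁻¹ ^ (n + 1)) (by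
        have : β - algebraMap k K c * π⁻¹ ^ (n + 1) =
            (β * π ^ (n + 1) - algebraMap k K c) * π⁻¹ ^ (n + 1) := by
          rw [inv_pow, sub_mul, mul_inv_cancel_right₀ (pow_ne_zero _ ht)]
        rw [this, map_mul, map_pow, map_inv₀, hv.map_self, ← exp_neg, ← exp_nsmul]
        refine (mul_le_mul_left hc _).trans ?_
        rw [← exp_add, exp_le_exp]
        simp)
      have hinf : v none (algebraMap k K c * π⁻¹ ^ (n + 1)) ≤ exp (-1) := by
        rw [map_mul, map_pow, map_inv₀, hv.map_infty, ← exp_neg, ← exp_nsmul]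
        refine (mul_le_mul_left (hv.map_const_le _ _) _).trans ?_
        rw [one_mul, exp_le_exp]
        simp
      refine ⟨algebraMap k K c * π⁻¹ ^ (n + 1) + γ, by rwa [← sub_sub], fun r hr ↦ ?_,
        Valuation.map_add_le _ hinf hγ3⟩
      refine Valuation.map_add_le _ ?_ (hγ2 r hr)
      rcases r with _ | b
      · refine hinf.trans ?_
        rw [← exp_zero, exp_le_exp]; omega
      · rw [map_mul, map_pow, map_inv₀, hv.map_of_ne _ _ (fun h ↦ hr (by rw [h]))]
        simpa using hv.map_const_le _ _

end IsLineValuation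

end

section


/-! ### Rank two lattices on the projective line -/

open WithZero
open scoped Matrix

namespace IsLineValuation

/-! ### Extensions of 𝒪(-m) by 𝒪, given by local lattices F q -/

section extension

variable {k K T : Type*} [Field k] [Field K] [Algebra k K] {t : K} {v : Option k → Valuation K ℤᵐ⁰}
  (hv : IsLineValuation t v) [AddCommGroup T] [Module K T] {φ : T →ₗ[K] K} {D : T}
  {F : Option k → AddSubgroup T} {m : ℤ}
  (hker : ∀ x, φ x = 0 → ∃ c : K, x = c • D) (hφD : φ D = 0)
  (hsurj : Function.Surjective φ)
  (hD : ∀ q c, v q c ≤ 1 → c • D ∈ F q)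
  (hlift : ∀ q y, v q y ≤ (if q = none then exp (-m) else 1) → ∃ x ∈ F q, φ x = y)
  (hfin : ∀ x, {q | x ∉ F q}.Finite)

include hv hker hφD hsurj hD hlift hfin

/-- A rational function which locally lifts to the lattice outside `Z` lifts outside `Z`. -/
theorem exists_lift (Z : Set (Option k)) (γ : K)
    (hγ : ∀ q ∉ Z, v q γ ≤ (if q = none then exp (-m) else 1)) :
    ∃ y, φ y = γ ∧ ∀ q ∉ Z, y ∈ F q := by
  classical
  -- Any rational lift is good at all but finitely many points. At a bad point outside Z it differs
  -- from a local lift by c • D, and removing the principal part of c repairs it there without harm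
  -- at other points. This is H¹(ℙ¹, 𝒪) = 0 for the line spanned by D.
  obtain ⟨y, hy⟩ := hsurj γ
  let B : Finset (Option k) := ((hfin y).subset (Set.inter_subset_left (t := Zᶜ))).toFinset
  have hB : ∀ q, q ∈ B ↔ y ∉ F q ∧ q ∉ Z := fun q ↦ by simp [B]
  have hc : ∀ q : Option k, ∃ c : K, (∀ r, r ≠ q → v r c ≤ 1) ∧
      (q ∉ Z → y - c • D ∈ F q) := by
    intro q
    by_cases hq : q ∈ Z
    · exact ⟨0, by simp, fun h ↦ absurd hq h⟩
    obtain ⟨z, hz, hz'⟩ := hlift q γ (hγ q hq)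
    obtain ⟨c, hc⟩ := hker (y - z) (by rw [map_sub, hy, hz', sub_self])
    obtain ⟨c', h1, h2, -⟩ := hv.exists_principalPart q c
    refine ⟨c', h2, fun _ ↦ ?_⟩
    have : y - c' • D = z + (c - c') • D := by
      rw [sub_smul, ← hc]; abel
    rw [this]
    exact add_mem hz (hD q _ h1)
  choose c hc1 hc2 using hc
  refine ⟨y - ∑ q ∈ B, c q • D, ?_, fun q hq ↦ ?_⟩
  · simp [hφD, hy]
  · by_cases hqB : q ∈ B
    · rw [← Finset.add_sum_erase B _ hqB, ← sub_sub]
      refine sub_mem (hc2 q hq) (sum_mem fun r hr ↦ hD q _ (hc1 r q ?_))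
      exact (Finset.ne_of_mem_erase hr).symm
    · refine sub_mem ?_ (sum_mem fun r hr ↦ hD q _ (hc1 r q ?_))
      · by_contra h
        exact hqB ((hB q).2 ⟨h, hq⟩)
      · rintro rfl
        exact hqB hr

/-- The principal part is taken in the quotient and lifted, and the remaining discrepancy is
corrected along D. The quotient sections at infinity are the functions vanishing there to order m;
principal parts are controlled only to order one at infinity, and this is where m ≤ 1 enters. -/
theorem exists_vector_principalPart (hm : m ≤ 1) (q : Option k) (x : T) :
    ∃ y, x - y ∈ F q ∧ ∀ r ≠ q, y ∈ F r := by
  obtain ⟨γ, h1, h2, h3, h4⟩ := hv.exists_principalPart q (φ x)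
  obtain ⟨y, hy, hy'⟩ := hv.exists_lift hker hφD hsurj hD hlift hfin {q} γ (by
    intro r hr
    split_ifs with h
    · subst h
      exact (h3 fun h ↦ hr h.symm).trans (by rw [exp_le_exp]; omega)
    · exact h2 r hr)
  obtain ⟨z, hz, hz'⟩ := hlift q (φ x - γ) (by
    split_ifs with h
    · subst h
      exact (h4 rfl).trans (by rw [exp_le_exp]; omega)
    · exact h1)
  obtain ⟨c, hc⟩ := hker (x - y - z) (by rw [map_sub, map_sub, hz', hy, sub_self])
  obtain ⟨c', h5, h6, -⟩ := hv.exists_principalPart q c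
  refine ⟨y + c' • D, ?_, fun r hr ↦ add_mem (hy' r hr) (hD r _ (h6 r hr))⟩
  have : x - (y + c' • D) = z + (c - c') • D := by
    rw [sub_smul, ← hc]; abel
  rw [this]
  exact add_mem hz (hD q _ h5)

/-- Let z be the sum of the principal parts of x at the finitely many points of A where x is outside
the lattice. These points are not in A', so z is in the lattice along A', while x - z is in the
lattice along A. -/
theorem exists_add_of_le_one (hm : m ≤ 1) (A A' : Set (Option k)) (x : T)
    (hx : ∀ q ∈ A, q ∈ A' → x ∈ F q) :
    ∃ y z, x = y + z ∧ (∀ q ∈ A, y ∈ F q) ∧ ∀ q ∈ A', z ∈ F q := by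
  classical
  choose p hp hp' using
    fun q ↦ hv.exists_vector_principalPart hker hφD hsurj hD hlift hfin hm q x
  let B : Finset (Option k) := ((hfin x).subset (Set.inter_subset_left (t := A))).toFinset
  have hB : ∀ q, q ∈ B ↔ x ∉ F q ∧ q ∈ A := fun q ↦ by simp [B]
  refine ⟨x - ∑ q ∈ B, p q, ∑ q ∈ B, p q, by abel, fun q hq ↦ ?_, fun q hq ↦ ?_⟩
  · by_cases hqB : q ∈ B
    · rw [← Finset.add_sum_erase B _ hqB, ← sub_sub]
      exact sub_mem (hp q) (sum_mem fun r hr ↦ hp' r q (Finset.ne_of_mem_erase hr).symm)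
    · refine sub_mem ?_ (sum_mem fun r hr ↦ hp' r q ?_)
      · by_contra h
        exact hqB ((hB q).2 ⟨h, hq⟩)
      · rintro rfl
        exact hqB hr
  · refine sum_mem fun r hr ↦ hp' r q ?_
    rintro rfl
    rw [hB] at hr
    exact hr.1 (hx _ hr.2 hq)

/-- If m ≥ 2, the function t⁻¹, regular away from 0 and infinity, represents a nonzero class in H¹
of the quotient 𝒪(-m); a lift of it cannot be decomposed. -/
theorem le_one_of_exists_add
    (hle : ∀ q, ∀ x ∈ F q, v q (φ x) ≤ (if q = none then exp (-m) else 1))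
    (hadd : ∀ x, (∀ q, q ≠ none → q ≠ some 0 → x ∈ F q) →
      ∃ y z, x = y + z ∧ (∀ q, q ≠ none → y ∈ F q) ∧ ∀ q, q ≠ some 0 → z ∈ F q) : m ≤ 1 := by
  by_contra! hm
  have h0 : v none t = exp 1 := by simpa using hv.map_infty 0
  obtain ⟨x, hx, hx'⟩ := hv.exists_lift hker hφD hsurj hD hlift hfin {none, some 0} t⁻¹ (by
    rintro (_ | a) hq
    · simp at hq
    · have ha : a ≠ 0 := by rintro rfl; simp at hq
      have := hv.map_of_ne a 0 ha
      rw [map_zero, sub_zero] at this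
      rw [map_inv₀, this]
      simp)
  obtain ⟨y, z, rfl, hy, hz⟩ := hadd x fun q h h' ↦ hx' q (by simp [h, h'])
  have hz' := hle none z (hz none (by simp))
  rw [if_pos rfl] at hz'
  have hzlt : v none (φ z) < exp (-1) := hz'.trans_lt (by rw [exp_lt_exp]; omega)
  have ht : v none t⁻¹ = exp (-1) := by rw [map_inv₀, h0, exp_neg]
  -- The function φ y is regular at finite points, and φ y = t⁻¹ - φ z vanishes at infinity, so it
  -- is zero. Then φ z = t⁻¹ has order one at infinity, less than m.
  have hy0 : φ y = 0 := by
    refine hv.eq_zero_of_le _ (fun a ↦ ?_) ?_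
    · simpa using hle (some a) y (hy _ (by simp))
    · have : φ y = t⁻¹ - φ z := by rw [← hx, map_add]; ring
      rw [this]
      refine Valuation.map_sub_lt _ ?_ ?_
      · rw [ht, ← exp_zero, exp_lt_exp]; omega
      · exact hzlt.trans (by rw [← exp_zero, exp_lt_exp]; omega)
  rw [map_add, hy0, zero_add] at hx
  rw [hx, ht] at hzlt
  exact lt_irrefl _ hzlt

end extension

/-! ### The lattices of a rank two bundle with a nowhere vanishing twisted section -/

section lattice

variable {k K : Type*} [Field k] [Field K] [Algebra k K] {t : K} {v : Option k → Valuation K ℤᵐ⁰}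

/-- The factor by which the twist changes a lattice at a point. -/
def twistFactor (t : K) (q : Option k) : K := if q = none then t ^ 2 else 1

/-- The lattice at `q` of a twisted rank two bundle whose frame at `q` is given by `M q`. -/
def lattice (t : K) (v : Option k → Valuation K ℤᵐ⁰) (M : Option k → Matrix (Fin 2) (Fin 2) K)
    (q : Option k) : AddSubgroup (Fin 2 → K) where
  carrier := {x | ∀ j, v q (twistFactor t q * (x ᵥ* M q) j) ≤ 1}
  zero_mem' j := by simp
  add_mem' {x y} hx hy j := by
    rw [Matrix.add_vecMul, Pi.add_apply, mul_add]
    exact Valuation.map_add_le _ (hx j) (hy j)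
  neg_mem' {x} hx j := by
    rw [Matrix.neg_vecMul, Pi.neg_apply, mul_neg, Valuation.map_neg]
    exact hx j

omit [Field k] [Algebra k K] in
theorem mem_lattice {M : Option k → Matrix (Fin 2) (Fin 2) K} {q : Option k} {x : Fin 2 → K} :
    x ∈ lattice t v M q ↔ ∀ j, v q (twistFactor t q * (x ᵥ* M q) j) ≤ 1 := Iff.rfl

variable (hv : IsLineValuation t v) {M : Option k → Matrix (Fin 2) (Fin 2) K} {D : Fin 2 → K}
  (hdet : ∀ q, (M q).det ≠ 0)
  (hM : {q | ¬ ∀ i j, v q (M q i j) ≤ 1}.Finite)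
  (hM' : {q | v q (M q).det ≠ 1}.Finite)
  (hD : ∀ q, D ∈ lattice t v M q)
  (hD' : ∀ q, ∃ j, v q (twistFactor t q * (D ᵥ* M q) j) = 1)

/-- The degree of the bundle dual to the one spanned by the frames. -/
def latticeDegree (v : Option k → Valuation K ℤᵐ⁰) (M : Option k → Matrix (Fin 2) (Fin 2) K) : ℤ :=
  ∑ᶠ q, -log (v q (M q).det)

include hv hdet hM hM' hD hD'

/-- The vector D spans a copy of 𝒪 in the twisted bundle, and the wedge product with D realises the
quotient. The two halves are asymmetric: vanishing of H¹ requires splitting for all pairs of sets of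
points, while splitting for the two standard charts already bounds the degree. -/
theorem three_le_latticeDegree_iff :
    (3 ≤ latticeDegree v M → ∀ (A A' : Set (Option k)) (x : Fin 2 → K),
      (∀ q ∈ A, q ∈ A' → x ∈ lattice t v M q) →
      ∃ y z, x = y + z ∧ (∀ q ∈ A, y ∈ lattice t v M q) ∧ ∀ q ∈ A', z ∈ lattice t v M q) ∧
    ((∀ x, (∀ q, q ≠ none → q ≠ some 0 → x ∈ lattice t v M q) →
      ∃ y z, x = y + z ∧ (∀ q, q ≠ none → y ∈ lattice t v M q) ∧
        ∀ q, q ≠ some 0 → z ∈ lattice t v M q) → 3 ≤ latticeDegree v M) := by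
  classical
  have ht : t ≠ 0 := by simpa using hv.sub_ne_zero 0
  have htv : v none t = exp 1 := by simpa using hv.map_infty 0
  have htf : ∀ q : Option k, twistFactor t q ≠ 0 := by
    intro q; unfold twistFactor; split_ifs <;> simp [ht]
  -- a rational function with the same divisor as the determinant at finite points
  let n : k →₀ ℤ := Finsupp.onFinset (hM'.preimage (Option.some_injective k).injOn).toFinset
    (fun a ↦ -log (v (some a) (M (some a)).det)) (fun a ha ↦ by
      simp only [Set.Finite.mem_toFinset, Set.mem_preimage, Set.mem_ofPred_eq]
      rintro h
      rw [h] at ha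
      simp at ha)
  obtain ⟨g, hg0, hg, hg'⟩ := hv.exists_of_divisor n
  have hn : ∀ a, n a = -log (v (some a) (M (some a)).det) := fun a ↦ rfl
  -- Twisting a rank two bundle by -2 lowers its degree by 4, and D spans a subbundle of degree 0,
  -- so the quotient is 𝒪(-m).
  let m : ℤ := 4 - latticeDegree v M
  have hdeg : latticeDegree v M = (n.sum fun _ c ↦ c) - log (v none (M none).det) := by
    have hs : (n.sum fun _ c ↦ c) = ∑ᶠ a : k, -log (v (some a) (M (some a)).det) := by
      rw [Finsupp.sum, ← finsum_eq_sum_of_support_subset (s := n.support) (f := n)]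
      · rfl
      · simp
    rw [hs, latticeDegree]
    have hfs : (Function.support fun q : Option k ↦ -log (v q (M q).det)).Finite := by
      refine hM'.subset fun q hq h ↦ hq ?_
      simp only at h ⊢
      rw [h]; simp
    have := finsum_mem_union' (f := fun q : Option k ↦ -log (v q (M q).det))
      (s := {none}) (t := Set.range some) (by
        rw [Set.disjoint_left]; rintro _ rfl ⟨a, ha⟩; simp at ha)
      (Set.toFinite _) (hfs.subset Set.inter_subset_right)
    rw [finsum_mem_singleton, finsum_mem_range (Option.some_injective k)] at this
    have hu : ({none} ∪ Set.range some : Set (Option k)) = Set.univ := by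
      ext q; cases q <;> simp
    rw [hu, finsum_mem_univ] at this
    rw [this]; ring
  -- the quotient map
  let φ : (Fin 2 → K) →ₗ[K] K :=
    g • (D 1 • LinearMap.proj 0 - D 0 • LinearMap.proj 1)
  have hφ : ∀ x, φ x = g * (D 1 * x 0 - D 0 * x 1) := fun x ↦ by simp [φ]
  have hD0 : D ≠ 0 := by
    rintro rfl
    obtain ⟨j, hj⟩ := hD' none
    simp at hj
  have hφD : φ D = 0 := by rw [hφ]; ring
  have hker : ∀ x, φ x = 0 → ∃ c : K, x = c • D := by
    intro x hx
    rw [hφ, mul_eq_zero, or_iff_right hg0] at hx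
    by_cases h0 : D 0 = 0
    · have h1 : D 1 ≠ 0 := fun h1 ↦ hD0 (by ext j; fin_cases j <;> simp [h0, h1])
      refine ⟨x 1 / D 1, ?_⟩
      rw [h0, zero_mul, sub_zero, mul_eq_zero, or_iff_right h1] at hx
      ext j; fin_cases j
      · simp [h0, hx]
      · simp [h1]
    · refine ⟨x 0 / D 0, ?_⟩
      ext j; fin_cases j
      · simp [h0]
      · simp only [Fin.mk_one, Pi.smul_apply, smul_eq_mul]
        field_simp
        linear_combination -hx
  -- in terms of the frame at `q`
  have hcr : ∀ (q : Option k) (x : Fin 2 → K), twistFactor t q ^ 2 * (M q).det * φ x =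
      g * ((twistFactor t q * (D ᵥ* M q) 1) * (twistFactor t q * (x ᵥ* M q) 0) -
        (twistFactor t q * (D ᵥ* M q) 0) * (twistFactor t q * (x ᵥ* M q) 1)) := by
    intro q x
    rw [hφ, Matrix.det_fin_two]
    simp only [Matrix.vecMul, dotProduct, Fin.sum_univ_two]
    ring
  -- In the frame at q the wedge with D is onto the valuation ring, because D has a unit coordinate
  -- there. So φ carries the lattice onto the functions bounded by this quotient. The factor g
  -- cancels the determinant at finite points; at infinity the value is exp(deg - 4), the 4 coming
  -- from (t²)².
  have hbound : ∀ q : Option k, v q g / v q (twistFactor t q ^ 2 * (M q).det) =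
      if q = none then exp (-m) else 1 := by
    rintro (_ | a)
    · rw [if_pos rfl, twistFactor, if_pos rfl, hg', map_mul, map_pow, map_pow, htv]
      conv_lhs => rw [← exp_log ((v none).ne_zero_iff.2 (hdet none))]
      rw [← exp_nsmul, ← exp_nsmul, ← exp_add, ← exp_sub, exp_inj]
      simp only [m, hdeg]
      simp
      ring
    · rw [if_neg (by simp), twistFactor, if_neg (by simp), hg, hn, neg_neg,
        exp_log ((v _).ne_zero_iff.2 (hdet _))]
      simp [hdet]
  have hle : ∀ q, ∀ x ∈ lattice t v M q, v q (φ x) ≤ (if q = none then exp (-m) else 1) := by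
    intro q x hx
    have h0 : twistFactor t q ^ 2 * (M q).det ≠ 0 := mul_ne_zero (pow_ne_zero _ (htf q)) (hdet q)
    rw [← hbound, le_div_iff₀ (zero_lt_iff.2 ((v q).ne_zero_iff.2 h0)), ← map_mul, mul_comm (φ x),
      hcr, map_mul]
    refine mul_le_of_le_one_right' (Valuation.map_sub_le _ ?_ ?_)
    · rw [map_mul]; exact mul_le_one' (hD q 1) (hx 0)
    · rw [map_mul]; exact mul_le_one' (hD q 0) (hx 1)
  have hlift : ∀ q y, v q y ≤ (if q = none then exp (-m) else 1) →
      ∃ x ∈ lattice t v M q, φ x = y := by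
    intro q y hy
    have h0 : twistFactor t q ^ 2 * (M q).det ≠ 0 := mul_ne_zero (pow_ne_zero _ (htf q)) (hdet q)
    rw [← hbound, le_div_iff₀ (zero_lt_iff.2 ((v q).ne_zero_iff.2 h0)), ← map_mul] at hy
    obtain ⟨y', hy'⟩ : ∃ y', y' = y * (twistFactor t q ^ 2 * (M q).det) := ⟨_, rfl⟩
    rw [← hy'] at hy
    have hunit : IsUnit (M q).det := (hdet q).isUnit
    -- solve in the frame
    obtain ⟨z, hz, hz'⟩ : ∃ z : Fin 2 → K, (∀ j, v q (z j) ≤ 1) ∧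
        g * ((twistFactor t q * (D ᵥ* M q) 1) * z 0 - (twistFactor t q * (D ᵥ* M q) 0) * z 1) =
          y' := by
      -- The j-th coordinate of D is a unit, so z may vanish in slot j and be solved for in the
      -- other slot.
      obtain ⟨j, hj⟩ := hD' q
      have hj0 : twistFactor t q * (D ᵥ* M q) j ≠ 0 := (v q).ne_zero_iff.1 (by rw [hj]; simp)
      have hval : v q (y' / (g * (twistFactor t q * (D ᵥ* M q) j))) ≤ 1 := by
        rw [map_div₀, map_mul, hj, mul_one]
        exact div_le_one_of_le₀ hy zero_le
      fin_cases j
      · refine ⟨![0, -(y' / (g * (twistFactor t q * (D ᵥ* M q) 0)))], fun j ↦ ?_, ?_⟩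
        · fin_cases j
          · simp
          · simpa [-map_div₀] using hval
        · simp at hj0 ⊢
          field_simp [hj0.1, hj0.2]
      · refine ⟨![y' / (g * (twistFactor t q * (D ᵥ* M q) 1)), 0], fun j ↦ ?_, ?_⟩
        · fin_cases j
          · simpa [-map_div₀] using hval
          · simp
        · simp at hj0 ⊢
          field_simp [hj0.1, hj0.2]
    have hx : ∀ j, twistFactor t q * ((((twistFactor t q)⁻¹ • z) ᵥ* (M q)⁻¹) ᵥ* M q) j = z j := by
      intro j
      rw [Matrix.vecMul_vecMul, Matrix.nonsing_inv_mul _ hunit, Matrix.vecMul_one, Pi.smul_apply,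
        smul_eq_mul, mul_inv_cancel_left₀ (htf q)]
    refine ⟨((twistFactor t q)⁻¹ • z) ᵥ* (M q)⁻¹, fun j ↦ by rw [hx]; exact hz j, ?_⟩
    have := hcr q (((twistFactor t q)⁻¹ • z) ᵥ* (M q)⁻¹)
    rw [hx, hx, hz', hy', mul_comm] at this
    exact mul_right_cancel₀ h0 this
  have hsurj : Function.Surjective φ := by
    intro y
    by_cases h0 : D 0 = 0
    · have h1 : D 1 ≠ 0 := fun h1 ↦ hD0 (by ext j; fin_cases j <;> simp [h0, h1])
      refine ⟨![y / (g * D 1), 0], ?_⟩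
      rw [hφ]; simp; field_simp
    · refine ⟨![0, -(y / (g * D 0))], ?_⟩
      rw [hφ]; simp; field_simp
  have hDc : ∀ q c, v q c ≤ 1 → c • D ∈ lattice t v M q := by
    intro q c hc j
    rw [Matrix.smul_vecMul, Pi.smul_apply, smul_eq_mul, mul_left_comm, map_mul]
    exact mul_le_one' hc (hD q j)
  have hfin : ∀ x, {q | x ∉ lattice t v M q}.Finite := by
    intro x
    refine (((hM.union (hv.finite_one_lt (x 0))).union (hv.finite_one_lt (x 1))).union
      (Set.finite_singleton none)).subset fun q hq ↦ ?_
    by_contra hcon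
    simp only [Set.mem_union, Set.mem_ofPred_eq, not_or, not_not, Set.mem_singleton_iff] at hcon
    obtain ⟨⟨⟨h1, h2⟩, h3⟩, h4⟩ := hcon
    refine hq fun j ↦ ?_
    rw [twistFactor, if_neg h4, one_mul]
    simp only [Matrix.vecMul, dotProduct, Fin.sum_univ_two]
    refine Valuation.map_add_le _ ?_ ?_
    · rw [map_mul]; exact mul_le_one' h2 (h1 0 j)
    · rw [map_mul]; exact mul_le_one' h3 (h1 1 j)
  constructor
  · intro hd A A' x hx
    exact hv.exists_add_of_le_one (m := m) hker hφD hsurj hDc hlift hfin (by omega) A A' x hx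
  · intro h
    have := hv.le_one_of_exists_add (m := m) hker hφD hsurj hDc hlift hfin hle h
    omega

end lattice

end IsLineValuation

end

section


/-! ### Charts of the projective line -/

attribute [local instance] MvPolynomial.gradedAlgebra

/-- Constants, as functions on a scheme over `k`. -/
def constMap {k : Type u} [Field k] {X : Scheme.{u}} (s : X ⟶ Spec (CommRingCat.of k))
    (V : X.Opens) : k →+* Γ(X, V) :=
  (baseMap s V).comp (Scheme.ΓSpecIso (CommRingCat.of k)).inv.hom

theorem res_constMap {k : Type u} [Field k] {X : Scheme.{u}} (s : X ⟶ Spec (CommRingCat.of k))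
    {V W : X.Opens} (h : W ≤ V) (c : k) : res h (constMap s V c) = constMap s W c := by
  rw [constMap, RingHom.comp_apply, ← RingHom.comp_apply, res_baseMap]
  rfl

theorem baseMap_mem_range_constMap {k : Type u} [Field k] {X : Scheme.{u}}
    (s : X ⟶ Spec (CommRingCat.of k)) (V : X.Opens) (r : Γ(Spec (CommRingCat.of k), ⊤)) :
    ∃ c : k, baseMap s V r = constMap s V c :=
  ⟨(Scheme.ΓSpecIso (CommRingCat.of k)).hom r, by simp [constMap]⟩

theorem constMap_eq_of_ι_comp {k : Type u} [Field k] {X : Scheme.{u}}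
    (s : X ⟶ Spec (CommRingCat.of k)) (U : X.Opens) (φ : CommRingCat.of k ⟶ Γ(X, U))
    (h : U.ι ≫ s = U.toSpecΓ ≫ Spec.map φ) (c : k) : constMap s U c = φ c := by
  have := congrArg Scheme.Hom.appTop h
  rw [Scheme.Hom.comp_appTop, Scheme.Hom.comp_appTop, Scheme.Opens.toSpecΓ_appTop] at this
  have h2 : (Scheme.ΓSpecIso (CommRingCat.of k)).inv ≫ s.appTop ≫ U.ι.appTop ≫ U.topIso.hom = φ := by
    rw [← Category.assoc s.appTop, this]
    simp only [Category.assoc, Iso.inv_hom_id]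
    rw [Category.comp_id, Scheme.ΓSpecIso_naturality, Iso.inv_hom_id_assoc]
  have h3 : s.appTop ≫ U.ι.appTop ≫ U.topIso.hom = s.appLE ⊤ U (le_preimage_top s U) := by
    rw [Scheme.Hom.appLE, Scheme.Opens.ι_appTop, Scheme.Opens.topIso_hom]
    exact congrArg (s.appTop ≫ ·) (X.presheaf.map_comp _ _).symm
  rw [h3] at h2
  exact congr($h2 c)

section

variable (k : Type u) [Field k]

theorem X_mem (i : Fin 2) : (MvPolynomial.X i : MvPolynomial (Fin 2) k) ∈
    MvPolynomial.homogeneousSubmodule (Fin 2) k 1 := MvPolynomial.isHomogeneous_X k i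

/-- The fraction `Xⱼ / Xᵢ`. -/
def fraction (i j : Fin 2) : HomogeneousLocalization.Away
    (MvPolynomial.homogeneousSubmodule (Fin 2) k) (MvPolynomial.X i) :=
  .mk _ (X_mem k i) 1 (MvPolynomial.X j) (X_mem k j)

/-- Fractions with denominator a power of `Xᵢ`, as functions on the chart `Xᵢ ≠ 0`. -/
def awayToChart (i : Fin 2) : HomogeneousLocalization.Away
    (MvPolynomial.homogeneousSubmodule (Fin 2) k) (MvPolynomial.X i) →+* Γ(projLine k, chart k i) :=
  (Proj.awayToSection (MvPolynomial.homogeneousSubmodule (Fin 2) k) (MvPolynomial.X i)).hom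

/-- The affine coordinate `Xⱼ / Xᵢ` on the chart `Xᵢ ≠ 0`. -/
def chartCoordinate (i j : Fin 2) : Γ(projLine k, chart k i) :=
  awayToChart k i (fraction k i j)

theorem isAffineOpen_chart (i : Fin 2) : IsAffineOpen (chart k i) :=
  Proj.isAffineOpen_basicOpen _ _ (X_mem k i) one_pos

theorem chart_sup_chart : chart k 0 ⊔ chart k 1 = ⊤ := by
  have := Proj.iSup_basicOpen_eq_top' (MvPolynomial.homogeneousSubmodule (Fin 2) k)
    (fun i : Fin 2 ↦ MvPolynomial.X i) (fun i ↦ ⟨1, X_mem k i⟩) (by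
      rw [eq_top_iff]
      rintro p -
      induction p using MvPolynomial.induction_on with
      | C a =>
        exact Subalgebra.algebraMap_mem _
          (algebraMap k (MvPolynomial.homogeneousSubmodule (Fin 2) k 0) a)
      | add p q hp hq => exact Subalgebra.add_mem _ hp hq
      | mul_X p i hp => exact Subalgebra.mul_mem _ hp (Algebra.subset_adjoin ⟨i, rfl⟩))
  rw [← this]
  refine le_antisymm (sup_le ?_ ?_) (iSup_le fun i ↦ ?_)
  · exact le_iSup (fun i : Fin 2 ↦ Proj.basicOpen _ (MvPolynomial.X i)) 0
  · exact le_iSup (fun i : Fin 2 ↦ Proj.basicOpen _ (MvPolynomial.X i)) 1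
  · fin_cases i
    · exact le_sup_left
    · exact le_sup_right

theorem constMap_chart (i : Fin 2) (c : k) :
    constMap (projSpaceToSpec k 1) (chart k i) c =
      awayToChart k i (HomogeneousLocalization.fromZeroRingHom _ _
          (algebraMap k (MvPolynomial.homogeneousSubmodule (Fin 2) k 0) c)) := by
  refine constMap_eq_of_ι_comp _ _ (CommRingCat.ofHom
      (algebraMap k (MvPolynomial.homogeneousSubmodule (Fin 2) k 0)) ≫
    CommRingCat.ofHom (HomogeneousLocalization.fromZeroRingHom _ _) ≫
    Proj.awayToSection (MvPolynomial.homogeneousSubmodule (Fin 2) k) (MvPolynomial.X i)) ?_ c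
  have h1 := Proj.awayι_toSpecZero (MvPolynomial.homogeneousSubmodule (Fin 2) k) (MvPolynomial.X i)
    (X_mem k i) one_pos
  rw [Proj.awayι, Category.assoc, Iso.inv_comp_eq, Proj.basicOpenIsoSpec_hom,
    Proj.basicOpenToSpec] at h1
  rw [projSpaceToSpec, Spec.map_comp, Spec.map_comp]
  simp only [Category.assoc] at h1 ⊢
  rw [← Category.assoc]
  refine (congrArg (· ≫ _) h1).trans ?_
  simp only [Category.assoc]

theorem awayToChart_bijective (i : Fin 2) : Function.Bijective (awayToChart k i) :=
  (ConcreteCategory.isIso_iff_bijective _).1 (inferInstanceAs (IsIso (Proj.basicOpenIsoAway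
    (MvPolynomial.homogeneousSubmodule (Fin 2) k) (MvPolynomial.X i) (X_mem k i) one_pos).hom))

/-- Evaluation of polynomials at the affine coordinate. -/
def chartEval (i j : Fin 2) : Polynomial k →+* Γ(projLine k, chart k i) :=
  Polynomial.eval₂RingHom (constMap (projSpaceToSpec k 1) (chart k i)) (chartCoordinate k i j)

/-- Evaluation of polynomials at the fraction `Xⱼ / Xᵢ`. -/
def awayEval (i j : Fin 2) : Polynomial k →+* HomogeneousLocalization.Away
    (MvPolynomial.homogeneousSubmodule (Fin 2) k) (MvPolynomial.X i) :=
  Polynomial.eval₂RingHom ((HomogeneousLocalization.fromZeroRingHom _ _).comp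
    (algebraMap k (MvPolynomial.homogeneousSubmodule (Fin 2) k 0))) (fraction k i j)

theorem chartEval_eq (i j : Fin 2) (p : Polynomial k) : chartEval k i j p =
    awayToChart k i (awayEval k i j p) := by
  have : chartEval k i j = (awayToChart k i).comp (awayEval k i j) := by
    refine Polynomial.ringHom_ext (fun c ↦ ?_) ?_
    · rw [RingHom.comp_apply]
      simp only [chartEval, awayEval, Polynomial.coe_eval₂RingHom, Polynomial.eval₂_C]
      exact constMap_chart k i c
    · rw [RingHom.comp_apply]
      simp only [chartEval, awayEval, Polynomial.coe_eval₂RingHom, Polynomial.eval₂_X]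
      rfl
  exact congr($this p)

/-- Dehomogenization with respect to `Xᵢ`. -/
def dehomogenize (i : Fin 2) : HomogeneousLocalization.Away
    (MvPolynomial.homogeneousSubmodule (Fin 2) k) (MvPolynomial.X i) →+* Polynomial k :=
  (Localization.awayLift (MvPolynomial.eval₂Hom (Polynomial.C : k →+* Polynomial k)
    (fun l ↦ if l = i then 1 else Polynomial.X)) (MvPolynomial.X i) (by simp)).comp
    (algebraMap _ (Localization.Away (MvPolynomial.X i : MvPolynomial (Fin 2) k)))

theorem val_fromZeroRingHom (i : Fin 2) (c : k) :
    (HomogeneousLocalization.fromZeroRingHom (MvPolynomial.homogeneousSubmodule (Fin 2) k)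
      (Submonoid.powers (MvPolynomial.X i))
      (algebraMap k (MvPolynomial.homogeneousSubmodule (Fin 2) k 0) c)).val =
      algebraMap (MvPolynomial (Fin 2) k) (Localization.Away (MvPolynomial.X i))
        (MvPolynomial.C c) := rfl

theorem val_fraction (i j : Fin 2) : (fraction k i j).val =
    Localization.mk (MvPolynomial.X j)
      (⟨MvPolynomial.X i ^ 1, 1, rfl⟩ : Submonoid.powers (MvPolynomial.X i)) := rfl

theorem val_fraction_mul (i j : Fin 2) : algebraMap (MvPolynomial (Fin 2) k)
    (Localization.Away (MvPolynomial.X i)) (MvPolynomial.X i) * (fraction k i j).val =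
      algebraMap (MvPolynomial (Fin 2) k) (Localization.Away (MvPolynomial.X i))
        (MvPolynomial.X j) := by
  rw [val_fraction, Localization.mk_eq_mk']
  simp

/-- Setting Xᵢ = 1 is a left inverse of the evaluation, which gives its injectivity. -/
theorem dehomogenize_awayEval (i j : Fin 2) (h : i ≠ j) (p : Polynomial k) :
    dehomogenize k i (awayEval k i j p) = p := by
  have : (dehomogenize k i).comp (awayEval k i j) = RingHom.id _ := by
    refine Polynomial.ringHom_ext (fun c ↦ ?_) ?_
    · simp only [RingHom.comp_apply, awayEval, Polynomial.coe_eval₂RingHom, Polynomial.eval₂_C,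
        dehomogenize, HomogeneousLocalization.algebraMap_apply, val_fromZeroRingHom]
      rw [Localization.awayLift, IsLocalization.Away.lift_eq]
      simp
    · have h1 := congrArg (Localization.awayLift
        (MvPolynomial.eval₂Hom (Polynomial.C : k →+* Polynomial k)
          (fun l ↦ if l = i then 1 else Polynomial.X)) (MvPolynomial.X i) (by simp))
        (val_fraction_mul k i j)
      rw [map_mul, Localization.awayLift, IsLocalization.Away.lift_eq,
        IsLocalization.Away.lift_eq] at h1
      simp only [RingHom.comp_apply, awayEval, Polynomial.coe_eval₂RingHom, Polynomial.eval₂_X,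
        dehomogenize, HomogeneousLocalization.algebraMap_apply]
      simpa [h.symm] using h1
  exact congr($this p)

end

theorem eval₂_mul_of_isHomogeneous {σ R S : Type*} [CommSemiring R] [CommSemiring S] [Fintype σ]
    {f : MvPolynomial σ R} {n : ℕ} (hf : f.IsHomogeneous n) (φ : R →+* S) (g : σ → S) (a : S) :
    MvPolynomial.eval₂ φ (fun l ↦ a * g l) f = a ^ n * MvPolynomial.eval₂ φ g f := by
  rw [MvPolynomial.eval₂_eq', MvPolynomial.eval₂_eq', Finset.mul_sum]
  refine Finset.sum_congr rfl fun d hd ↦ ?_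
  have := hf (MvPolynomial.mem_support_iff.1 hd)
  rw [Finsupp.weight_apply, Finsupp.sum_fintype _ _ (by simp)] at this
  simp only [Pi.one_apply, smul_eq_mul, mul_one] at this
  simp only [mul_pow, Finset.prod_mul_distrib, Finset.prod_pow_eq_pow_sum]
  rw [this]
  ring

section

variable (k : Type u) [Field k]

/-- For f homogeneous of degree n, f / Xᵢⁿ is f evaluated at the fractions X_l / Xᵢ, one of which is
1; hence it is a polynomial in the other. -/
theorem awayEval_surjective (i j : Fin 2) (h : i ≠ j) : Function.Surjective (awayEval k i j) := by
  intro z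
  obtain ⟨n, f, hf, rfl⟩ := HomogeneousLocalization.Away.mk_surjective _ (X_mem k i) z
  have hf' : f.IsHomogeneous n := by simpa using hf
  refine ⟨MvPolynomial.eval₂Hom (Polynomial.C : k →+* Polynomial k)
    (fun l ↦ if l = i then 1 else Polynomial.X) f, HomogeneousLocalization.val_injective _ ?_⟩
  set A := Localization.Away (MvPolynomial.X i : MvPolynomial (Fin 2) k)
  let a : A := algebraMap (MvPolynomial (Fin 2) k) A (MvPolynomial.X i)
  have ha : IsUnit a := IsLocalization.Away.algebraMap_isUnit _
  let v : HomogeneousLocalization.Away (MvPolynomial.homogeneousSubmodule (Fin 2) k)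
    (MvPolynomial.X i) →+* A := algebraMap _ _
  have key : ((v.comp (awayEval k i j)).comp (MvPolynomial.eval₂Hom
      (Polynomial.C : k →+* Polynomial k) (fun l ↦ if l = i then 1 else Polynomial.X))) =
      MvPolynomial.eval₂Hom ((algebraMap (MvPolynomial (Fin 2) k) A).comp MvPolynomial.C)
        (fun l ↦ (fraction k i l).val) := by
    refine MvPolynomial.ringHom_ext (fun c ↦ ?_) fun l ↦ ?_
    · simp only [RingHom.comp_apply, MvPolynomial.coe_eval₂Hom, MvPolynomial.eval₂_C, awayEval,
        Polynomial.coe_eval₂RingHom, Polynomial.eval₂_C]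
      exact val_fromZeroRingHom k i c
    · simp only [RingHom.comp_apply, MvPolynomial.coe_eval₂Hom, MvPolynomial.eval₂_X, awayEval,
        Polynomial.coe_eval₂RingHom]
      split_ifs with hl
      · subst hl
        refine ha.mul_left_cancel ?_
        rw [val_fraction_mul, Polynomial.eval₂_one, map_one, mul_one]
      · have : l = j := by omega
        subst this
        rw [Polynomial.eval₂_X]
        rfl
  have e1 := congr($key f)
  rw [RingHom.comp_apply, RingHom.comp_apply, MvPolynomial.coe_eval₂Hom] at e1
  refine Eq.trans e1 ?_
  refine (ha.pow n).mul_left_cancel ?_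
  rw [MvPolynomial.coe_eval₂Hom, ← eval₂_mul_of_isHomogeneous hf']
  have e2 : (fun l ↦ a * (fraction k i l).val) =
      fun l ↦ algebraMap (MvPolynomial (Fin 2) k) A (MvPolynomial.X l) :=
    funext fun l ↦ val_fraction_mul k i l
  rw [e2]
  have e3 : MvPolynomial.eval₂ ((algebraMap (MvPolynomial (Fin 2) k) A).comp MvPolynomial.C)
      (fun l ↦ algebraMap (MvPolynomial (Fin 2) k) A (MvPolynomial.X l)) f =
      algebraMap (MvPolynomial (Fin 2) k) A f := by
    have := MvPolynomial.eval₂_comp_left (algebraMap (MvPolynomial (Fin 2) k) A) MvPolynomial.C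
      MvPolynomial.X f
    rw [MvPolynomial.eval₂_eta] at this
    exact this.symm
  rw [e3]
  simp only [a, HomogeneousLocalization.Away.val_mk]
  rw [Localization.mk_eq_mk', ← map_pow]
  exact (IsLocalization.mk'_spec' A f
    (⟨MvPolynomial.X i ^ n, n, rfl⟩ : Submonoid.powers (MvPolynomial.X i))).symm

theorem chartEval_bijective (i j : Fin 2) (h : i ≠ j) : Function.Bijective (chartEval k i j) := by
  have : (chartEval k i j : Polynomial k → _) = awayToChart k i ∘ awayEval k i j :=
    funext fun p ↦ chartEval_eq k i j p
  rw [this]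
  exact (awayToChart_bijective k i).comp
    ⟨Function.LeftInverse.injective (dehomogenize_awayEval k i j h),
      awayEval_surjective k i j h⟩

theorem res_chartCoordinate_eq_coordinate :
    res inf_le_left (chartCoordinate k 0 1) = (coordinate k).val := by
  have h := congr($(Proj.awayMap_awayToSection (MvPolynomial.homogeneousSubmodule (Fin 2) k)
    (f := MvPolynomial.X 0) (g := MvPolynomial.X 1) (X_mem k 1) rfl) (fraction k 0 1))
  have h' : HomogeneousLocalization.awayMap (MvPolynomial.homogeneousSubmodule (Fin 2) k)
      (X_mem k 1) rfl (fraction k 0 1) = ratio k 1 := by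
    refine HomogeneousLocalization.val_injective _ ?_
    rw [fraction, HomogeneousLocalization.awayMap_mk, ratio,
      HomogeneousLocalization.Away.val_mk, HomogeneousLocalization.Away.val_mk, pow_one]
  have h2 := congrArg (res (chart_inf_chart_le k)) h.symm
  refine Eq.trans ?_ (h2.trans ?_)
  · exact (res_res _ _ _).symm
  · exact congrArg (awayToChartInter k) h'

theorem res_chartCoordinate_eq_coordinate_inv :
    res inf_le_right (chartCoordinate k 1 0) = (coordinate k).inv := by
  have h := congr($(Proj.awayMap_awayToSection (MvPolynomial.homogeneousSubmodule (Fin 2) k)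
    (f := MvPolynomial.X 1) (g := MvPolynomial.X 0) (x := MvPolynomial.X 0 * MvPolynomial.X 1)
    (X_mem k 0) (mul_comm _ _)) (fraction k 1 0))
  have hawayMap : HomogeneousLocalization.awayMap (MvPolynomial.homogeneousSubmodule (Fin 2) k)
      (x := MvPolynomial.X 0 * MvPolynomial.X 1)
      (X_mem k 0) (mul_comm _ _) (fraction k 1 0) = ratio k 0 := by
    refine HomogeneousLocalization.val_injective _ ?_
    rw [fraction, HomogeneousLocalization.awayMap_mk, ratio,
      HomogeneousLocalization.Away.val_mk, HomogeneousLocalization.Away.val_mk, pow_one]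
  have h2 := congrArg (res (chart_inf_chart_le k)) h.symm
  refine Eq.trans ?_ (h2.trans ?_)
  · exact (res_res _ _ _).symm
  · exact congrArg (awayToChartInter k) hawayMap

/-- A point of a chart at which the coordinate does not vanish lies in the other chart. -/
theorem mem_chart_of_isUnit (i j : Fin 2) (y : projLine k) (hy : y ∈ chart k i)
    (h : IsUnit ((projLine k).presheaf.germ _ y hy (chartCoordinate k i j))) : y ∈ chart k j := by
  have h1 : IsUnit (Proj.stalkIso' (MvPolynomial.homogeneousSubmodule (Fin 2) k) y
      ((ProjectiveSpectrum.Proj.structureSheaf (MvPolynomial.homogeneousSubmodule (Fin 2) k)).presheaf.germ _ y hy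
        (chartCoordinate k i j))) :=
    h.map (Proj.stalkIso' (MvPolynomial.homogeneousSubmodule (Fin 2) k) y)
  have e := Proj.stalkIso'_germ (MvPolynomial.homogeneousSubmodule (Fin 2) k) (chart k i) y hy
    (chartCoordinate k i j)
  replace h1 := (congrArg IsUnit e).mp h1
  have : y.asHomogeneousIdeal.toIdeal.IsPrime := y.isPrime
  have h2 := (HomogeneousLocalization.isUnit_iff_isUnit_val
    (MvPolynomial.homogeneousSubmodule (Fin 2) k) y.asHomogeneousIdeal.toIdeal _).2 h1
  have h3 : IsUnit (Localization.mk (MvPolynomial.X j)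
      (⟨MvPolynomial.X i ^ 1, Submonoid.powers_le.mpr hy ⟨1, rfl⟩⟩ :
        y.asHomogeneousIdeal.toIdeal.primeCompl)) := h2
  rw [Localization.mk_eq_mk', IsLocalization.AtPrime.isUnit_mk'_iff _ y.asHomogeneousIdeal.toIdeal]
    at h3
  exact h3

end

end

section


/-! ### Points and stalks of an affine line -/

section affineLine

open Polynomial IsLocalRing

theorem isUnit_germ_iff_notMem {Y : Scheme.{u}} {U : Y.Opens} (hU : IsAffineOpen U) (y : Y)
    (hy : y ∈ U) (a : Γ(Y, U)) :
    IsUnit (Y.presheaf.germ U y hy a) ↔ a ∉ (hU.primeIdealOf ⟨y, hy⟩).asIdeal := by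
  let : Algebra Γ(Y, U) (Y.presheaf.stalk y) := (Y.presheaf.germ U y hy).hom.toAlgebra
  have : IsLocalization.AtPrime (Y.presheaf.stalk y) (hU.primeIdealOf ⟨y, hy⟩).asIdeal :=
    hU.isLocalization_stalk ⟨y, hy⟩
  exact IsLocalization.AtPrime.isUnit_to_map_iff (Y.presheaf.stalk y) _ a

theorem maximalIdeal_stalk_eq_map {Y : Scheme.{u}} {U : Y.Opens} (hU : IsAffineOpen U) (y : Y)
    (hy : y ∈ U) : maximalIdeal (Y.presheaf.stalk y) =
      (hU.primeIdealOf ⟨y, hy⟩).asIdeal.map (Y.presheaf.germ U y hy).hom := by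
  let : Algebra Γ(Y, U) (Y.presheaf.stalk y) := (Y.presheaf.germ U y hy).hom.toAlgebra
  have : IsLocalization.AtPrime (Y.presheaf.stalk y) (hU.primeIdealOf ⟨y, hy⟩).asIdeal :=
    hU.isLocalization_stalk ⟨y, hy⟩
  exact (IsLocalization.AtPrime.map_eq_maximalIdeal _ _).symm

theorem exists_primeIdealOf_eq {Y : Scheme.{u}} {U : Y.Opens} (hU : IsAffineOpen U)
    (P : PrimeSpectrum Γ(Y, U)) : ∃ (y : Y) (hy : y ∈ U), hU.primeIdealOf ⟨y, hy⟩ = P := by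
  have hy : hU.fromSpec P ∈ U := by
    have : hU.fromSpec P ∈ Set.range hU.fromSpec := ⟨P, rfl⟩
    rwa [hU.range_fromSpec] at this
  refine ⟨hU.fromSpec P, hy, ?_⟩
  exact hU.fromSpec.isOpenEmbedding.injective (hU.fromSpec_primeIdealOf ⟨_, hy⟩)

theorem primeIdealOf_injective {Y : Scheme.{u}} {U : Y.Opens} (hU : IsAffineOpen U) {y y' : Y}
    (hy : y ∈ U) (hy' : y' ∈ U) (h : hU.primeIdealOf ⟨y, hy⟩ = hU.primeIdealOf ⟨y', hy'⟩) :
    y = y' := by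
  have := hU.fromSpec_primeIdealOf ⟨y, hy⟩
  rw [h, hU.fromSpec_primeIdealOf ⟨y', hy'⟩] at this
  exact this.symm

variable {k : Type u} [Field k] {Y : Scheme.{u}} {U : Y.Opens} (hU : IsAffineOpen U)
  (ε : k[X] →+* Γ(Y, U)) (hε : Function.Bijective ε)

include hU hε

/-- The point is the prime generated by X - a. Closed points are recognised throughout by the germ
of X - a not being a unit. -/
theorem exists_not_isUnit_germ (a : k) :
    ∃ (y : Y) (hy : y ∈ U), ¬ IsUnit (Y.presheaf.germ U y hy (ε (X - C a))) := by
  let e : k[X] ≃+* Γ(Y, U) := RingEquiv.ofBijective ε hε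
  have hp : (Ideal.span {(X - C a : k[X])}).IsPrime :=
    (Ideal.span_singleton_prime (X_sub_C_ne_zero a)).2 (prime_X_sub_C a)
  let P : PrimeSpectrum Γ(Y, U) := ⟨(Ideal.span {(X - C a : k[X])}).comap e.symm, hp.comap _⟩
  obtain ⟨y, hy, h⟩ := exists_primeIdealOf_eq hU P
  refine ⟨y, hy, ?_⟩
  rw [isUnit_germ_iff_notMem hU, not_not, h]
  change e.symm (e (X - C a)) ∈ Ideal.span {(X - C a : k[X])}
  rw [e.symm_apply_apply]
  exact Ideal.mem_span_singleton_self _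

theorem primeIdealOf_eq_span {y : Y} {hy : y ∈ U} {a : k}
    (h : ¬ IsUnit (Y.presheaf.germ U y hy (ε (X - C a)))) :
    (hU.primeIdealOf ⟨y, hy⟩).asIdeal = Ideal.span {ε (X - C a)} := by
  rw [isUnit_germ_iff_notMem hU, not_not] at h
  have hm : (Ideal.span {(X - C a : k[X])}).IsMaximal :=
    PrincipalIdealRing.isMaximal_of_irreducible (irreducible_X_sub_C a)
  have hm' : (Ideal.span {ε (X - C a)}).IsMaximal := by
    have := Ideal.map_isMaximal_of_equiv (RingEquiv.ofBijective ε hε) (p := Ideal.span {(X - C a : k[X])})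
    rw [Ideal.map_span, Set.image_singleton] at this
    exact this
  refine (hm'.eq_of_le (hU.primeIdealOf ⟨y, hy⟩).isPrime.ne_top ?_).symm
  rw [Ideal.span_singleton_le_iff_mem]
  exact h

theorem eq_of_not_isUnit_germ {y y' : Y} {hy : y ∈ U} {hy' : y' ∈ U} {a : k}
    (h : ¬ IsUnit (Y.presheaf.germ U y hy (ε (X - C a))))
    (h' : ¬ IsUnit (Y.presheaf.germ U y' hy' (ε (X - C a)))) : y = y' :=
  primeIdealOf_injective hU hy hy' (PrimeSpectrum.ext
    ((primeIdealOf_eq_span hU ε hε h).trans (primeIdealOf_eq_span hU ε hε h').symm))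

theorem isUnit_germ_iff_eval_ne_zero {y : Y} {hy : y ∈ U} {a : k}
    (h : ¬ IsUnit (Y.presheaf.germ U y hy (ε (X - C a)))) (f : k[X]) :
    IsUnit (Y.presheaf.germ U y hy (ε f)) ↔ f.eval a ≠ 0 := by
  rw [isUnit_germ_iff_notMem hU, primeIdealOf_eq_span hU ε hε h, Ideal.mem_span_singleton, not_iff_not,
    ← IsRoot.def, ← dvd_iff_isRoot]
  exact map_dvd_iff (RingEquiv.ofBijective ε hε)

theorem maximalIdeal_stalk_eq_span {y : Y} {hy : y ∈ U} {a : k}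
    (h : ¬ IsUnit (Y.presheaf.germ U y hy (ε (X - C a)))) :
    maximalIdeal (Y.presheaf.stalk y) = Ideal.span {Y.presheaf.germ U y hy (ε (X - C a))} := by
  rw [maximalIdeal_stalk_eq_map hU, primeIdealOf_eq_span hU ε hε h, Ideal.map_span,
    Set.image_singleton]

/-- The stalk is the localization of a principal ideal domain at a nonzero prime. -/
theorem isDiscreteValuationRing_stalk [IsIntegral Y] {y : Y} {hy : y ∈ U} {a : k}
    (h : ¬ IsUnit (Y.presheaf.germ U y hy (ε (X - C a)))) :
    IsDiscreteValuationRing (Y.presheaf.stalk y) := by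
  have : Nonempty U := ⟨⟨y, hy⟩⟩
  have : IsPrincipalIdealRing Γ(Y, U) := IsPrincipalIdealRing.of_surjective ε hε.2
  let : Algebra Γ(Y, U) (Y.presheaf.stalk y) := (Y.presheaf.germ U y hy).hom.toAlgebra
  have : IsLocalization.AtPrime (Y.presheaf.stalk y) (hU.primeIdealOf ⟨y, hy⟩).asIdeal :=
    hU.isLocalization_stalk ⟨y, hy⟩
  refine IsLocalization.AtPrime.isDiscreteValuationRing_of_dedekind_domain Γ(Y, U)
    (P := (hU.primeIdealOf ⟨y, hy⟩).asIdeal) ?_ (Y.presheaf.stalk y)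
  rw [primeIdealOf_eq_span hU ε hε h, Ne, Ideal.span_singleton_eq_bot, ← map_zero ε]
  exact fun h ↦ X_sub_C_ne_zero a (hε.1 h)

/-- A point of an affine line over an algebraically closed field is the generic point or a
rational point. -/
theorem eq_genericPoint_or_exists_not_isUnit [IsAlgClosed k] [IsIntegral Y] (y : Y) (hy : y ∈ U) :
    y = genericPoint Y ∨ ∃ a : k, ¬ IsUnit (Y.presheaf.germ U y hy (ε (X - C a))) := by
  have : Nonempty U := ⟨⟨y, hy⟩⟩
  simp only [isUnit_germ_iff_notMem hU, not_not]
  -- The zero prime is the generic point. A nonzero prime contains a nonzero polynomial, which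
  -- splits over k; its leading coefficient is a unit, so some linear factor lies in the prime.
  by_cases hbot : (hU.primeIdealOf ⟨y, hy⟩).asIdeal = ⊥
  · left
    have hg := hU.primeIdealOf_genericPoint
    refine primeIdealOf_injective hU hy ((genericPoint_spec Y).mem_open_set_iff U.isOpen |>.2
      ⟨y, trivial, hy⟩) (PrimeSpectrum.ext ?_)
    rw [hbot, hg, genericPoint_eq_bot_of_affine]
    rfl
  · right
    obtain ⟨b, hb, hb0⟩ := Submodule.exists_mem_ne_zero_of_ne_bot hbot
    obtain ⟨f, rfl⟩ := hε.2 b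
    have hf0 : f ≠ 0 := by rintro rfl; exact hb0 (map_zero ε)
    have hprime := (hU.primeIdealOf ⟨y, hy⟩).isPrime.comap ε
    have hf : f ∈ (hU.primeIdealOf ⟨y, hy⟩).asIdeal.comap ε := hb
    have hs := (IsAlgClosed.splits f).eq_prod_roots
    rw [hs] at hf
    rcases hprime.mem_or_mem hf with h | h
    · exact absurd (Ideal.eq_top_of_isUnit_mem _ h
        (isUnit_C.2 (leadingCoeff_ne_zero.2 hf0).isUnit)) hprime.ne_top
    · obtain ⟨g, hg, hg'⟩ := (hprime.multiset_prod_mem_iff_exists_mem _).1 h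
      obtain ⟨a, -, rfl⟩ := Multiset.mem_map.1 hg
      exact ⟨a, hg'⟩

end affineLine

end

section


/-! ### Valuations of the function field of the projective line -/

open WithZero Polynomial

/-! ### Valuations of discrete valuation rings -/

section discreteValuation

variable {R K : Type*} [CommRing R] [IsDomain R] [IsDiscreteValuationRing R] [Field K]
  [Algebra R K] [IsFractionRing R K]

theorem valuation_le_one_iff_mem_range (x : K) :
    (IsDiscreteValuationRing.maximalIdeal R).valuation K x ≤ 1 ↔ x ∈ Set.range (algebraMap R K) := by
  constructor
  · intro h
    obtain ⟨a, rfl⟩ := IsDiscreteValuationRing.exists_lift_of_le_one h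
    exact ⟨a, rfl⟩
  · rintro ⟨a, rfl⟩
    exact (IsDiscreteValuationRing.maximalIdeal R).valuation_le_one a

theorem valuation_algebraMap_eq_one_iff (r : R) :
    (IsDiscreteValuationRing.maximalIdeal R).valuation K (algebraMap R K r) = 1 ↔ IsUnit r := by
  rw [IsDedekindDomain.HeightOneSpectrum.valuation_of_algebraMap,
    IsDedekindDomain.HeightOneSpectrum.intValuation_eq_one_iff]
  exact IsLocalRing.notMem_maximalIdeal

theorem valuation_algebraMap_of_span_eq (r : R)
    (hr : IsLocalRing.maximalIdeal R = Ideal.span {r}) :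
    (IsDiscreteValuationRing.maximalIdeal R).valuation K (algebraMap R K r) = exp (-1) := by
  rw [IsDedekindDomain.HeightOneSpectrum.valuation_of_algebraMap,
    IsDedekindDomain.HeightOneSpectrum.intValuation_singleton _ _ hr]
  rintro rfl
  exact IsDiscreteValuationRing.not_a_field R (by simpa using hr)

end discreteValuation

theorem genericPoint_mem {Y : Scheme.{u}} [IsIntegral Y] {V : Y.Opens} {y : Y} (hy : y ∈ V) :
    genericPoint Y ∈ V :=
  (genericPoint_spec Y).mem_open_set_iff V.isOpen |>.2 ⟨y, trivial, hy⟩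

theorem algebraMap_germ {Y : Scheme.{u}} [IsIntegral Y] {V : Y.Opens} (y : Y) (hy : y ∈ V)
    (a : Γ(Y, V)) : algebraMap (Y.presheaf.stalk y) Y.functionField (Y.presheaf.germ V y hy a) =
      Y.presheaf.germ V (genericPoint Y) (genericPoint_mem hy) a :=
  Y.presheaf.germ_stalkSpecializes_apply hy (genericPoint_specializes y) a

/-! ### Closed points of the projective line and their valuations -/

section line

/-- The chart containing a point. -/
def chartIndex (k : Type u) (q : Option k) : Fin 2 := if q.isNone then 1 else 0

/-- The chart not used at a point. -/
def chartIndex' (k : Type u) (q : Option k) : Fin 2 := if q.isNone then 0 else 1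

theorem chartIndex_ne (k : Type u) (q : Option k) : chartIndex k q ≠ chartIndex' k q := by
  cases q <;> simp [chartIndex, chartIndex']

variable (k : Type u) [Field k]

/-- The closed point of the projective line with affine coordinate `q`. -/
def pt (q : Option k) : projLine k :=
  (exists_not_isUnit_germ (isAffineOpen_chart k (chartIndex k q))
    (chartEval k (chartIndex k q) (chartIndex' k q))
    (chartEval_bijective k _ _ (chartIndex_ne k q)) (q.getD 0)).choose

theorem pt_mem (q : Option k) : pt k q ∈ chart k (chartIndex k q) :=
  (exists_not_isUnit_germ (isAffineOpen_chart k (chartIndex k q))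
    (chartEval k (chartIndex k q) (chartIndex' k q))
    (chartEval_bijective k _ _ (chartIndex_ne k q)) (q.getD 0)).choose_spec.choose

theorem not_isUnit_germ_pt (q : Option k) :
    ¬ IsUnit ((projLine k).presheaf.germ _ (pt k q) (pt_mem k q)
      (chartEval k (chartIndex k q) (chartIndex' k q) (X - C (q.getD 0)))) :=
  (exists_not_isUnit_germ (isAffineOpen_chart k (chartIndex k q))
    (chartEval k (chartIndex k q) (chartIndex' k q))
    (chartEval_bijective k _ _ (chartIndex_ne k q)) (q.getD 0)).choose_spec.choose_spec

theorem isUnit_germ_pt_iff (q : Option k) (f : k[X]) :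
    IsUnit ((projLine k).presheaf.germ _ (pt k q) (pt_mem k q)
      (chartEval k (chartIndex k q) (chartIndex' k q) f)) ↔ f.eval (q.getD 0) ≠ 0 :=
  isUnit_germ_iff_eval_ne_zero (isAffineOpen_chart k _) _
    (chartEval_bijective k _ _ (chartIndex_ne k q)) (not_isUnit_germ_pt k q) f

theorem pt_some_mem (a : k) : pt k (some a) ∈ chart k 0 := pt_mem k (some a)

theorem pt_none_mem : pt k none ∈ chart k 1 := pt_mem k none

variable [IsIntegral (projLine k)]

instance isDiscreteValuationRing_stalk_pt (q : Option k) :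
    IsDiscreteValuationRing ((projLine k).presheaf.stalk (pt k q)) :=
  isDiscreteValuationRing_stalk (isAffineOpen_chart k _) _
    (chartEval_bijective k _ _ (chartIndex_ne k q)) (not_isUnit_germ_pt k q)

/-- The valuation attached to a closed point of the projective line. -/
def lineVal (q : Option k) : Valuation (projLine k).functionField ℤᵐ⁰ :=
  (IsDiscreteValuationRing.maximalIdeal ((projLine k).presheaf.stalk (pt k q))).valuation _

theorem lineVal_le_one_iff (q : Option k) (x : (projLine k).functionField) :
    lineVal k q x ≤ 1 ↔
      x ∈ Set.range (algebraMap ((projLine k).presheaf.stalk (pt k q)) (projLine k).functionField) :=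
  valuation_le_one_iff_mem_range x

/-- The function field of the projective line as an extension of the base field. -/
instance algebraFunctionField : Algebra k (projLine k).functionField :=
  (((projLine k).presheaf.germ ⊤ (genericPoint (projLine k)) (Opens.mem_top _)).hom.comp
    (constMap (projSpaceToSpec k 1) ⊤)).toAlgebra

theorem germ_constMap (V : (projLine k).Opens) (hV : genericPoint (projLine k) ∈ V) (c : k) :
    (projLine k).presheaf.germ V _ hV (constMap (projSpaceToSpec k 1) V c) =
      algebraMap k (projLine k).functionField c := by
  rw [← res_constMap _ le_top, germ_res]
  rfl

theorem genericPoint_mem_chart (i : Fin 2) : genericPoint (projLine k) ∈ chart k i := by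
  fin_cases i
  · exact genericPoint_mem (pt_mem k (some 0))
  · exact genericPoint_mem (pt_mem k none)

/-- The rational function `X₁ / X₀`. -/
def lineCoordinate : (projLine k).functionField :=
  (projLine k).presheaf.germ _ _ (genericPoint_mem_chart k 0) (chartCoordinate k 0 1)

theorem genericPoint_mem_inf : genericPoint (projLine k) ∈ chart k 0 ⊓ chart k 1 :=
  ⟨genericPoint_mem_chart k 0, genericPoint_mem_chart k 1⟩

theorem germ_coordinate : (projLine k).presheaf.germ _ _ (genericPoint_mem_inf k)
    (coordinate k).val = lineCoordinate k := by
  rw [← res_chartCoordinate_eq_coordinate, germ_res]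
  rfl

theorem germ_chartCoordinate_one : (projLine k).presheaf.germ _ _ (genericPoint_mem_chart k 1)
    (chartCoordinate k 1 0) = (lineCoordinate k)⁻¹ := by
  refine eq_inv_of_mul_eq_one_right ?_
  rw [← germ_coordinate, ← germ_res inf_le_right _ (genericPoint_mem_inf k),
    res_chartCoordinate_eq_coordinate_inv, ← map_mul]
  exact (congrArg _ (coordinate k).val_inv).trans (map_one _)

theorem germ_chartEval_zero (f : k[X]) :
    (projLine k).presheaf.germ _ _ (genericPoint_mem_chart k 0) (chartEval k 0 1 f) =
      aeval (lineCoordinate k) f := by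
  have : ((projLine k).presheaf.germ _ _ (genericPoint_mem_chart k 0)).hom.comp (chartEval k 0 1) =
      (aeval (lineCoordinate k) : k[X] →ₐ[k] _).toRingHom := by
    refine Polynomial.ringHom_ext (fun c ↦ ?_) ?_
    · simp [chartEval, germ_constMap]
    · simp [chartEval, lineCoordinate]
  exact congr($this f)

theorem germ_chartEval_one (f : k[X]) :
    (projLine k).presheaf.germ _ _ (genericPoint_mem_chart k 1) (chartEval k 1 0 f) =
      aeval (lineCoordinate k)⁻¹ f := by
  have : ((projLine k).presheaf.germ _ _ (genericPoint_mem_chart k 1)).hom.comp (chartEval k 1 0) =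
      (aeval (lineCoordinate k)⁻¹ : k[X] →ₐ[k] _).toRingHom := by
    refine Polynomial.ringHom_ext (fun c ↦ ?_) ?_
    · simp [chartEval, germ_constMap]
    · simp [chartEval, germ_chartCoordinate_one]
  exact congr($this f)

theorem lineVal_aeval_eq_one (a : k) (f : k[X]) (hf : f.eval a ≠ 0) :
    lineVal k (some a) (aeval (lineCoordinate k) f) = 1 := by
  rw [← germ_chartEval_zero, ← algebraMap_germ (pt k (some a)) (pt_some_mem k a)]
  exact (valuation_algebraMap_eq_one_iff _).2 ((isUnit_germ_pt_iff k (some a) f).2 hf)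

theorem lineVal_none_aeval_eq_one (f : k[X]) (hf : f.eval 0 ≠ 0) :
    lineVal k none (aeval (lineCoordinate k)⁻¹ f) = 1 := by
  rw [← germ_chartEval_one, ← algebraMap_germ (pt k none) (pt_none_mem k)]
  exact (valuation_algebraMap_eq_one_iff _).2 ((isUnit_germ_pt_iff k none f).2 hf)

theorem lineVal_aeval_self (a : k) :
    lineVal k (some a) (aeval (lineCoordinate k) (X - C a)) = exp (-1) := by
  rw [← germ_chartEval_zero, ← algebraMap_germ (pt k (some a)) (pt_some_mem k a)]
  exact valuation_algebraMap_of_span_eq _ (maximalIdeal_stalk_eq_span (isAffineOpen_chart k 0) _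
    (chartEval_bijective k _ _ (chartIndex_ne k (some a))) (not_isUnit_germ_pt k (some a)))

theorem lineVal_none_inv : lineVal k none (lineCoordinate k)⁻¹ = exp (-1) := by
  have : (lineCoordinate k)⁻¹ = aeval (lineCoordinate k)⁻¹ (X - C 0 : k[X]) := by simp
  rw [this, ← germ_chartEval_one, ← algebraMap_germ (pt k none) (pt_none_mem k)]
  exact valuation_algebraMap_of_span_eq _ (maximalIdeal_stalk_eq_span (isAffineOpen_chart k 1) _
    (chartEval_bijective k _ _ (chartIndex_ne k none)) (not_isUnit_germ_pt k none))

theorem aeval_lineCoordinate_injective :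
    Function.Injective (aeval (lineCoordinate k) : k[X] →ₐ[k] (projLine k).functionField) := by
  intro f g h
  rw [← germ_chartEval_zero, ← germ_chartEval_zero] at h
  exact (chartEval_bijective k 0 1 (by simp)).1 (germ_injective_of_isIntegral _ _ _ h)

/-- The function field is the field of rational functions in the coordinate. -/
theorem exists_eq_div (x : (projLine k).functionField) : ∃ f g : k[X], g ≠ 0 ∧
    x = aeval (lineCoordinate k) f / aeval (lineCoordinate k) g := by
  have : Nonempty (chart k 0) := ⟨⟨_, genericPoint_mem_chart k 0⟩⟩
  have := functionField_isFractionRing_of_isAffineOpen (projLine k) (chart k 0) (isAffineOpen_chart k 0)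
  obtain ⟨a, b, hb, rfl⟩ := IsFractionRing.div_surjective (A := Γ(projLine k, chart k 0)) x
  obtain ⟨f, rfl⟩ := (chartEval_bijective k 0 1 (by simp)).2 a
  obtain ⟨g, rfl⟩ := (chartEval_bijective k 0 1 (by simp)).2 b
  refine ⟨f, g, ?_, ?_⟩
  · rintro rfl
    rw [map_zero] at hb
    exact zero_notMem_nonZeroDivisors hb
  · rw [← germ_chartEval_zero, ← germ_chartEval_zero]
    rfl

theorem isLineValuation [IsAlgClosed k] : IsLineValuation (lineCoordinate k) (lineVal k) where
  map_const q c hc := by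
    cases q with
    | none => simpa using lineVal_none_aeval_eq_one k (C c) (by simpa using hc)
    | some a => simpa using lineVal_aeval_eq_one k a (C c) (by simpa using hc)
  map_self a := by simpa using lineVal_aeval_self k a
  map_of_ne a b h := by
    have := lineVal_aeval_eq_one k a (X - C b) (by simpa [sub_eq_zero] using h)
    rwa [map_sub, aeval_X, aeval_C] at this
  map_infty b := by
    have ht : lineCoordinate k ≠ 0 := by
      rw [← aeval_X (R := k) (lineCoordinate k), ← map_zero (aeval (R := k) (lineCoordinate k))]
      exact (aeval_lineCoordinate_injective k).ne X_ne_zero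
    -- Here t - b = t(1 - b t⁻¹), and the second factor is a unit at infinity, where t⁻¹ is the
    -- coordinate.
    have h1 : lineCoordinate k - algebraMap k _ b =
        ((lineCoordinate k)⁻¹)⁻¹ * aeval (lineCoordinate k)⁻¹ (1 - C b * X : k[X]) := by
      simp only [inv_inv, map_sub, map_one, map_mul, aeval_C, aeval_X]
      field_simp
    rw [h1, map_mul, lineVal_none_aeval_eq_one k _ (by simp), map_inv₀, lineVal_none_inv, mul_one,
      ← exp_neg, neg_neg]
  exists_prod x hx := by
    classical
    set t := lineCoordinate k
    let P : (projLine k).functionField → Prop := fun x ↦ ∃ (c : k) (n : k →₀ ℤ), c ≠ 0 ∧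
      x = algebraMap k _ c * n.prod fun a m ↦ (t - algebraMap k _ a) ^ m
    have hne : ∀ a : k, t - algebraMap k _ a ≠ 0 := fun a ↦ by
      have : t - algebraMap k _ a = aeval t (X - C a) := by simp
      rw [this, ← map_zero (aeval (R := k) t)]
      exact (aeval_lineCoordinate_injective k).ne (X_sub_C_ne_zero a)
    have hmul : ∀ x y, P x → P y → P (x * y) := by
      rintro _ _ ⟨c, n, hc, rfl⟩ ⟨d, m, hd, rfl⟩
      refine ⟨c * d, n + m, mul_ne_zero hc hd, ?_⟩
      rw [Finsupp.prod_add_index' (by simp) (fun a _ _ ↦ zpow_add₀ (hne a) _ _), map_mul]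
      ring
    have hinv : ∀ x, P x → P x⁻¹ := by
      rintro _ ⟨c, n, hc, rfl⟩
      refine ⟨c⁻¹, -n, inv_ne_zero hc, ?_⟩
      rw [Finsupp.prod_neg_index (by simp), mul_inv, map_inv₀]
      simp only [zpow_neg, Finsupp.prod, Finset.prod_inv_distrib]
    have hconst : ∀ c : k, c ≠ 0 → P (algebraMap k _ c) := fun c hc ↦ ⟨c, 0, hc, by simp⟩
    have hlin : ∀ a : k, P (t - algebraMap k _ a) := fun a ↦
      ⟨1, Finsupp.single a 1, one_ne_zero, by simp⟩
    have hpoly : ∀ f : k[X], f ≠ 0 → P (aeval t f) := by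
      intro f hf
      rw [(IsAlgClosed.splits f).eq_prod_roots, map_mul, aeval_C, map_multiset_prod,
        Multiset.map_map]
      refine hmul _ _ (hconst _ (leadingCoeff_ne_zero.2 hf)) ?_
      induction f.roots using Multiset.induction_on with
      | empty => simpa using hconst 1 one_ne_zero
      | cons a s ih =>
        rw [Multiset.map_cons, Multiset.prod_cons]
        refine hmul _ _ ?_ ih
        simpa using hlin a
    obtain ⟨f, g, hg, rfl⟩ := exists_eq_div k x
    have hf : f ≠ 0 := by rintro rfl; simp at hx
    rw [div_eq_mul_inv]
    exact hmul _ _ (hpoly f hf) (hinv _ (hpoly g hg))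

end line

end

section


/-! ### Sections of the structure sheaf of the projective line -/

open WithZero Polynomial

/-- A rational function which is regular at all points of `V` is a function on `V`. -/
theorem exists_germ_genericPoint_eq {Y : Scheme.{u}} [IsIntegral Y] (V : Y.Opens)
    (hV : genericPoint Y ∈ V) (x : Y.functionField)
    (hx : ∀ y ∈ V, x ∈ Set.range (algebraMap (Y.presheaf.stalk y) Y.functionField)) :
    ∃ a : Γ(Y, V), Y.presheaf.germ V _ hV a = x := by
  have hloc : ∀ y : V, ∃ (W : Y.Opens) (hW : W ≤ V) (hy : y.1 ∈ W) (a : Γ(Y, W)),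
      Y.presheaf.germ W _ (genericPoint_mem hy) a = x := by
    rintro ⟨y, hy⟩
    obtain ⟨r, rfl⟩ := hx y hy
    obtain ⟨W, hyW, a, rfl⟩ := Y.presheaf.exists_germ_eq r
    refine ⟨W ⊓ V, inf_le_right, ⟨hyW, hy⟩, res inf_le_left a, ?_⟩
    rw [germ_res, algebraMap_germ]
  choose W hW hy a ha using hloc
  obtain ⟨b, hb⟩ := res_glue W hW (fun y hy' ↦ Opens.mem_iSup.2 ⟨⟨y, hy'⟩, hy ⟨y, hy'⟩⟩) a
    fun y z ↦ by
      have hg : genericPoint Y ∈ W y ⊓ W z := ⟨genericPoint_mem (hy y), genericPoint_mem (hy z)⟩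
      refine germ_injective_of_isIntegral _ _ hg ?_
      rw [germ_res, germ_res, ha, ha]
  refine ⟨b, ?_⟩
  rw [← ha ⟨_, hV⟩, ← hb ⟨_, hV⟩, germ_res]

variable (k : Type u) [Field k]

theorem chartEval_X (i j : Fin 2) : chartEval k i j X = chartCoordinate k i j := by
  simp [chartEval]

theorem pt_some_mem_chart_one_iff (a : k) : pt k (some a) ∈ chart k 1 ↔ a ≠ 0 := by
  constructor
  · rintro h rfl
    refine not_isUnit_germ_pt k (some 0) ?_
    have hm : pt k (some 0) ∈ chart k 0 ⊓ chart k 1 := ⟨pt_some_mem k 0, h⟩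
    have hu : IsUnit (coordinate k).val := (coordinate k).isUnit
    rw [← res_chartCoordinate_eq_coordinate] at hu
    have e2 : (chartEval k 0 1) (X - C 0) = chartCoordinate k 0 1 := by
      rw [map_zero, sub_zero, chartEval_X]
    change IsUnit ((projLine k).presheaf.germ (chart k 0) _ _ (chartEval k 0 1 (X - C 0)))
    rw [e2, ← germ_res inf_le_left _ hm]
    exact hu.map ((projLine k).presheaf.germ _ _ hm).hom
  · intro ha
    refine mem_chart_of_isUnit k 0 1 _ (pt_some_mem k a) ?_
    rw [← chartEval_X]
    exact (isUnit_germ_pt_iff k (some a) X).2 (by simpa using ha)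

theorem pt_none_notMem_chart_zero : pt k none ∉ chart k 0 := by
  intro h
  refine not_isUnit_germ_pt k none ?_
  have hm : pt k none ∈ chart k 0 ⊓ chart k 1 := ⟨h, pt_none_mem k⟩
  have hu : IsUnit (coordinate k).inv := (coordinate k)⁻¹.isUnit
  rw [← res_chartCoordinate_eq_coordinate_inv] at hu
  have e2 : (chartEval k 1 0) (X - C 0) = chartCoordinate k 1 0 := by
    rw [map_zero, sub_zero, chartEval_X]
  change IsUnit ((projLine k).presheaf.germ (chart k 1) _ _ (chartEval k 1 0 (X - C 0)))
  rw [e2, ← germ_res inf_le_right _ hm]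
  exact hu.map ((projLine k).presheaf.germ _ _ hm).hom

theorem pt_mem_chart_zero_iff (q : Option k) : pt k q ∈ chart k 0 ↔ q ≠ none := by
  cases q with
  | none => simpa using pt_none_notMem_chart_zero k
  | some a => simpa using pt_some_mem k a

theorem pt_mem_chart_one_iff (q : Option k) : pt k q ∈ chart k 1 ↔ q ≠ some 0 := by
  cases q with
  | none => simpa using pt_none_mem k
  | some a => simpa using pt_some_mem_chart_one_iff k a

variable [IsIntegral (projLine k)]

theorem pt_ne_genericPoint (q : Option k) : pt k q ≠ genericPoint (projLine k) := by
  intro h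
  have := isDiscreteValuationRing_stalk_pt k q
  rw [h] at this
  exact IsDiscreteValuationRing.not_isField _
    (Field.toIsField (projLine k).functionField)

theorem eq_genericPoint_or_exists_pt [IsAlgClosed k] (y : projLine k) :
    y = genericPoint (projLine k) ∨ ∃ q, y = pt k q := by
  have h0 : ∀ hy : y ∈ chart k 0, y = genericPoint (projLine k) ∨ ∃ q, y = pt k q := by
    intro hy
    refine (eq_genericPoint_or_exists_not_isUnit (isAffineOpen_chart k 0) (chartEval k 0 1)
      (chartEval_bijective k 0 1 (by simp)) y hy).imp_right ?_
    rintro ⟨a, ha⟩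
    exact ⟨some a, eq_of_not_isUnit_germ (isAffineOpen_chart k 0) (chartEval k 0 1)
      (chartEval_bijective k 0 1 (by simp)) ha (not_isUnit_germ_pt k (some a))⟩
  have hy : y ∈ chart k 0 ⊔ chart k 1 := by rw [chart_sup_chart]; trivial
  rcases hy with hy | hy
  · exact h0 hy
  · rcases eq_genericPoint_or_exists_not_isUnit (isAffineOpen_chart k 1) (chartEval k 1 0)
      (chartEval_bijective k 1 0 (by simp)) y hy with h | ⟨a, ha⟩
    · exact Or.inl h
    · rcases eq_or_ne a 0 with rfl | ha0
      · exact Or.inr ⟨none, eq_of_not_isUnit_germ (isAffineOpen_chart k 1) (chartEval k 1 0)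
          (chartEval_bijective k 1 0 (by simp)) ha (not_isUnit_germ_pt k none)⟩
      · refine h0 (mem_chart_of_isUnit k 1 0 _ hy ?_)
        rw [← chartEval_X]
        exact (isUnit_germ_iff_eval_ne_zero (isAffineOpen_chart k 1) _
          (chartEval_bijective k 1 0 (by simp)) ha X).2 (by simpa using ha0)

theorem lineVal_germ_le_one (V : (projLine k).Opens) (q : Option k) (hq : pt k q ∈ V)
    (a : Γ(projLine k, V)) :
    lineVal k q ((projLine k).presheaf.germ V _ (genericPoint_mem hq) a) ≤ 1 := by
  rw [lineVal_le_one_iff, ← algebraMap_germ (pt k q) hq]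
  exact ⟨_, rfl⟩

/-- Regularity at a closed point is the valuation bound, and at the generic point there is no
condition; these are all the points. -/
theorem exists_germ_eq_of_lineVal_le_one [IsAlgClosed k] (V : (projLine k).Opens)
    (hV : genericPoint (projLine k) ∈ V) (x : (projLine k).functionField)
    (hx : ∀ q, pt k q ∈ V → lineVal k q x ≤ 1) :
    ∃ a : Γ(projLine k, V), (projLine k).presheaf.germ V _ hV a = x := by
  refine exists_germ_genericPoint_eq V hV x fun y hy ↦ ?_
  rcases eq_genericPoint_or_exists_pt k y with rfl | ⟨q, rfl⟩
  · obtain ⟨W, hW, a, rfl⟩ := (projLine k).presheaf.exists_germ_eq x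
    exact ⟨(projLine k).presheaf.germ W _ hW a, algebraMap_germ _ hW a⟩
  · rw [← lineVal_le_one_iff]
    exact hx q hy

/-- A nonempty open set contains a basic open of the chart 0, and so misses at most infinity and the
roots of one polynomial. -/
theorem finite_pt_notMem (V : (projLine k).Opens) (hV : genericPoint (projLine k) ∈ V) :
    {q | pt k q ∉ V}.Finite := by
  classical
  obtain ⟨s, hs, hs'⟩ := (isAffineOpen_chart k 0).exists_basicOpen_le
    (V := V) ⟨_, hV⟩ (genericPoint_mem_chart k 0)
  obtain ⟨f, rfl⟩ := (chartEval_bijective k 0 1 (by simp)).2 s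
  have hf : f ≠ 0 := by
    rintro rfl
    rw [map_zero, Scheme.basicOpen_zero] at hs'
    exact hs'
  refine ((f.roots.toFinset.finite_toSet.image some).union (Set.finite_singleton none)).subset ?_
  rintro (_ | a) hq
  · simp
  · refine Or.inl ⟨a, ?_, rfl⟩
    by_contra ha
    refine hq (hs ?_)
    have ha' : f.eval a ≠ 0 := by simpa [hf] using ha
    exact (Scheme.mem_basicOpen _ _ _ (pt_some_mem k a)).2 ((isUnit_germ_pt_iff k (some a) f).2 ha')

instance compactSpace_projLine : CompactSpace (projLine k) := by
  rw [← isCompact_univ_iff]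
  have := congrArg (fun V : (projLine k).Opens ↦ (V : Set (projLine k))) (chart_sup_chart k)
  simp only [Opens.coe_sup, Opens.coe_top] at this
  rw [← this]
  exact (isAffineOpen_chart k 0).isCompact.union (isAffineOpen_chart k 1).isCompact

/-! ### The derivation of the function field -/

theorem isCoordinateSystem_algebraMap {R B : Type u} [CommRing R] [CommRing B] [A : Algebra R B]
    {ι : Type} {w : ι → B} (b : Module.Basis ι B (Ω[B⁄R]))
    (hb : ∀ j, b j = KaehlerDifferential.D R B (w j)) :
    IsCoordinateSystem (algebraMap R B) w := by
  have key : ∀ A' : Algebra R B, A = A' →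
      ∃ b : Module.Basis ι B (@KaehlerDifferential R B _ _ A'),
        ∀ j, b j = @KaehlerDifferential.D R B _ _ A' (w j) := by
    rintro _ rfl
    exact ⟨b, hb⟩
  exact key _ (toAlgebra_algebraMap).symm

omit [IsIntegral (projLine k)] in
theorem isCoordinateSystem_polynomial :
    IsCoordinateSystem (C : k →+* k[X]) (fun _ : Unit ↦ (X : k[X])) := by
  refine isCoordinateSystem_algebraMap
    ((Module.Basis.singleton Unit k[X]).map (KaehlerDifferential.polynomialEquiv k).symm)
    fun _ ↦ ?_
  rw [Module.Basis.map_apply, Module.Basis.singleton_apply, LinearEquiv.symm_apply_eq,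
    KaehlerDifferential.polynomialEquiv_D, derivative_X]

/-- The derivation of the function field with respect to the coordinate. -/
theorem exists_derivation : ∃ d : (projLine k).functionField →+ (projLine k).functionField,
    (∀ a b, d (a * b) = a * d b + b * d a) ∧ (∀ c, d (algebraMap k _ c) = 0) ∧
      d (lineCoordinate k) = 1 := by
  -- The derivation d/dX of k[X] is carried to the function field through an isomorphism and a
  -- localization, both formally étale.
  have h1 := (isCoordinateSystem_polynomial k).map_of_formallyEtale (chartEval k 0 1)
    (RingHom.Etale.of_bijective (chartEval_bijective k 0 1 (by simp))).formallyEtale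
  have h2 := h1.map_of_formallyEtale _ (formallyEtale_germ (isAffineOpen_chart k 0)
    (genericPoint (projLine k)) (genericPoint_mem_chart k 0))
  obtain ⟨e, he1, he2, he3, -⟩ := h2.exists_dual
  refine ⟨e (), he1 (), fun c ↦ ?_, ?_⟩
  · rw [← he2 () c]
    congr 1
    refine Eq.trans ?_ (germ_chartEval_zero k (C c)).symm
    rw [aeval_C]
  · have := he3 () ()
    rw [if_pos rfl] at this
    rw [← this]
    congr 1
    refine Eq.trans ?_ (germ_chartEval_zero k X).symm
    rw [aeval_X]

section derivation

variable {k}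
variable {d : (projLine k).functionField →+ (projLine k).functionField}
  (hd : ∀ a b, d (a * b) = a * d b + b * d a) (hc : ∀ c, d (algebraMap k _ c) = 0)

include hd in
theorem derivation_div (a b : (projLine k).functionField) (hb : b ≠ 0) :
    d (a / b) = (d a - a / b * d b) / b := by
  have := hd (a / b) b
  rw [div_mul_cancel₀ _ hb] at this
  field_simp
  field_simp at this
  linear_combination -this

include hd hc

theorem derivation_aeval (x : (projLine k).functionField) (f : k[X]) :
    d (aeval x f) = aeval x (derivative f) * d x := by
  induction f using Polynomial.induction_on' with
  | add p q hp hq => rw [map_add, map_add, hp, hq, map_add, map_add, add_mul]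
  | monomial n a =>
    rw [aeval_monomial, hd, hc, mul_zero, add_zero, derivative_monomial, aeval_monomial]
    have : ∀ n : ℕ, d (x ^ n) = n * x ^ (n - 1) * d x := by
      intro n
      induction n with
      | zero =>
        have := hd 1 1
        simp only [mul_one, one_mul] at this
        simp at this ⊢
        exact this
      | succ n ih =>
        rw [pow_succ, hd, ih]
        rcases n with _ | n
        · simp
        · simp only [Nat.add_sub_cancel]
          push_cast
          ring
    rw [this, map_mul, map_natCast]
    ring

end derivation

/-- The coordinate used at a closed point. -/
def localCoordinate (q : Option k) : (projLine k).functionField :=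
  if q = none then (lineCoordinate k)⁻¹ else lineCoordinate k

theorem germ_chartEval_chartIndex (q : Option k) (f : k[X]) :
    (projLine k).presheaf.germ _ _ (genericPoint_mem_chart k (chartIndex k q))
      (chartEval k (chartIndex k q) (chartIndex' k q) f) = aeval (localCoordinate k q) f := by
  cases q with
  | none => exact germ_chartEval_one k f
  | some a => exact germ_chartEval_zero k f

theorem lineVal_aeval_localCoordinate_le_one (q : Option k) (f : k[X]) :
    lineVal k q (aeval (localCoordinate k q) f) ≤ 1 := by
  rw [← germ_chartEval_chartIndex]
  exact lineVal_germ_le_one k _ q (pt_mem k q) _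

theorem lineVal_aeval_localCoordinate_eq_one (q : Option k) (f : k[X]) (hf : f.eval (q.getD 0) ≠ 0) :
    lineVal k q (aeval (localCoordinate k q) f) = 1 := by
  cases q with
  | none => exact lineVal_none_aeval_eq_one k f hf
  | some a => exact lineVal_aeval_eq_one k a f hf

theorem lineVal_localCoordinate_sub (q : Option k) :
    lineVal k q (localCoordinate k q - algebraMap k _ (q.getD 0)) = exp (-1) := by
  cases q with
  | none =>
    have := lineVal_none_inv k
    simp only [localCoordinate, if_true, Option.getD_none, map_zero, sub_zero]
    exact this
  | some a =>
    have := lineVal_aeval_self k a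
    rw [map_sub, aeval_X, aeval_C] at this
    exact this

theorem exists_eq_div_of_lineVal_le_one (q : Option k) (x : (projLine k).functionField)
    (hx : lineVal k q x ≤ 1) : ∃ f g : k[X], g.eval (q.getD 0) ≠ 0 ∧
      x = aeval (localCoordinate k q) f / aeval (localCoordinate k q) g := by
  obtain ⟨r, rfl⟩ := (lineVal_le_one_iff k q x).1 hx
  let i := chartIndex k q
  let : Algebra Γ(projLine k, chart k i) ((projLine k).presheaf.stalk (pt k q)) :=
    ((projLine k).presheaf.germ _ _ (pt_mem k q)).hom.toAlgebra
  have : IsLocalization.AtPrime ((projLine k).presheaf.stalk (pt k q))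
      ((isAffineOpen_chart k i).primeIdealOf ⟨pt k q, pt_mem k q⟩).asIdeal :=
    (isAffineOpen_chart k i).isLocalization_stalk ⟨pt k q, pt_mem k q⟩
  obtain ⟨a, b, rfl⟩ := IsLocalization.exists_mk'_eq
    ((isAffineOpen_chart k i).primeIdealOf ⟨pt k q, pt_mem k q⟩).asIdeal.primeCompl r
  have hspec := IsLocalization.mk'_spec ((projLine k).presheaf.stalk (pt k q)) a b
  obtain ⟨b, hb⟩ := b
  obtain ⟨f, rfl⟩ := (chartEval_bijective k _ _ (chartIndex_ne k q)).2 a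
  obtain ⟨g, rfl⟩ := (chartEval_bijective k _ _ (chartIndex_ne k q)).2 b
  have hg : g.eval (q.getD 0) ≠ 0 :=
    (isUnit_germ_pt_iff k q g).1 ((isUnit_germ_iff_notMem (isAffineOpen_chart k i) _ _ _).2 hb)
  refine ⟨f, g, hg, ?_⟩
  have hg0 : aeval (localCoordinate k q) g ≠ 0 := by
    rw [← (lineVal k q).ne_zero_iff, lineVal_aeval_localCoordinate_eq_one k q g hg]
    exact one_ne_zero
  rw [eq_div_iff hg0]
  have h2 := congrArg (algebraMap ((projLine k).presheaf.stalk (pt k q))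
    (projLine k).functionField) hspec
  rw [map_mul] at h2
  have e : ∀ f : k[X], algebraMap ((projLine k).presheaf.stalk (pt k q))
      (projLine k).functionField (algebraMap Γ(projLine k, chart k i) _
        (chartEval k (chartIndex k q) (chartIndex' k q) f)) = aeval (localCoordinate k q) f :=
    fun f ↦ (algebraMap_germ (pt k q) (pt_mem k q) _).trans (germ_chartEval_chartIndex k q f)
  rw [e, e] at h2
  exact h2

section

variable {k} [IsAlgClosed k]
variable {d : (projLine k).functionField →+ (projLine k).functionField}
  (hd : ∀ a b, d (a * b) = a * d b + b * d a) (hc : ∀ c, d (algebraMap k _ c) = 0)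
  (ht : d (lineCoordinate k) = 1)

open IsLineValuation

-- This says that d/dt is a nowhere vanishing section of T_{ℙ¹}(-2) = 𝒪: at infinity the twisting
-- factor t² compensates d(t⁻¹) = -t⁻².
include hd ht in
theorem lineVal_twistFactor_mul_derivation_localCoordinate (q : Option k) :
    lineVal k q (twistFactor (lineCoordinate k) q * d (localCoordinate k q)) = 1 := by
  have ht0 : lineCoordinate k ≠ 0 := by simpa using (isLineValuation k).sub_ne_zero 0
  cases q with
  | some a => simp [twistFactor, localCoordinate, ht]
  | none =>
    have h1 := derivation_div hd 1 (lineCoordinate k) ht0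
    have h0 : d 1 = 0 := by
      have := hd 1 1
      simpa using this
    rw [h0, ht, one_div] at h1
    simp only [twistFactor, localCoordinate, if_true, h1]
    have : lineCoordinate k ^ 2 * ((0 - (lineCoordinate k)⁻¹ * 1) / lineCoordinate k) = -1 := by
      field_simp
      simp
    rw [this, Valuation.map_neg, map_one]

include hd hc ht

/-- Regularity of derivatives. -/
theorem lineVal_twistFactor_mul_derivation_le_one (q : Option k) (x : (projLine k).functionField)
    (hx : lineVal k q x ≤ 1) : lineVal k q (twistFactor (lineCoordinate k) q * d x) ≤ 1 := by
  obtain ⟨f, g, hg, rfl⟩ := exists_eq_div_of_lineVal_le_one k q x hx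
  have hg1 := lineVal_aeval_localCoordinate_eq_one k q g hg
  have hg0 : aeval (localCoordinate k q) g ≠ 0 := by
    rw [← (lineVal k q).ne_zero_iff, hg1]
    exact one_ne_zero
  have hpoly : ∀ f : k[X],
      lineVal k q (twistFactor (lineCoordinate k) q * d (aeval (localCoordinate k q) f)) ≤ 1 := by
    intro f
    rw [derivation_aeval hd hc, mul_left_comm, map_mul,
      lineVal_twistFactor_mul_derivation_localCoordinate hd ht q, mul_one]
    exact lineVal_aeval_localCoordinate_le_one k q _
  rw [derivation_div hd _ _ hg0, ← mul_div_assoc, map_div₀, hg1, div_one, mul_sub]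
  refine Valuation.map_sub_le _ (hpoly f) ?_
  rw [mul_left_comm, map_mul]
  exact mul_le_one' hx (hpoly g)

/-- The derivative of a uniformizer is a unit. -/
theorem lineVal_twistFactor_mul_derivation_eq_one (q : Option k) (x : (projLine k).functionField)
    (hx : lineVal k q x = exp (-1)) : lineVal k q (twistFactor (lineCoordinate k) q * d x) = 1 := by
  set π := localCoordinate k q - algebraMap k _ (q.getD 0) with hπ
  have hπv : lineVal k q π = exp (-1) := lineVal_localCoordinate_sub k q
  have hπ0 : π ≠ 0 := by
    rw [← (lineVal k q).ne_zero_iff, hπv]; exact exp_ne_zero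
  have hu : lineVal k q (x / π) = 1 := by
    rw [map_div₀, hx, hπv, div_self exp_ne_zero]
  have hdπ : d π = d (localCoordinate k q) := by rw [hπ, map_sub, hc, sub_zero]
  -- The product rule for x = π · (x/π): the term with π as a factor vanishes at q and the other is
  -- a unit, whatever the characteristic.
  have e : twistFactor (lineCoordinate k) q * d x =
      π * (twistFactor (lineCoordinate k) q * d (x / π)) +
        x / π * (twistFactor (lineCoordinate k) q * d (localCoordinate k q)) := by
    conv_lhs => rw [← div_mul_cancel₀ x hπ0, hd, hdπ]
    ring
  have h1 : lineVal k q (x / π * (twistFactor (lineCoordinate k) q * d (localCoordinate k q))) = 1 := by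
    rw [map_mul, hu, lineVal_twistFactor_mul_derivation_localCoordinate hd ht q, one_mul]
  have h2 : lineVal k q (π * (twistFactor (lineCoordinate k) q * d (x / π))) < 1 := by
    rw [map_mul, hπv]
    refine (mul_le_mul_right (lineVal_twistFactor_mul_derivation_le_one hd hc ht q _ hu.le) _).trans_lt ?_
    rw [mul_one, ← exp_zero, exp_lt_exp]
    omega
  rw [e, Valuation.map_add_eq_of_lt_right _ (by rwa [h1]), h1]

end

end

section


/-! ### Coordinates on the generic fibre of the pulled back tangent sheaf -/

open scoped Matrix

section Coordinates

theorem germ_genericPoint_injective {Y : Scheme.{u}} [IsIntegral Y] {V : Y.Opens}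
    (hV : genericPoint Y ∈ V) :
    Function.Injective (Y.presheaf.germ V (genericPoint Y) hV) :=
  germ_injective_of_isIntegral _ _ hV

theorem LocalFunctional.map_sum {Y : Scheme.{u}} {M : Y.Modules} {U : Y.Opens}
    (l : LocalFunctional M U)
    {ι : Type*} [Fintype ι] {V : Y.Opens} (hV : V ≤ U) (a : ι → Γ(Y, V)) (m : ι → Γ(M, V)) :
    l.toFun V hV (∑ i, a i • m i) = ∑ i, a i * l.toFun V hV (m i) := by
  rw [_root_.map_sum]
  exact Finset.sum_congr rfl fun i _ ↦ l.map_smul V hV _ _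

variable {X Y : Scheme.{u}} (f : Y ⟶ X)

section

variable [IsIntegral Y]

theorem mem_of_mem_preimage {U : X.Opens} {y : Y} (hy : f y ∈ U) : f (genericPoint Y) ∈ U :=
  genericPoint_mem (V := f ⁻¹ᵁ U) hy

theorem generic_mem_preimage {U : X.Opens} (hU : f (genericPoint Y) ∈ U) :
    genericPoint Y ∈ f ⁻¹ᵁ U := hU

theorem generic_mem_inf_preimage {U : X.Opens} {V : Y.Opens} (hV : genericPoint Y ∈ V)
    (hU : f (genericPoint Y) ∈ U) : genericPoint Y ∈ V ⊓ f ⁻¹ᵁ U := ⟨hV, hU⟩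

/-- Pullback of functions to the function field of `Y`. -/
def pullGerm {U : X.Opens} (hU : f (genericPoint Y) ∈ U) : Γ(X, U) →+* Y.functionField :=
  (Y.presheaf.germ (f ⁻¹ᵁ U) (genericPoint Y) (generic_mem_preimage f hU)).hom.comp (f.app U).hom

theorem pullGerm_apply {U : X.Opens} (hU : f (genericPoint Y) ∈ U) (a : Γ(X, U)) :
    pullGerm f hU a = Y.presheaf.germ (f ⁻¹ᵁ U) (genericPoint Y)
      (generic_mem_preimage f hU) (f.app U a) := rfl

theorem pullGerm_res {U V : X.Opens} (h : V ≤ U) (hV : f (genericPoint Y) ∈ V) (a : Γ(X, U)) :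
    pullGerm f hV (res h a) = pullGerm f (h hV) a := by
  rw [pullGerm_apply, pullGerm_apply, app_res, germ_res]

end

variable {S : Scheme.{u}} {s : X ⟶ S}

section

variable [IsIntegral Y]

/-- The transition matrix between two charts, over the function field of `Y`. -/
def transition (c c' : Chart s) (hc : f (genericPoint Y) ∈ c.U) (hc' : f (genericPoint Y) ∈ c'.U) :
    Matrix (Fin 2) (Fin 2) Y.functionField :=
  fun i j ↦ pullGerm f (U := c.U ⊓ c'.U) ⟨hc, hc'⟩
    ((c.e i).1 ⟨c.U ⊓ c'.U, inf_le_left⟩ (res inf_le_right (c'.w j)))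

theorem transition_apply (c c' : Chart s) (hc : f (genericPoint Y) ∈ c.U)
    (hc' : f (genericPoint Y) ∈ c'.U) (V : X.Opens) (hV : V ≤ c.U) (hV' : V ≤ c'.U)
    (hη : f (genericPoint Y) ∈ V) (i j : Fin 2) : transition f c c' hc hc' i j =
      pullGerm f hη ((c.e i).1 ⟨V, hV⟩ (res hV' (c'.w j))) := by
  have := (c.e i).2.2.1 ⟨c.U ⊓ c'.U, inf_le_left⟩ ⟨V, hV⟩ (le_inf hV hV')
    (res inf_le_right (c'.w j))
  rw [res_res] at this
  rw [← this, pullGerm_res]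
  rfl

theorem transition_self (c : Chart s) (hc : f (genericPoint Y) ∈ c.U) :
    transition f c c hc hc = 1 := by
  ext i j
  rw [transition_apply f c c hc hc c.U le_rfl le_rfl hc, c.dual i j ⟨c.U, le_rfl⟩,
    Matrix.one_apply]
  split_ifs <;> simp

/-- The chain rule: the vector field e_i of c is expanded in the chart c' before being applied to
the coordinates of c''. -/
theorem transition_mul (c c' c'' : Chart s) (hc : f (genericPoint Y) ∈ c.U)
    (hc' : f (genericPoint Y) ∈ c'.U) (hc'' : f (genericPoint Y) ∈ c''.U) :
    transition f c c' hc hc' * transition f c' c'' hc' hc'' = transition f c c'' hc hc'' := by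
  ext i j
  let V := c.U ⊓ c'.U ⊓ c''.U
  have h : V ≤ c.U := inf_le_left.trans inf_le_left
  have h' : V ≤ c'.U := inf_le_left.trans inf_le_right
  have h'' : V ≤ c''.U := inf_le_right
  have hη : f (genericPoint Y) ∈ V := ⟨⟨hc, hc'⟩, hc''⟩
  rw [Matrix.mul_apply, transition_apply f c c'' hc hc'' V h h'' hη]
  have := c'.expand_tangentSections h' (mres (tangentSheaf s) h (c.e i)) ⟨V, le_rfl⟩
    (res h'' (c''.w j))
  refine Eq.trans ?_ (congrArg (pullGerm f hη) this.symm)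
  rw [map_sum]
  refine Finset.sum_congr rfl fun l _ ↦ ?_
  rw [map_mul, transition_apply f c c' hc hc' V h h' hη,
    transition_apply f c' c'' hc' hc'' V h' h'' hη, mul_comm]
  rfl

theorem det_transition_ne_zero (c c' : Chart s) (hc : f (genericPoint Y) ∈ c.U)
    (hc' : f (genericPoint Y) ∈ c'.U) : (transition f c c' hc hc').det ≠ 0 := by
  have := congrArg Matrix.det (transition_mul f c c' c hc hc' hc)
  rw [transition_self, Matrix.det_mul, Matrix.det_one] at this
  exact left_ne_zero_of_mul_eq_one this

end

/-- The dual vector fields of a chart as sections of the tangent sheaf. -/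
def Chart.field (c : Chart s) (i : Fin 2) : Γ(tangentSheaf s, c.U) := c.e i

theorem Chart.evalAt_mres_field (c : Chart s) (i : Fin 2) {U V : X.Opens} (hV : V ≤ c.U)
    (hVU : V ≤ U) (w : Γ(X, U)) :
    (evalAt s w).toFun V hVU (mres _ hV (c.field i)) = (c.e i).1 ⟨V, hV⟩ (res hVU w) := rfl

/-- Pulled back tangent sheaf. -/
abbrev pullTangent (s : X ⟶ S) (f : Y ⟶ X) : Y.Modules :=
  (Scheme.Modules.pullback f).obj (tangentSheaf s)

/-- The coordinate functionals of a chart on the pulled back tangent sheaf. -/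
def coordinateFunctional (c : Chart s) (j : Fin 2) :
    LocalFunctional (pullTangent s f) (f ⁻¹ᵁ c.U) :=
  ((evalAt s (c.w j)).exists_pullback f).choose

theorem coordinateFunctional_pullSec (c : Chart s) (j : Fin 2) (V : X.Opens) (hV : V ≤ c.U)
    (m : Γ(tangentSheaf s, V)) :
    (coordinateFunctional f c j).toFun _ (f.preimage_mono hV) (pullSec f _ V m) =
      f.app V ((evalAt s (c.w j)).toFun V hV m) :=
  ((evalAt s (c.w j)).exists_pullback f).choose_spec V hV m

theorem eq_sum_coordinateFunctional (c : Chart s) (V : Y.Opens) (hV : V ≤ f ⁻¹ᵁ c.U)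
    (m : Γ(pullTangent s f, V)) :
    m = ∑ j, (coordinateFunctional f c j).toFun V hV m •
      mres _ hV (pullSec f (tangentSheaf s) c.U (c.field j)) :=
  eq_sum_of_pullback f (M := tangentSheaf s) c.field (fun j ↦ evalAt s (c.w j)) c.eq_sum_evalAt
    (fun j ↦ coordinateFunctional f c j) (fun j ↦ coordinateFunctional_pullSec f c j) V hV m

variable {f} [IsIntegral Y]

/-- The coordinates of a section of the pulled back tangent sheaf over the generic point. -/
def genericCoords (c : Chart s) (hc : f (genericPoint Y) ∈ c.U) {V : Y.Opens}
    (hV : genericPoint Y ∈ V) : Γ(pullTangent s f, V) →+ (Fin 2 → Y.functionField) :=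
  AddMonoidHom.pi fun j ↦
    (Y.presheaf.germ (V ⊓ f ⁻¹ᵁ c.U) (genericPoint Y)
      (generic_mem_inf_preimage f hV hc)).hom.toAddMonoidHom.comp <|
      ((coordinateFunctional f c j).toFun _ inf_le_right).comp (mres _ inf_le_left)

theorem genericCoords_apply (c : Chart s) (hc : f (genericPoint Y) ∈ c.U) {V W : Y.Opens}
    (hV : genericPoint Y ∈ V) (hWV : W ≤ V) (hWc : W ≤ f ⁻¹ᵁ c.U) (hW : genericPoint Y ∈ W)
    (m : Γ(pullTangent s f, V)) (j : Fin 2) : genericCoords c hc hV m j =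
      Y.presheaf.germ W (genericPoint Y) hW
        ((coordinateFunctional f c j).toFun W hWc (mres _ hWV m)) := by
  have hle : W ≤ V ⊓ f ⁻¹ᵁ c.U := le_inf hWV hWc
  rw [← mres_mres _ inf_le_left hle, ← (coordinateFunctional f c j).map_res _ _ inf_le_right,
    germ_res]
  rfl

theorem genericCoords_mres (c : Chart s) (hc : f (genericPoint Y) ∈ c.U) {V W : Y.Opens}
    (hWV : W ≤ V) (hW : genericPoint Y ∈ W) (m : Γ(pullTangent s f, V)) :
    genericCoords c hc hW (mres _ hWV m) = genericCoords c hc (hWV hW) m := by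
  ext j
  have hle : W ⊓ f ⁻¹ᵁ c.U ≤ V := inf_le_left.trans hWV
  rw [genericCoords_apply c hc (hWV hW) hle inf_le_right
      (generic_mem_inf_preimage f hW hc),
    genericCoords_apply c hc hW inf_le_left inf_le_right
      (generic_mem_inf_preimage f hW hc), mres_mres]

theorem genericCoords_smul (c : Chart s) (hc : f (genericPoint Y) ∈ c.U) {V : Y.Opens}
    (hV : genericPoint Y ∈ V) (r : Γ(Y, V)) (m : Γ(pullTangent s f, V)) :
    genericCoords c hc hV (r • m) =
      Y.presheaf.germ V (genericPoint Y) hV r • genericCoords c hc hV m := by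
  ext j
  rw [Pi.smul_apply, genericCoords_apply c hc hV inf_le_left inf_le_right
      (generic_mem_inf_preimage f hV hc),
    genericCoords_apply c hc hV inf_le_left inf_le_right
      (generic_mem_inf_preimage f hV hc), mres_smul,
    LocalFunctional.map_smul, map_mul, germ_res, smul_eq_mul]

/-- Expand m in the pulled back frame of c. The coordinate functionals of c' take on this frame the
pulled back values e_i(w'_j), the entries of the transition matrix. -/
theorem genericCoords_transition (c c' : Chart s) (hc : f (genericPoint Y) ∈ c.U)
    (hc' : f (genericPoint Y) ∈ c'.U) {V : Y.Opens}
    (hV : genericPoint Y ∈ V) (m : Γ(pullTangent s f, V)) :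
    genericCoords c' hc' hV m = genericCoords c hc hV m ᵥ* transition f c c' hc hc' := by
  ext j
  let U := c.U ⊓ c'.U
  have hU : U ≤ c.U := inf_le_left
  have hU' : U ≤ c'.U := inf_le_right
  let W := V ⊓ f ⁻¹ᵁ U
  have hη : f (genericPoint Y) ∈ U := ⟨hc, hc'⟩
  have hW : genericPoint Y ∈ W := generic_mem_inf_preimage f hV hη
  have hWU : W ≤ f ⁻¹ᵁ U := inf_le_right
  have hWc : W ≤ f ⁻¹ᵁ c.U := hWU.trans (f.preimage_mono hU)
  have hWc' : W ≤ f ⁻¹ᵁ c'.U := hWU.trans (f.preimage_mono hU')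
  have hWV : W ≤ V := inf_le_left
  rw [genericCoords_apply c' hc' hV hWV hWc' hW, eq_sum_coordinateFunctional f c W hWc
    (mres _ hWV m), LocalFunctional.map_sum, map_sum, Matrix.vecMul, dotProduct]
  refine Finset.sum_congr rfl fun i _ ↦ ?_
  rw [map_mul, genericCoords_apply c hc hV hWV hWc hW]
  congr 1
  rw [← mres_mres _ (f.preimage_mono hU) hWU, mres_pullSec,
    ← LocalFunctional.map_res _ _ _ (f.preimage_mono hU'), coordinateFunctional_pullSec, germ_res,
    Chart.evalAt_mres_field,
    transition_apply f c c' hc hc' U hU hU' hη, pullGerm_apply]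

/-- Near any point of V there is a chart; the coordinates in it are obtained by a transition matrix,
hence vanish at the generic point, hence vanish as Y is integral. -/
theorem genericCoords_injective [Subsingleton S] [SmoothOfRelativeDimension 2 s] (c : Chart s)
    (hc : f (genericPoint Y) ∈ c.U) {V : Y.Opens} (hV : genericPoint Y ∈ V) :
    Function.Injective (genericCoords (f := f) c hc hV) := by
  rw [injective_iff_map_eq_zero]
  intro m hm
  choose c' hc' using fun y : Y ↦ exists_chart s (f y)
  refine mres_ext _ (fun y : V ↦ V ⊓ f ⁻¹ᵁ (c' y).U) (fun _ ↦ inf_le_left)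
    (fun y hy ↦ Opens.mem_iSup.2 ⟨⟨y, hy⟩, ⟨hy, hc' y⟩⟩) _ _ fun y ↦ ?_
  have hη := mem_of_mem_preimage f (hc' y)
  have h0 : genericCoords (c' y) hη hV m = 0 := by
    rw [genericCoords_transition c _ hc, hm, Matrix.zero_vecMul]
  rw [map_zero, eq_sum_coordinateFunctional f (c' y) _ inf_le_right (mres _ _ m)]
  refine Finset.sum_eq_zero fun j _ ↦ ?_
  have : (coordinateFunctional f (c' y) j).toFun _ inf_le_right (mres _ inf_le_left m) = 0 := by
    apply germ_genericPoint_injective (generic_mem_inf_preimage f hV hη)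
    rw [← genericCoords_apply (c' y) hη hV, h0, map_zero]
    rfl
  rw [this, zero_smul]

theorem genericCoords_sum_pullSec (c : Chart s) (hc : f (genericPoint Y) ∈ c.U) {V : Y.Opens}
    (hV : genericPoint Y ∈ V) (hVc : V ≤ f ⁻¹ᵁ c.U) (a : Fin 2 → Γ(Y, V)) :
    genericCoords c hc hV (∑ j, a j • mres _ hVc (pullSec f (tangentSheaf s) c.U (c.field j))) =
      fun j ↦ Y.presheaf.germ V (genericPoint Y) hV (a j) := by
  ext j
  rw [genericCoords_apply c hc hV le_rfl hVc hV, mres_self, LocalFunctional.map_sum,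
    Finset.sum_eq_single j]
  · have : (coordinateFunctional f c j).toFun V hVc (mres _ hVc
      (pullSec f (tangentSheaf s) c.U (c.field j))) = 1 := by
      rw [← LocalFunctional.map_res _ _ _ le_rfl]
      refine (congrArg (res hVc) (coordinateFunctional_pullSec f c j c.U le_rfl (c.field j))).trans ?_
      have := (c.evalAt_mres_field j le_rfl le_rfl (c.w j)).trans (c.dual j j ⟨c.U, le_rfl⟩)
      rw [mres_self, if_pos rfl] at this
      rw [this, map_one, map_one]
    rw [this, mul_one]
  · intro i _ hij
    have : (coordinateFunctional f c j).toFun V hVc (mres _ hVc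
      (pullSec f (tangentSheaf s) c.U (c.field i))) = 0 := by
      rw [← LocalFunctional.map_res _ _ _ le_rfl]
      refine (congrArg (res hVc) (coordinateFunctional_pullSec f c j c.U le_rfl (c.field i))).trans ?_
      have := (c.evalAt_mres_field i le_rfl le_rfl (c.w j)).trans (c.dual i j ⟨c.U, le_rfl⟩)
      rw [mres_self, if_neg hij] at this
      rw [this, map_zero, map_zero]
    rw [this, mul_zero]
  · simp

/-- Near each point the regular coordinates define a section in the frame of a chart. Injectivity of
the generic coordinates makes these local sections agree on overlaps. -/
theorem exists_genericCoords_eq [Subsingleton S] [SmoothOfRelativeDimension 2 s] (c : Chart s)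
    (hc : f (genericPoint Y) ∈ c.U) {V : Y.Opens} (hV : genericPoint Y ∈ V)
    (x : Fin 2 → Y.functionField)
    (hx : ∀ y ∈ V, ∃ (c' : Chart s) (hy : f y ∈ c'.U), ∀ j,
      (x ᵥ* transition f c c' hc (mem_of_mem_preimage f hy)) j ∈
        Set.range (algebraMap (Y.presheaf.stalk y) Y.functionField)) :
    ∃ m, genericCoords (f := f) c hc hV m = x := by
  have key : ∀ y : V, ∃ (W : Y.Opens) (_ : y.1 ∈ W) (_ : W ≤ V) (hη : genericPoint Y ∈ W)
      (m : Γ(pullTangent s f, W)), genericCoords c hc hη m = x := by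
    intro y
    obtain ⟨c', hy, h⟩ := hx y.1 y.2
    have hη := mem_of_mem_preimage f hy
    choose b hb using h
    choose W hyW a ha using fun j ↦ Y.presheaf.exists_germ_eq (b j)
    let Z := V ⊓ (W 0 ⊓ W 1) ⊓ f ⁻¹ᵁ c'.U
    have hZ : ∀ j, Z ≤ W j := by
      intro j
      fin_cases j
      · exact inf_le_left.trans (inf_le_right.trans inf_le_left)
      · exact inf_le_left.trans (inf_le_right.trans inf_le_right)
    have hyZ : y.1 ∈ Z := ⟨⟨y.2, hyW 0, hyW 1⟩, hy⟩
    have hηZ := genericPoint_mem hyZ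
    have hZc : Z ≤ f ⁻¹ᵁ c'.U := inf_le_right
    refine ⟨Z, hyZ, inf_le_left.trans inf_le_left, hηZ, ∑ j, res (hZ j) (a j) • mres _ hZc
      (pullSec f (tangentSheaf s) c'.U (c'.field j)), ?_⟩
    rw [genericCoords_transition c' c hη hc, genericCoords_sum_pullSec]
    have : (fun j ↦ Y.presheaf.germ Z (genericPoint Y) hηZ (res (hZ j) (a j))) =
        x ᵥ* transition f c c' hc hη := by
      ext j
      rw [germ_res, ← hb, ← ha]
      exact (algebraMap_germ y.1 (hyW j) (a j)).symm
    rw [this, Matrix.vecMul_vecMul, transition_mul, transition_self, Matrix.vecMul_one]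
  choose W hyW hWV hη m hm using key
  obtain ⟨b, hb⟩ := mres_glue (pullTangent s f) W hWV
    (fun y hy ↦ Opens.mem_iSup.2 ⟨⟨y, hy⟩, hyW ⟨y, hy⟩⟩) m fun y z ↦ by
      have hyz : genericPoint Y ∈ W y ⊓ W z := ⟨hη y, hη z⟩
      apply genericCoords_injective (f := f) c hc hyz
      rw [genericCoords_mres, genericCoords_mres, hm, hm]
  refine ⟨b, ?_⟩
  rw [← genericCoords_mres c hc (hWV ⟨_, hV⟩) (hη ⟨_, hV⟩), hb, hm]

theorem genericCoords_mem_range (c : Chart s) (hc : f (genericPoint Y) ∈ c.U) {V : Y.Opens}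
    {y : Y} (hy : y ∈ V) (hyc : f y ∈ c.U) (m : Γ(pullTangent s f, V)) (j : Fin 2) :
    genericCoords c hc (genericPoint_mem hy) m j ∈
      Set.range (algebraMap (Y.presheaf.stalk y) Y.functionField) := by
  rw [genericCoords_apply c hc (genericPoint_mem hy) inf_le_left inf_le_right
    (generic_mem_inf_preimage f (genericPoint_mem hy) hc)]
  have hmem : y ∈ V ⊓ f ⁻¹ᵁ c.U := ⟨hy, hyc⟩
  exact ⟨_, algebraMap_germ y hmem _⟩

end Coordinates

end

section


/-! ### Very freeness as a splitting property of lattices -/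

open scoped Matrix
open IsLineValuation WithZero

theorem mem_range_algebraMap_of_eq_genericPoint {Y : Scheme.{u}} [IsIntegral Y] {y : Y}
    (hy : y = genericPoint Y) (x : Y.functionField) :
    x ∈ Set.range (algebraMap (Y.presheaf.stalk y) Y.functionField) := by
  obtain ⟨V, hV, a, rfl⟩ := Y.presheaf.exists_germ_eq x
  have hyV : y ∈ V := hy ▸ hV
  exact ⟨Y.presheaf.germ V y hyV a, algebraMap_germ y hyV a⟩

theorem app_constMap {k : Type u} [Field k] {X Y : Scheme.{u}} (s : X ⟶ Spec (CommRingCat.of k))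
    (f : Y ⟶ X) (U : X.Opens) (r : k) :
    f.app U (constMap s U r) = constMap (f ≫ s) (f ⁻¹ᵁ U) r := by
  have : s.appLE ⊤ U (le_preimage_top s U) ≫ f.app U =
      (f ≫ s).appLE ⊤ (f ⁻¹ᵁ U) (le_preimage_top (f ≫ s) _) := by
    rw [Scheme.Hom.app_eq_appLE]
    exact Scheme.Hom.appLE_comp_appLE ..
  exact congr($this ((Scheme.ΓSpecIso (CommRingCat.of k)).inv r))

section

variable {k : Type u} [Field k]

/-- Over the empty set there is only one section. This disposes of pairs of opens whose intersection
misses the generic point. -/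
theorem sumSurjective_of_inf_eq_bot (F : AbSheaf (projLine k).toTopCat)
    {V W : (projLine k).Opens} (h : V ⊓ W = ⊥) : SumSurjective F V W := fun _ ↦
  ⟨0, 0, sheaf_ext F (fun i : Empty ↦ i.elim) (fun i ↦ i.elim) (h.le.trans bot_le) _ _
    fun i ↦ i.elim⟩

variable [IsIntegral (projLine k)] {X : Scheme.{u}}
  {s : X ⟶ Spec (CommRingCat.of k)} {f : projLine k ⟶ X}

theorem germ_coordinate_zpow_mul :
    (projLine k).presheaf.germ _ _ (genericPoint_mem_inf k) (coordinate k ^ (-2 : ℤ)).val *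
      lineCoordinate k ^ 2 = 1 := by
  rw [← germ_coordinate, ← map_pow, ← map_mul, ← Units.val_pow_eq_pow_val, ← Units.val_mul,
    ← zpow_natCast, ← zpow_add]
  simp

theorem lineVal_lineCoordinate_eq_one (q : Option k) (hq : q ≠ none) (hq' : q ≠ some 0) :
    lineVal k q (lineCoordinate k) = 1 := by
  obtain ⟨a, rfl⟩ := Option.ne_none_iff_exists'.1 hq
  have ha : a ≠ 0 := fun h ↦ hq' (by rw [h])
  have := lineVal_aeval_eq_one k a Polynomial.X (by simpa using ha)
  simpa using this

theorem genericPoint_mem_inf_chart {V : (projLine k).Opens} (hV : genericPoint (projLine k) ∈ V)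
    (i : Fin 2) : genericPoint (projLine k) ∈ V ⊓ chart k i := ⟨hV, genericPoint_mem_chart k i⟩

theorem pullGerm_baseMap (hf : f ≫ s = projSpaceToSpec k 1) {U : X.Opens} (hU : f (genericPoint (projLine k)) ∈ U)
    (r : Γ(Spec (CommRingCat.of k), ⊤)) :
    ∃ a : k, pullGerm f hU (baseMap s U r) = algebraMap k _ a := by
  obtain ⟨a, ha⟩ := baseMap_mem_range_constMap s U r
  refine ⟨a, ?_⟩
  rw [ha, pullGerm_apply, app_constMap, hf, germ_constMap]

theorem lineVal_pullGerm_le_one {U : X.Opens} (q : Option k) (hq : f (pt k q) ∈ U) (a : Γ(X, U)) :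
    lineVal k q (pullGerm f (mem_of_mem_preimage f hq) a) ≤ 1 :=
  lineVal_germ_le_one k (f ⁻¹ᵁ U) q hq (f.app U a)

variable [IsAlgClosed k]

variable (c₀ : Chart s) (h₀ : f (genericPoint (projLine k)) ∈ c₀.U)

/-- The transition function is t⁻², so near infinity a section with first coordinates x has
coordinates t² x. This is the origin of `twistFactor`. -/
theorem genericCoords_fst_eq {V : (projLine k).Opens} (hV : genericPoint (projLine k) ∈ V)
    (p : twistSections (pullTangent s f) (chart k 0) (chart k 1) (coordinate k ^ (-2 : ℤ)) V) :
    lineCoordinate k ^ 2 • genericCoords c₀ h₀ (genericPoint_mem_inf_chart hV 0) p.1.1 =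
      genericCoords c₀ h₀ (genericPoint_mem_inf_chart hV 1) p.1.2 := by
  have hη : genericPoint (projLine k) ∈ V ⊓ (chart k 0 ⊓ chart k 1) :=
    ⟨hV, genericPoint_mem_inf k⟩
  have h := congrArg (genericCoords c₀ h₀ hη) p.2
  rw [genericCoords_mres, genericCoords_smul, genericCoords_mres, germ_res] at h
  rw [h, smul_smul, mul_comm, germ_coordinate_zpow_mul, one_smul]

variable (c : Option k → Chart s) (hc : ∀ q, f (pt k q) ∈ (c q).U)

/-- The transition matrices from a base chart to charts at the points of the line. -/
def lineTransition (q : Option k) : Matrix (Fin 2) (Fin 2) (projLine k).functionField :=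
  transition f c₀ (c q) h₀ (mem_of_mem_preimage f (hc q))

theorem genericCoords_fst_mem_lattice {V : (projLine k).Opens}
    (hV : genericPoint (projLine k) ∈ V)
    (p : twistSections (pullTangent s f) (chart k 0) (chart k 1) (coordinate k ^ (-2 : ℤ)) V)
    (q : Option k) (hq : pt k q ∈ V) :
    genericCoords c₀ h₀ (genericPoint_mem_inf_chart hV 0) p.1.1 ∈
      lattice (lineCoordinate k) (lineVal k) (lineTransition c₀ h₀ c hc) q := by
  rw [mem_lattice]
  intro j
  have hcq := mem_of_mem_preimage f (hc q)
  by_cases h : q = none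
  · subst h
    have e : twistFactor (lineCoordinate k) (none : Option k) = lineCoordinate k ^ 2 := rfl
    have hm : pt k none ∈ V ⊓ chart k 1 := ⟨hq, pt_none_mem k⟩
    rw [e, ← smul_eq_mul, ← Pi.smul_apply, ← Matrix.smul_vecMul, genericCoords_fst_eq c₀ h₀ hV,
      lineTransition, ← genericCoords_transition, lineVal_le_one_iff]
    exact genericCoords_mem_range (c none) hcq hm (hc none) p.1.2 j
  · obtain ⟨a, rfl⟩ := Option.ne_none_iff_exists'.1 h
    have e : twistFactor (lineCoordinate k) (some a) = 1 := rfl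
    have hm : pt k (some a) ∈ V ⊓ chart k 0 := ⟨hq, pt_some_mem k a⟩
    rw [e, one_mul, lineTransition, ← genericCoords_transition, lineVal_le_one_iff]
    exact genericCoords_mem_range (c (some a)) hcq hm (hc _) p.1.1 j

include hc in
theorem exists_genericCoords_eq_of_lineVal_le [SmoothOfRelativeDimension 2 s]
    {V : (projLine k).Opens} (hV : genericPoint (projLine k) ∈ V)
    (x : Fin 2 → (projLine k).functionField)
    (hx : ∀ q, pt k q ∈ V → ∀ j, lineVal k q ((x ᵥ* lineTransition c₀ h₀ c hc q) j) ≤ 1) :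
    ∃ m, genericCoords (f := f) c₀ h₀ hV m = x := by
  refine exists_genericCoords_eq c₀ h₀ hV x fun y hy ↦ ?_
  obtain hη | ⟨q, rfl⟩ := eq_genericPoint_or_exists_pt k y
  · exact ⟨c₀, by rw [hη]; exact h₀, fun j ↦ mem_range_algebraMap_of_eq_genericPoint hη _⟩
  · exact ⟨c q, hc q, fun j ↦ (lineVal_le_one_iff k q _).1 (hx q hy j)⟩

/-- The two components are built from x over the chart 0 and from t² x over the chart 1. On the
chart 1 away from infinity t is a unit, so the factor t² does not affect integrality. -/
theorem exists_twistSections [SmoothOfRelativeDimension 2 s] {V : (projLine k).Opens}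
    (hV : genericPoint (projLine k) ∈ V) (x : Fin 2 → (projLine k).functionField)
    (hx : ∀ q, pt k q ∈ V →
      x ∈ lattice (lineCoordinate k) (lineVal k) (lineTransition c₀ h₀ c hc) q) :
    ∃ p : twistSections (pullTangent s f) (chart k 0) (chart k 1) (coordinate k ^ (-2 : ℤ)) V,
      genericCoords c₀ h₀ (genericPoint_mem_inf_chart hV 0) p.1.1 = x := by
  simp only [mem_lattice] at hx
  obtain ⟨m₀, h0⟩ := exists_genericCoords_eq_of_lineVal_le c₀ h₀ c hc
    (genericPoint_mem_inf_chart hV 0) x (by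
      rintro q ⟨hq, hq'⟩ j
      have hn := (pt_mem_chart_zero_iff k q).1 hq'
      obtain ⟨a, rfl⟩ := Option.ne_none_iff_exists'.1 hn
      have := hx _ hq j
      rwa [show twistFactor (lineCoordinate k) (some a) = 1 from rfl, one_mul] at this)
  obtain ⟨m₁, h1⟩ := exists_genericCoords_eq_of_lineVal_le c₀ h₀ c hc
    (genericPoint_mem_inf_chart hV 1) (lineCoordinate k ^ 2 • x) (by
      rintro q ⟨hq, hq'⟩ j
      have hn := (pt_mem_chart_one_iff k q).1 hq'
      have := hx _ hq j
      rw [Matrix.smul_vecMul, Pi.smul_apply, smul_eq_mul]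
      by_cases h : q = none
      · subst h
        exact this
      · obtain ⟨a, rfl⟩ := Option.ne_none_iff_exists'.1 h
        rw [show twistFactor (lineCoordinate k) (some a) = 1 from rfl, one_mul] at this
        rwa [map_mul, map_pow, lineVal_lineCoordinate_eq_one _ h hn, one_pow, one_mul])
  refine ⟨⟨(m₀, m₁), ?_⟩, h0⟩
  have hη : genericPoint (projLine k) ∈ V ⊓ (chart k 0 ⊓ chart k 1) :=
    ⟨hV, genericPoint_mem_inf k⟩
  apply genericCoords_injective (f := f) c₀ h₀ hη
  rw [genericCoords_mres, genericCoords_smul, genericCoords_mres, germ_res, h0, h1, smul_smul,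
    germ_coordinate_zpow_mul, one_smul]

theorem twistSections_ext [SmoothOfRelativeDimension 2 s] {V : (projLine k).Opens}
    (hV : genericPoint (projLine k) ∈ V)
    (p p' : twistSections (pullTangent s f) (chart k 0) (chart k 1) (coordinate k ^ (-2 : ℤ)) V)
    (h : genericCoords c₀ h₀ (genericPoint_mem_inf_chart hV 0) p.1.1 =
      genericCoords c₀ h₀ (genericPoint_mem_inf_chart hV 0) p'.1.1) : p = p' := by
  refine Subtype.ext (Prod.ext (genericCoords_injective c₀ h₀ _ h) ?_)
  apply genericCoords_injective c₀ h₀ (genericPoint_mem_inf_chart hV 1)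
  rw [← genericCoords_fst_eq c₀ h₀ hV, ← genericCoords_fst_eq c₀ h₀ hV, h]

variable (s f) in
/-- The sheaf `(f^* T_X)(-2)`. -/
abbrev twistedTangent : AbSheaf (projLine k).toTopCat :=
  serreTwist (pullTangent s f) (-2)

/-- A section of the twisted sheaf as a pair of sections. -/
def twistedTangentSections {V : (projLine k).Opens} (p : (twistedTangent s f).obj.obj (op V)) :
    twistSections (pullTangent s f) (chart k 0) (chart k 1) (coordinate k ^ (-2 : ℤ)) V := p

theorem genericCoords_sres {V W : (projLine k).Opens} (hWV : W ≤ V)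
    (hW : genericPoint (projLine k) ∈ W) (p : (twistedTangent s f).obj.obj (op V)) :
    genericCoords c₀ h₀ (genericPoint_mem_inf_chart hW 0)
      (twistedTangentSections (sres _ hWV p)).1.1 =
    genericCoords c₀ h₀ (genericPoint_mem_inf_chart (hWV hW) 0)
      (twistedTangentSections p).1.1 :=
  genericCoords_mres c₀ h₀ _ (genericPoint_mem_inf_chart hW 0) (twistedTangentSections p).1.1

theorem eq_bot_of_genericPoint_notMem {Y : Scheme.{u}} [IsIntegral Y] {V : Y.Opens}
    (h : genericPoint Y ∉ V) : V = ⊥ := by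
  ext y
  simp only [Opens.coe_bot, Set.mem_empty_iff_false, iff_false, SetLike.mem_coe]
  exact fun hy ↦ h (genericPoint_mem hy)

/-- Generic coordinates of the first component identify sections over an open set with the vectors
lying in the lattices at its points, compatibly with restriction; the splitting of sections becomes
the splitting of vectors. -/
theorem sumSurjective_twistedTangent_iff [SmoothOfRelativeDimension 2 s]
    {V W : (projLine k).Opens} (hη : genericPoint (projLine k) ∈ V ⊓ W) :
    SumSurjective (twistedTangent s f) V W ↔ ∀ x, (∀ q, pt k q ∈ V → pt k q ∈ W →
        x ∈ lattice (lineCoordinate k) (lineVal k) (lineTransition c₀ h₀ c hc) q) →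
      ∃ y z, x = y + z ∧
        (∀ q, pt k q ∈ V →
          y ∈ lattice (lineCoordinate k) (lineVal k) (lineTransition c₀ h₀ c hc) q) ∧
        ∀ q, pt k q ∈ W →
          z ∈ lattice (lineCoordinate k) (lineVal k) (lineTransition c₀ h₀ c hc) q := by
  have hV : genericPoint (projLine k) ∈ V := hη.1
  have hW : genericPoint (projLine k) ∈ W := hη.2
  constructor
  · intro h x hx
    obtain ⟨p, hp⟩ := exists_twistSections c₀ h₀ c hc hη x fun q hq ↦ hx q hq.1 hq.2
    obtain ⟨a, b, hab⟩ := h p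
    refine ⟨_, _, ?_,
      genericCoords_fst_mem_lattice c₀ h₀ c hc hV (twistedTangentSections a),
      genericCoords_fst_mem_lattice c₀ h₀ c hc hW (twistedTangentSections b)⟩
    rw [← hp, ← genericCoords_sres c₀ h₀ inf_le_left hη a,
      ← genericCoords_sres c₀ h₀ inf_le_right hη b, ← map_add]
    exact congrArg (fun p ↦ genericCoords c₀ h₀ (genericPoint_mem_inf_chart hη 0)
      (twistedTangentSections p).1.1) hab
  · intro h p
    obtain ⟨y, z, hyz, hy, hz⟩ := h _ fun q hq hq' ↦
      genericCoords_fst_mem_lattice c₀ h₀ c hc hη (twistedTangentSections p) q ⟨hq, hq'⟩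
    obtain ⟨a, ha⟩ := exists_twistSections c₀ h₀ c hc hV y hy
    obtain ⟨b, hb⟩ := exists_twistSections c₀ h₀ c hc hW z hz
    refine ⟨a, b, twistSections_ext c₀ h₀ hη _ _ ?_⟩
    have e1 := genericCoords_sres c₀ h₀ inf_le_left hη (V := V) a
    have e2 := genericCoords_sres c₀ h₀ inf_le_right hη (V := W) b
    refine hyz.trans ?_
    rw [← ha, ← hb]
    refine Eq.trans ?_ (map_add (genericCoords c₀ h₀ (genericPoint_mem_inf_chart hη 0)) _ _).symm
    exact congrArg₂ (· + ·) e1.symm e2.symm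

variable (hf : f ≫ s = projSpaceToSpec k 1)

/-! ### The differential of f: ℙ¹ → X at the generic point -/

section Derivation

variable {d : (projLine k).functionField →+ (projLine k).functionField}
  (hd : ∀ a b, d (a * b) = a * d b + b * d a) (hk : ∀ c, d (algebraMap k _ c) = 0)
include hf hd hk

/-- Composing d with the pullback of functions gives a derivation that kills constants, because f is
a k-morphism; its expansion in a chart is the chain rule. -/
theorem derivation_pullGerm (c : Chart s) {V : X.Opens} (hV : V ≤ c.U)
    (hη : f (genericPoint (projLine k)) ∈ V) (a : Γ(X, V)) :
    d (pullGerm f hη a) =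
      ∑ j, pullGerm f hη ((c.e j).1 ⟨V, hV⟩ a) * d (pullGerm f (hV hη) (c.w j)) := by
  obtain ⟨W, hW, hηW, hWV'⟩ := exists_isAffineOpen_mem_and_subset hη
  have hWV : W ≤ V := hWV'
  have := c.expand_ringHom hW (hWV.trans hV) (pullGerm f hηW)
    (d.comp (pullGerm f hηW).toAddMonoidHom)
    (fun a b ↦ by
      change d (pullGerm f hηW (a * b)) = _
      rw [map_mul, hd]; rfl)
    (fun r ↦ by
      obtain ⟨b, hb⟩ := pullGerm_baseMap hf hηW r
      change d (pullGerm f hηW (baseMap s W r)) = _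
      rw [hb, hk]) (res hWV a)
  change d (pullGerm f hηW (res hWV a)) = _ at this
  rw [pullGerm_res] at this
  rw [this]
  refine Finset.sum_congr rfl fun j _ ↦ ?_
  change _ * d (pullGerm f hηW (res (hWV.trans hV) (c.w j))) = _
  rw [pullGerm_res, ← (c.e j).2.2.1 ⟨V, hV⟩ ⟨W, hWV.trans hV⟩ hWV a, pullGerm_res]

/-- The vector of the d(f^*w_j) is the image of d/dt under df, so it changes with the chart as the
coordinates of a section do. -/
theorem derivation_vecMul_transition (c c' : Chart s)
    (hc : f (genericPoint (projLine k)) ∈ c.U) (hc' : f (genericPoint (projLine k)) ∈ c'.U) :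
    (fun j ↦ d (pullGerm f hc (c.w j))) ᵥ* transition f c c' hc hc' =
      fun j ↦ d (pullGerm f hc' (c'.w j)) := by
  ext j
  have hle : c.U ⊓ c'.U ≤ c.U := inf_le_left
  have hle' : c.U ⊓ c'.U ≤ c'.U := inf_le_right
  have hη : f (genericPoint (projLine k)) ∈ c.U ⊓ c'.U := ⟨hc, hc'⟩
  rw [← pullGerm_res f hle' hη, derivation_pullGerm hf hd hk c hle hη, Matrix.vecMul, dotProduct]
  refine Finset.sum_congr rfl fun i _ ↦ ?_
  rw [transition_apply f c c' hc hc' _ hle hle' hη, mul_comm]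

end Derivation

/-- The image of d/dt under df serves as the vector D of the lattice criterion. Its integrality is
automatic; that it vanishes nowhere is the unramifiedness `hunr`. -/
theorem veryFree_iff_three_le_latticeDegree [SmoothOfRelativeDimension 2 s]
    (hf : f ≫ s = projSpaceToSpec k 1) (hc₀ : ∀ q, f (pt k q) ∈ c₀.U → c q = c₀)
    (hunr : ∀ q, ∃ a : X.presheaf.stalk (f (pt k q)),
      lineVal k q (algebraMap _ _ (f.stalkMap (pt k q) a)) = exp (-1)) :
    VeryFree s f ↔ 3 ≤ latticeDegree (lineVal k) (lineTransition c₀ h₀ c hc) := by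
  obtain ⟨d, hd, hk, ht⟩ := exists_derivation k
  have hone : ∀ q, f (pt k q) ∈ c₀.U → lineTransition c₀ h₀ c hc q = 1 := by
    intro q hq
    have aux : ∀ (c' : Chart s) (hc' : f (genericPoint (projLine k)) ∈ c'.U), c' = c₀ →
        transition f c₀ c' h₀ hc' = 1 := by
      rintro c' hc' rfl
      exact transition_self f c' h₀
    exact aux _ _ (hc₀ q hq)
  have hfin : {q | ¬ f (pt k q) ∈ c₀.U}.Finite := finite_pt_notMem k (f ⁻¹ᵁ c₀.U) h₀
  have hDM : ∀ q, (fun j ↦ d (pullGerm f h₀ (c₀.w j))) ᵥ* lineTransition c₀ h₀ c hc q =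
      fun j ↦ d (pullGerm f (mem_of_mem_preimage f (hc q)) ((c q).w j)) := fun q ↦
    derivation_vecMul_transition hf hd hk c₀ (c q) h₀ _
  have hDle : ∀ q j, lineVal k q (twistFactor (lineCoordinate k) q *
      d (pullGerm f (mem_of_mem_preimage f (hc q)) ((c q).w j))) ≤ 1 := fun q j ↦
    lineVal_twistFactor_mul_derivation_le_one hd hk ht q _ (lineVal_pullGerm_le_one q (hc q) _)
  have key := (isLineValuation k).three_le_latticeDegree_iff (M := lineTransition c₀ h₀ c hc)
    (D := fun j ↦ d (pullGerm f h₀ (c₀.w j)))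
    (fun q ↦ det_transition_ne_zero f _ _ _ _)
    (hfin.subset fun q hq hq' ↦ hq fun i j ↦ by
      rw [hone q hq', Matrix.one_apply]
      split_ifs <;> simp)
    (hfin.subset fun q hq hq' ↦ hq (by rw [hone q hq', Matrix.det_one, map_one]))
    (fun q ↦ by
      rw [mem_lattice, hDM]
      exact hDle q)
    (fun q ↦ by
      simp only [hDM]
      -- If every coordinate of D at q were a nonunit, then by the chain rule so would be the
      -- twisted derivative of every function pulled back from X near f(q). For a function pulling
      -- back to a uniformizer that derivative is a unit.
      by_contra! hne
      have hlt := fun j ↦ lt_of_le_of_ne (hDle q j) (hne j)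
      obtain ⟨a, ha⟩ := hunr q
      obtain ⟨V, hV, b, rfl⟩ := X.presheaf.exists_germ_eq a
      have hle : V ⊓ (c q).U ≤ V := inf_le_left
      have hle' : V ⊓ (c q).U ≤ (c q).U := inf_le_right
      have hq : f (pt k q) ∈ V ⊓ (c q).U := ⟨hV, hc q⟩
      have hη := mem_of_mem_preimage f hq
      have e : algebraMap _ (projLine k).functionField
          (f.stalkMap (pt k q) (X.presheaf.germ V _ hV b)) = pullGerm f hη (res hle b) := by
        rw [Scheme.Hom.germ_stalkMap_apply, pullGerm_res]
        exact algebraMap_germ (V := f ⁻¹ᵁ V) (pt k q) hV (f.app V b)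
      rw [e] at ha
      have h1 := lineVal_twistFactor_mul_derivation_eq_one hd hk ht q _ ha
      rw [derivation_pullGerm hf hd hk (c q) hle' hη, Finset.mul_sum] at h1
      refine h1.not_lt ((lineVal k q).map_sum_lt one_ne_zero fun j _ ↦ ?_)
      rw [mul_left_comm, map_mul]
      exact lt_of_le_of_lt (mul_le_of_le_one_left' (lineVal_pullGerm_le_one q hq _)) (hlt j))
  constructor
  · intro h
    refine key.2 ?_
    have : Subsingleton (Sheaf.H (twistedTangent s f) 1) := h
    have hs := sumSurjective_of_subsingleton_H_one (twistedTangent s f) (chart_sup_chart k)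
    rw [sumSurjective_twistedTangent_iff c₀ h₀ c hc (genericPoint_mem_inf k)] at hs
    simpa only [pt_mem_chart_zero_iff, pt_mem_chart_one_iff] using hs
  · intro h
    have : CompactSpace (projLine k).toTopCat := compactSpace_projLine k
    refine subsingleton_H_one_of_sumSurjective (twistedTangent s f) fun V W ↦ ?_
    by_cases hη : genericPoint (projLine k) ∈ V ⊓ W
    · rw [sumSurjective_twistedTangent_iff c₀ h₀ c hc hη]
      exact key.1 h {q | pt k q ∈ V} {q | pt k q ∈ W}
    · exact sumSurjective_of_inf_eq_bot _ (eq_bot_of_genericPoint_notMem hη)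

end

end

section


/-! ### Orders of vanishing and valuations -/

open WithZero

/-! ### Lengths of quotients of submodules -/

section RelLength

variable {R M : Type*} [CommRing R] [AddCommGroup M] [Module R M]

/-- The length of `B / A` for submodules `A ≤ B`. -/
def relLength (A B : Submodule R M) : ℕ∞ := Module.length R (B ⧸ A.submoduleOf B)

theorem relLength_add {A B C : Submodule R M} (hAB : A ≤ B) (hBC : B ≤ C) :
    relLength A C = relLength A B + relLength B C := by
  let f : (B ⧸ A.submoduleOf B) →ₗ[R] (C ⧸ A.submoduleOf C) :=
    Submodule.mapQ _ _ (Submodule.inclusion hBC) fun x hx ↦ hx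
  let g : (C ⧸ A.submoduleOf C) →ₗ[R] (C ⧸ B.submoduleOf C) :=
    Submodule.mapQ _ _ LinearMap.id fun x hx ↦ hAB hx
  refine Module.length_eq_add_of_exact f g ?_ ?_ ?_
  · rw [← LinearMap.ker_eq_bot, LinearMap.ker_eq_bot']
    intro x hx
    obtain ⟨x, rfl⟩ := Submodule.Quotient.mk_surjective _ x
    change Submodule.Quotient.mk (Submodule.inclusion hBC x) = 0 at hx
    rw [Submodule.Quotient.mk_eq_zero] at hx
    rw [Submodule.Quotient.mk_eq_zero]
    exact hx
  · intro x
    obtain ⟨x, rfl⟩ := Submodule.Quotient.mk_surjective _ x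
    exact ⟨Submodule.Quotient.mk x, rfl⟩
  · intro x
    obtain ⟨x, rfl⟩ := Submodule.Quotient.mk_surjective _ x
    change Submodule.Quotient.mk x = 0 ↔ _
    rw [Submodule.Quotient.mk_eq_zero]
    constructor
    · intro hx
      exact ⟨Submodule.Quotient.mk ⟨x.1, hx⟩, rfl⟩
    · rintro ⟨y, hy⟩
      obtain ⟨y, rfl⟩ := Submodule.Quotient.mk_surjective _ y
      change Submodule.Quotient.mk (Submodule.inclusion hBC y) = Submodule.Quotient.mk x at hy
      rw [Submodule.Quotient.eq] at hy
      have h1 : y.1 - x.1 ∈ A := hy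
      have : x.1 = y.1 - (y.1 - x.1) := by abel
      change x.1 ∈ B
      rw [this]
      exact B.sub_mem y.2 (hAB h1)

theorem relLength_self (A : Submodule R M) : relLength A A = 0 := by
  rw [relLength, Module.length_eq_zero_iff]
  refine Submodule.Quotient.subsingleton_iff.2 (eq_top_iff.2 fun x _ ↦ x.2)

theorem relLength_map (e : M ≃ₗ[R] M) (A B : Submodule R M) :
    relLength (A.map e.toLinearMap) (B.map e.toLinearMap) = relLength A B := by
  refine (LinearEquiv.length_eq (Submodule.Quotient.equiv _ _ (e.submoduleMap B) ?_)).symm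
  ext ⟨x, y, hy, rfl⟩
  constructor
  · rintro ⟨z, hz, hzx⟩
    have := congrArg Subtype.val hzx
    exact ⟨z.1, hz, this⟩
  · rintro ⟨z, hz, hzy⟩
    have : z = y := e.injective hzy
    subst this
    exact ⟨⟨z, hy⟩, hz, rfl⟩

/-- A submodule between A and B that is larger than A contains a unit multiple of b modulo A, hence
b, hence all of B. -/
theorem relLength_eq_one {A B : Submodule R M} (hAB : A ≤ B) (b : M) (hb : b ∈ B) (hbA : b ∉ A)
    (h : ∀ x ∈ B, ∃ c : R, (c = 0 ∨ IsUnit c) ∧ x - c • b ∈ A) : relLength A B = 1 := by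
  rw [relLength, Module.length_eq_one_iff]
  refine (covBy_iff_quot_is_simple hAB).1 ⟨lt_of_le_of_ne hAB fun e ↦ hbA (e ▸ hb), fun N hAN hNB ↦ ?_⟩
  obtain ⟨x, hxN, hxA⟩ := SetLike.exists_of_lt hAN
  obtain ⟨c, hc | hc, hx⟩ := h x (hNB.le hxN)
  · rw [hc, zero_smul, sub_zero] at hx
    exact hxA hx
  · have hbN : b ∈ N := by
      have h1 : c • b ∈ N := by
        have := N.sub_mem hxN (hAN.le hx)
        rwa [sub_sub_cancel] at this
      obtain ⟨u, rfl⟩ := hc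
      have := N.smul_mem ((u⁻¹ : Rˣ) : R) h1
      rwa [smul_smul, Units.inv_mul, one_smul] at this
    refine hNB.not_ge fun y hy ↦ ?_
    obtain ⟨c', -, hy'⟩ := h y hy
    have := N.add_mem (hAN.le hy') (N.smul_mem c' hbN)
    rwa [sub_add_cancel] at this

end RelLength

/-! ### Orders in a one-dimensional ring and valuations of its normalization -/

section Valuations

variable {R K ι : Type*} [CommRing R] [Field K] [Algebra R K] (Q : Finset ι)
  (v : ι → Valuation K ℤᵐ⁰) (h1 : ∀ q ∈ Q, ∀ r : R, v q (algebraMap R K r) ≤ 1)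

/-- The elements of `K` of order at least `n q` for all `q`. -/
def orderSubmodule (n : ι → ℤ) : Submodule R K where
  carrier := {x | ∀ q ∈ Q, v q x ≤ exp (-n q)}
  zero_mem' q _ := by simp
  add_mem' ha hb q hq := (v q).map_add_le (ha q hq) (hb q hq)
  smul_mem' r x hx q hq := by
    rw [Algebra.smul_def, map_mul]
    exact (mul_le_of_le_one_left' (h1 q hq r)).trans (hx q hq)

theorem orderSubmodule_anti {m n : ι → ℤ} (h : ∀ q ∈ Q, m q ≤ n q) :
    orderSubmodule Q v h1 n ≤ orderSubmodule Q v h1 m := fun _ hx q hq ↦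
  (hx q hq).trans (exp_le_exp.2 (neg_le_neg (h q hq)))

variable (h2 : ∀ n : ι → ℤ, ∃ x : K, ∀ q ∈ Q, v q x = exp (-n q))
  (h3 : ∀ q ∈ Q, ∀ x, v q x ≤ 1 → ∃ c : R, (c = 0 ∨ IsUnit c) ∧
    v q (x - algebraMap R K c) ≤ exp (-1))

include h1 h2 h3

-- Take b with exact orders n. The residue field at q comes from R, so subtracting a suitable
-- multiple c • b raises the order at q by one, while the integrality of c preserves the bounds
-- elsewhere.
open Classical in
theorem relLength_orderSubmodule_update (n : ι → ℤ) (q : ι) (hq : q ∈ Q) :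
    relLength (orderSubmodule Q v h1 (Function.update n q (n q + 1))) (orderSubmodule Q v h1 n) =
      1 := by
  obtain ⟨b, hb⟩ := h2 n
  have hb0 : b ≠ 0 := fun h ↦ by
    have := hb q hq
    rw [h, map_zero] at this
    exact exp_ne_zero this.symm
  refine relLength_eq_one (orderSubmodule_anti Q v h1 fun r _ ↦ ?_) b (fun r hr ↦ (hb r hr).le)
    (fun h ↦ ?_) fun x hx ↦ ?_
  · by_cases hr : r = q
    · subst hr; simp
    · simp [hr]
  · have := h q hq
    rw [hb q hq, exp_le_exp] at this
    simp at this
  · obtain ⟨c, hc, hc'⟩ := h3 q hq (x / b) (by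
      rw [map_div₀, hb q hq]
      exact div_le_one_of_le₀ (hx q hq) zero_le)
    refine ⟨c, hc, fun r hr ↦ ?_⟩
    by_cases hrq : r = q
    · subst hrq
      have e : x - c • b = (x / b - algebraMap R K c) * b := by
        rw [Algebra.smul_def]; field_simp
      rw [Function.update_self, e, map_mul, hb r hr]
      calc _ ≤ exp (-1) * exp (-n r) := mul_le_mul_left hc' _
        _ = _ := by rw [← exp_add]; congr 1; ring
    · rw [Function.update_of_ne hrq]
      refine (v r).map_sub_le (hx r hr) ?_
      rw [Algebra.smul_def, map_mul, hb r hr]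
      exact mul_le_of_le_one_left' (h1 r hr c)

theorem relLength_orderSubmodule (n : ι → ℕ) :
    relLength (orderSubmodule Q v h1 fun q ↦ n q) (orderSubmodule Q v h1 0) =
      ((∑ q ∈ Q, n q : ℕ) : ℕ∞) := by
  classical
  induction hN : ∑ q ∈ Q, n q generalizing n with
  | zero =>
    have : orderSubmodule Q v h1 (fun q ↦ n q) = orderSubmodule Q v h1 0 := by
      have h0 : ∀ q ∈ Q, n q = 0 := Finset.sum_eq_zero_iff.1 hN
      apply le_antisymm
      · exact orderSubmodule_anti Q v h1 fun q _ ↦ by simp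
      · exact orderSubmodule_anti Q v h1 fun q hq ↦ by simp [h0 q hq]
    rw [this, relLength_self]
    rfl
  | succ N ih =>
    obtain ⟨q, hq, hn⟩ : ∃ q ∈ Q, n q ≠ 0 := by
      by_contra! h
      rw [Finset.sum_eq_zero h] at hN
      omega
    let m := Function.update n q (n q - 1)
    have hm : ∑ q ∈ Q, m q = N := by
      have h5 := Finset.sum_update_of_mem hq n (n q - 1)
      have h6 := Finset.add_sum_erase Q n hq
      rw [Finset.sdiff_singleton_eq_erase] at h5
      change ∑ q ∈ Q, m q = _ at h5
      omega
    have e : (fun q ↦ (n q : ℤ)) =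
        Function.update (fun q ↦ (m q : ℤ)) q ((m q : ℤ) + 1) := by
      ext r
      by_cases hr : r = q
      · subst hr
        simp only [Function.update_self, m]
        omega
      · simp [m, hr]
    have h7 := relLength_orderSubmodule_update Q v h1 h2 h3 (fun q ↦ (m q : ℤ)) q hq
    rw [e, relLength_add (B := orderSubmodule Q v h1 fun q ↦ (m q : ℤ)), h7, ih m hm]
    · push_cast; rw [add_comm]
    · refine orderSubmodule_anti Q v h1 fun r _ ↦ ?_
      by_cases hr : r = q
      · subst hr; simp
      · simp [hr]
    · exact orderSubmodule_anti Q v h1 fun q _ ↦ by simp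

omit h1 h2 h3 in
theorem ringOrd_eq_relLength [FaithfulSMul R K] (a : R) (ha : algebraMap R K a ≠ 0) :
    Ring.ord R a = relLength
      ((LinearMap.range (Algebra.linearMap R K)).map
        (LinearEquiv.smulOfNeZero K K (algebraMap R K a) ha |>.restrictScalars R).toLinearMap)
      (LinearMap.range (Algebra.linearMap R K)) := by
  have hinj : Function.Injective (Algebra.linearMap R K) := FaithfulSMul.algebraMap_injective R K
  refine LinearEquiv.length_eq (Submodule.Quotient.equiv _ _
    (LinearEquiv.ofInjective (Algebra.linearMap R K) hinj) ?_)
  ext ⟨x, y, rfl⟩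
  constructor
  · rintro ⟨z, hz, hzx⟩
    obtain ⟨w, rfl⟩ := Ideal.mem_span_singleton'.1 hz
    refine ⟨algebraMap R K w, ⟨w, rfl⟩, ?_⟩
    have := congrArg Subtype.val hzx
    change algebraMap R K (w * a) = algebraMap R K y at this
    change algebraMap R K a * algebraMap R K w = algebraMap R K y
    rw [← this, map_mul, mul_comm]
  · rintro ⟨_, ⟨w, rfl⟩, hw⟩
    change algebraMap R K a * algebraMap R K w = algebraMap R K y at hw
    refine ⟨y, Ideal.mem_span_singleton'.2 ⟨w, hinj ?_⟩, rfl⟩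
    change algebraMap R K (w * a) = algebraMap R K y
    rw [← hw, map_mul, mul_comm]

/-- Let N be the image of R in K and O the elements integral at all places of Q. Compare aN ≤ N ≤ O
with aN ≤ aO ≤ O. Multiplication by a gives O/N and aO/aN the same length, so R/a and O/aO have the
same length, and the latter is the sum of the orders of a. -/
theorem ringOrd_eq_sum [FaithfulSMul R K]
    (h4 : ∃ n : ι → ℕ, ∀ x : K, (∀ q ∈ Q, v q x ≤ exp (-(n q : ℤ))) →
      x ∈ Set.range (algebraMap R K))
    (a : R) (ha : a ≠ 0) :
    Ring.ord R a = ((∑ q ∈ Q, (-log (v q (algebraMap R K a))).toNat : ℕ) : ℕ∞) := by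
  have ha' : algebraMap R K a ≠ 0 := by
    rwa [Ne, FaithfulSMul.algebraMap_eq_zero_iff]
  let e := (LinearEquiv.smulOfNeZero K K (algebraMap R K a) ha').restrictScalars R
  let N := LinearMap.range (Algebra.linearMap R K)
  let O := orderSubmodule Q v h1 0
  have hNO : N ≤ O := by
    rintro _ ⟨r, rfl⟩ q hq
    simpa using h1 q hq r
  let n : ι → ℕ := fun q ↦ (-log (v q (algebraMap R K a))).toNat
  have hlog : ∀ q ∈ Q, v q (algebraMap R K a) = exp (-(n q : ℤ)) := by
    intro q hq
    have h0 : v q (algebraMap R K a) ≠ 0 := (v q).ne_zero_iff.2 ha'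
    have : log (v q (algebraMap R K a)) ≤ 0 := (log_le_iff_le_exp h0).2 (by simpa using h1 q hq a)
    rw [Int.toNat_of_nonneg (by omega), neg_neg, exp_log h0]
  have heO : O.map e.toLinearMap = orderSubmodule Q v h1 fun q ↦ n q := by
    ext x
    constructor
    · rintro ⟨y, hy, rfl⟩ q hq
      change v q (algebraMap R K a * y) ≤ _
      rw [map_mul, hlog q hq]
      exact mul_le_of_le_one_right' (by simpa using hy q hq)
    · intro hx
      refine ⟨(algebraMap R K a)⁻¹ * x, fun q hq ↦ ?_, ?_⟩
      · rw [map_mul, map_inv₀, hlog q hq, inv_mul_le_iff₀ (by simp)]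
        simpa using hx q hq
      · change algebraMap R K a * ((algebraMap R K a)⁻¹ * x) = x
        rw [mul_inv_cancel_left₀ ha']
  have hmono : N.map e.toLinearMap ≤ N := by
    rintro _ ⟨_, ⟨r, rfl⟩, rfl⟩
    exact ⟨a * r, map_mul (algebraMap R K) a r⟩
  -- By `h4`, N contains every element of sufficiently high order, so O/N has finite length and may
  -- be cancelled.
  have hfin : relLength N O ≠ ⊤ := by
    obtain ⟨m, hm⟩ := h4
    have hle : orderSubmodule Q v h1 (fun q ↦ m q) ≤ N := fun x hx ↦ hm x hx
    have := relLength_add hle hNO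
    rw [relLength_orderSubmodule Q v h1 h2 h3 m] at this
    intro h
    rw [h, add_top] at this
    exact ENat.natCast_ne_top _ this
  have t1 := relLength_add hmono hNO
  have t2 := relLength_add (Submodule.map_mono hNO : N.map e.toLinearMap ≤ O.map e.toLinearMap)
    (heO.le.trans (orderSubmodule_anti Q v h1 fun q _ ↦ by simp) : O.map e.toLinearMap ≤ O)
  rw [t1, relLength_map, heO, relLength_orderSubmodule Q v h1 h2 h3 n, add_comm] at t2
  rw [ringOrd_eq_relLength a ha']
  exact ENat.add_right_injective_of_ne_top hfin t2

/-- The order of vanishing of a fraction is the sum of its orders at the places above. -/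
theorem ordFrac_eq_exp_sum [IsDomain R] [IsNoetherianRing R] [Ring.KrullDimLE 1 R]
    {L : Type*} [Field L] [Algebra R L] [IsFractionRing R L] (κ : L →+* K)
    (hκ : ∀ r, κ (algebraMap R L r) = algebraMap R K r)
    (h4 : ∃ n : ι → ℕ, ∀ x : K, (∀ q ∈ Q, v q x ≤ exp (-(n q : ℤ))) →
      x ∈ Set.range (algebraMap R K))
    (a : L) (ha : a ≠ 0) :
    Ring.ordFrac R a = exp (∑ q ∈ Q, -log (v q (κ a))) := by
  have hinj : Function.Injective (algebraMap R K) := fun x y h ↦ by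
    rw [← hκ, ← hκ] at h
    exact IsFractionRing.injective R L (κ.injective h)
  have : FaithfulSMul R K := (faithfulSMul_iff_algebraMap_injective R K).2 hinj
  have key : ∀ r : R, r ≠ 0 → Ring.ordFrac R (algebraMap R L r) =
      exp (∑ q ∈ Q, -log (v q (algebraMap R K r))) := by
    intro r hr
    have hr' : algebraMap R K r ≠ 0 := (map_ne_zero_iff _ hinj).2 hr
    have hsum : ∑ q ∈ Q, -log (v q (algebraMap R K r)) =
        ((∑ q ∈ Q, (-log (v q (algebraMap R K r))).toNat : ℕ) : ℤ) := by
      push_cast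
      refine Finset.sum_congr rfl fun q hq ↦ ?_
      have h0 : v q (algebraMap R K r) ≠ 0 := (v q).ne_zero_iff.2 hr'
      have : log (v q (algebraMap R K r)) ≤ 0 :=
        (log_le_iff_le_exp h0).2 (by simpa using h1 q hq r)
      omega
    rw [Ring.ordFrac_eq_ord R hr, hsum, Ring.ordMonoidWithZeroHom_eq_coe R
      (mem_nonZeroDivisors_of_ne_zero hr) (ringOrd_eq_sum Q v h1 h2 h3 h4 r hr)]
    rfl
  obtain ⟨x, y, hy, rfl⟩ := IsFractionRing.div_surjective (A := R) a
  have hy0 : y ≠ 0 := nonZeroDivisors.ne_zero hy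
  have hx0 : x ≠ 0 := by
    rintro rfl
    simp at ha
  rw [map_div₀, key x hx0, key y hy0, ← exp_sub, ← Finset.sum_sub_distrib]
  congr 1
  refine Finset.sum_congr rfl fun q hq ↦ ?_
  rw [map_div₀, hκ, hκ, map_div₀, log_div]
  · ring
  · exact (v q).ne_zero_iff.2 ((map_ne_zero_iff _ hinj).2 hx0)
  · exact (v q).ne_zero_iff.2 ((map_ne_zero_iff _ hinj).2 hy0)

end Valuations

end

section


/-! ### Uniformizers at ordinary double points -/

open WithZero IsLocalRing

section Node

variable {O K : Type*} [CommRing O] [IsLocalRing O] [Field K] (v : Valuation K ℤᵐ⁰) (ψ : O →+* K)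
  (hle : ∀ x, v (ψ x) ≤ 1) (hlt : ∀ x ∈ maximalIdeal O, v (ψ x) < 1)
  (hfrac : ∀ x : K, ∃ a b : O, ψ b ≠ 0 ∧ x = ψ a / ψ b) (hex : ∃ x : K, v x = exp (-1))

include hle hlt hfrac hex

/-- Blow up the node: adjoin y = w/u, which is integral at v, to the image of O. In the resulting
ring S the maximal ideal of O generates uS, and the equation of the curve forces y into uS. Hence
every element of S has value 1 or is divisible by u, so all values are powers of v(u); since a
uniformizer is a fraction of elements of O, v(u) generates the value group. -/
theorem valuation_eq_exp_neg_one_of_le {f u w : O} (hm : maximalIdeal O = Ideal.span {u, w})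
    (hf : f - u * w ∈ maximalIdeal O ^ 3) (hψ : ψ f = 0) (huw : v (ψ w) ≤ v (ψ u)) :
    v (ψ u) = exp (-1) := by
  have hunit : ∀ x, x ∉ maximalIdeal O → v (ψ x) = 1 := by
    intro x hx
    have hx' : IsUnit x := by simpa using hx
    obtain ⟨y, hy⟩ := hx'.exists_right_inv
    have : v (ψ x) * v (ψ y) = 1 := by rw [← map_mul, ← map_mul, hy, map_one, map_one]
    refine le_antisymm (hle x) ?_
    rw [← this]
    exact mul_le_of_le_one_right' (hle y)
  obtain ⟨x₀, hx₀⟩ := hex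
  -- Otherwise ψ w = 0 too, ψ kills the maximal ideal, and v takes only the values 0 and 1, against
  -- `hex`.
  have hu0 : ψ u ≠ 0 := by
    intro h0
    have hw0 : ψ w = 0 := by
      rw [h0, map_zero, le_zero_iff] at huw
      exact (map_eq_zero v).1 huw
    have hker : ∀ x ∈ maximalIdeal O, ψ x = 0 := by
      intro x hx
      rw [hm, Ideal.mem_span_pair] at hx
      obtain ⟨a, b, rfl⟩ := hx
      rw [map_add, map_mul, map_mul, h0, hw0, mul_zero, mul_zero, add_zero]
    obtain ⟨a, b, hb, rfl⟩ := hfrac x₀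
    rw [map_div₀, hunit b (fun h ↦ hb (hker b h)), div_one] at hx₀
    by_cases ha : a ∈ maximalIdeal O
    · rw [hker a ha, map_zero] at hx₀
      exact exp_ne_zero hx₀.symm
    · rw [hunit a ha, ← exp_zero, exp_inj] at hx₀
      omega
  have hvu0 : v (ψ u) ≠ 0 := v.ne_zero_iff.2 hu0
  have hu1 : v (ψ u) < 1 := hlt u (hm ▸ Ideal.subset_span (by simp))
  let y := ψ w / ψ u
  have hwy : ψ w = ψ u * y := by
    simp only [y]; field_simp
  have hy1 : v y ≤ 1 := by
    rw [map_div₀]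
    exact div_le_one_of_le₀ huw zero_le
  let S : Subring K := Subring.closure (Set.range ψ ∪ {y})
  have hψS : ∀ x, ψ x ∈ S := fun x ↦ Subring.subset_closure (Or.inl ⟨x, rfl⟩)
  have hyS : y ∈ S := Subring.subset_closure (Or.inr rfl)
  have hSle : ∀ r ∈ S, v r ≤ 1 := by
    have : S ≤ v.integer := by
      refine Subring.closure_le.2 ?_
      rintro _ (⟨x, rfl⟩ | rfl)
      · exact hle x
      · exact hy1
    exact this
  let ψ' : O →+* S := ψ.codRestrict S hψS
  have hmap : (maximalIdeal O).map ψ' ≤ Ideal.span {ψ' u} := by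
    rw [hm, Ideal.map_span, Ideal.span_le]
    rintro _ ⟨x, rfl | rfl, rfl⟩
    · exact Ideal.mem_span_singleton_self _
    · refine Ideal.mem_span_singleton'.2 ⟨⟨y, hyS⟩, Subtype.ext ?_⟩
      change y * ψ u = ψ x
      rw [hwy, mul_comm]
  have hmem : ∀ x ∈ maximalIdeal O, ∃ r ∈ S, ψ x = ψ u * r := by
    intro x hx
    obtain ⟨r, hr⟩ := Ideal.mem_span_singleton'.1 (hmap (Ideal.mem_map_of_mem ψ' hx))
    refine ⟨r.1, r.2, ?_⟩
    rw [mul_comm]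
    exact (congrArg Subtype.val hr).symm
  -- Since f maps to 0, the product u w = u² y lies in 𝔪³S ⊆ u³S; cancelling u² leaves y in uS.
  have hyu : ∃ r ∈ S, y = ψ u * r := by
    have h1 : ψ' (f - u * w) ∈ Ideal.span {ψ' u ^ 3} := by
      have := Ideal.mem_map_of_mem ψ' hf
      rw [Ideal.map_pow] at this
      have h2 := Ideal.pow_right_mono hmap 3 this
      rwa [Ideal.span_singleton_pow] at h2
    obtain ⟨r, hr⟩ := Ideal.mem_span_singleton'.1 h1
    have h2 : r.1 * ψ u ^ 3 = ψ f - ψ u * ψ w := by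
      have := congrArg Subtype.val hr
      rw [← map_mul, ← map_sub]
      exact this
    refine ⟨-r.1, S.neg_mem r.2, ?_⟩
    rw [hψ, zero_sub, hwy] at h2
    have h3 : ψ u ^ 2 * (ψ u * -r.1) = ψ u ^ 2 * y := by linear_combination -h2
    exact (mul_left_cancel₀ (pow_ne_zero 2 hu0) h3).symm
  have hdec : ∀ r ∈ S, ∃ x, ∃ r' ∈ S, r = ψ x + ψ u * r' := by
    intro r hr
    induction hr using Subring.closure_induction with
    | mem r hr =>
      obtain ⟨x, rfl⟩ | rfl := hr
      · exact ⟨x, 0, S.zero_mem, by simp⟩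
      · obtain ⟨r, hr, h⟩ := hyu
        exact ⟨0, r, hr, by rw [map_zero, zero_add]; exact h⟩
    | zero => exact ⟨0, 0, S.zero_mem, by simp⟩
    | one => exact ⟨1, 0, S.zero_mem, by simp⟩
    | add a b _ _ ha hb =>
      obtain ⟨x, r, hr, rfl⟩ := ha
      obtain ⟨x', r', hr', rfl⟩ := hb
      exact ⟨x + x', r + r', S.add_mem hr hr', by rw [map_add]; ring⟩
    | neg a _ ha =>
      obtain ⟨x, r, hr, rfl⟩ := ha
      exact ⟨-x, -r, S.neg_mem hr, by rw [map_neg]; ring⟩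
    | mul a b ha' hb' ha hb =>
      obtain ⟨x, r, hr, rfl⟩ := ha
      obtain ⟨x', r', hr', rfl⟩ := hb
      refine ⟨x * x', ψ x * r' + r * ψ x' + ψ u * r * r', ?_, by rw [map_mul]; ring⟩
      exact S.add_mem (S.add_mem (S.mul_mem (hψS _) hr') (S.mul_mem hr (hψS _)))
        (S.mul_mem (S.mul_mem (hψS _) hr) hr')
  have hdec' : ∀ r ∈ S, v r = 1 ∨ ∃ r' ∈ S, r = ψ u * r' := by
    intro r hr
    obtain ⟨x, r', hr', rfl⟩ := hdec r hr
    by_cases hx : x ∈ maximalIdeal O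
    · obtain ⟨r'', hr'', h⟩ := hmem x hx
      exact Or.inr ⟨r'' + r', S.add_mem hr'' hr', by rw [h, mul_add]⟩
    · left
      have h1 := hunit x hx
      rw [Valuation.map_add_eq_of_lt_left v, h1]
      rw [h1, map_mul]
      exact lt_of_le_of_lt (mul_le_of_le_one_right' (hSle r' hr')) hu1
  have hlog : log (v (ψ u)) ≤ -1 := by
    have := (log_lt_iff_lt_exp (a := 0) hvu0).2 (by rwa [exp_zero])
    omega
  -- Divide by u repeatedly. Each division lowers the order by at least one, so a bound n on the
  -- order makes the induction terminate.
  have hpow : ∀ (n : ℕ) (r : K), r ∈ S → r ≠ 0 → -(n : ℤ) ≤ log (v r) →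
      ∃ m : ℤ, log (v r) = m * log (v (ψ u)) := by
    intro n
    induction n with
    | zero =>
      intro r hr hr0 h
      refine ⟨0, ?_⟩
      have := (log_le_iff_le_exp (a := 0) (v.ne_zero_iff.2 hr0)).2 (by rw [exp_zero]; exact hSle r hr)
      simp at h
      omega
    | succ n ih =>
      intro r hr hr0 h
      obtain h1 | ⟨r', hr', rfl⟩ := hdec' r hr
      · exact ⟨0, by rw [h1]; simp⟩
      · have hr'0 : r' ≠ 0 := right_ne_zero_of_mul hr0
        rw [map_mul, log_mul hvu0 (v.ne_zero_iff.2 hr'0)] at h ⊢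
        obtain ⟨m, hm'⟩ := ih r' hr' hr'0 (by push_cast at h; omega)
        exact ⟨m + 1, by rw [hm']; ring⟩
  have hall : ∀ x, ψ x ≠ 0 → ∃ m : ℤ, log (v (ψ x)) = m * log (v (ψ u)) := fun x hx ↦
    hpow (log (v (ψ x))).natAbs (ψ x) (hψS x) hx (by omega)
  obtain ⟨a, b, hb, rfl⟩ := hfrac x₀
  have ha : ψ a ≠ 0 := by
    intro h
    rw [h, zero_div, map_zero] at hx₀
    exact exp_ne_zero hx₀.symm
  obtain ⟨m, hm1⟩ := hall a ha
  obtain ⟨m', hm2⟩ := hall b hb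
  have h5 := congrArg log hx₀
  rw [map_div₀, log_div (v.ne_zero_iff.2 ha) (v.ne_zero_iff.2 hb), log_exp, hm1, hm2,
    ← sub_mul] at h5
  -- The uniformizer x₀ is a fraction, so its order 1 is a multiple of the order of u.
  have h6 : log (v (ψ u)) ∣ 1 := ⟨-(m - m'), by linear_combination h5⟩
  have h7 : log (v (ψ u)) = -1 := by
    rcases Int.isUnit_iff.1 (isUnit_of_dvd_one h6) with h | h
    · omega
    · exact h
  rw [← exp_log hvu0, h7]

theorem exists_valuation_eq_exp_neg_one {f u w : O} (hm : maximalIdeal O = Ideal.span {u, w})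
    (hf : f - u * w ∈ maximalIdeal O ^ 3) (hψ : ψ f = 0) : ∃ x, v (ψ x) = exp (-1) := by
  rcases le_total (v (ψ w)) (v (ψ u)) with h | h
  · exact ⟨u, valuation_eq_exp_neg_one_of_le v ψ hle hlt hfrac hex hm hf hψ h⟩
  · rw [mul_comm] at hf
    exact ⟨w, valuation_eq_exp_neg_one_of_le v ψ hle hlt hfrac hex
      (hm.trans (by rw [Set.pair_comm])) hf hψ h⟩

end Node

/-- A regular local ring of dimension at most one has principal maximal ideal. -/
theorem valuationRing_of_isRegularLocalRing (R : Type*) [CommRing R] [IsDomain R]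
    [IsRegularLocalRing R] (hdim : Ring.KrullDimLE 1 R) : ValuationRing R := by
  have h1 := (IsRegularLocalRing.iff_finrank_cotangentSpace R).1 inferInstance
  have h2 : ringKrullDim R ≤ 1 := Ring.krullDimLE_iff.1 hdim
  rw [← h1] at h2
  exact ((tfae_of_isNoetherianRing_of_isLocalRing_of_isDomain R).out 5 1).1 (by exact_mod_cast h2)

end

section


/-! ### The normalization of a rational curve -/

open WithZero IsLocalRing

/-! ### Function fields of birational curves -/

section Birational

variable {Y C : Scheme.{u}} [IsIntegral Y] [IsIntegral C] (h : Y ⟶ C)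

/-- Over U the generic point of C has a preimage. The generic point of Y specializes to it, so its
image specializes to the generic point of C and must equal it. -/
theorem map_genericPoint (hb : ∃ U : C.Opens, (U : Set C).Nonempty ∧ IsIso (h ∣_ U)) :
    h (genericPoint Y) = genericPoint C := by
  obtain ⟨U, ⟨c, hc⟩, hU⟩ := hb
  have hη : genericPoint C ∈ U := genericPoint_mem hc
  obtain ⟨y, hy⟩ := (h ∣_ U).surjective ⟨genericPoint C, hη⟩
  have hy' : h y.1 = genericPoint C := by
    have h2 : h y.1 = ((h ∣_ U) y).1 := (congr($(morphismRestrict_ι h U) y)).symm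
    exact h2.trans (congrArg Subtype.val hy)
  have h1 : h (genericPoint Y) ⤳ genericPoint C := by
    rw [← hy']
    exact (genericPoint_specializes y.1).map h.continuous
  exact (h1.antisymm (genericPoint_specializes _)).eq

variable (hη : h (genericPoint Y) = genericPoint C)

include hη in
theorem map_genericPoint_mem {V : C.Opens} (hV : genericPoint C ∈ V) :
    h (genericPoint Y) ∈ V := by rwa [hη]

/-- The map on function fields induced by a dominant morphism. -/
def functionFieldMap : C.functionField →+* Y.functionField :=
  (h.stalkMap (genericPoint Y)).hom.comp
    (C.presheaf.stalkSpecializes (specializes_of_eq hη)).hom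

theorem functionFieldMap_germ {V : C.Opens} (hV : genericPoint C ∈ V) (a : Γ(C, V)) :
    functionFieldMap h hη (C.presheaf.germ V _ hV a) =
      pullGerm h (map_genericPoint_mem h hη hV) a := by
  change h.stalkMap (genericPoint Y) (C.presheaf.stalkSpecializes _ (C.presheaf.germ V _ hV a)) = _
  rw [TopCat.Presheaf.germ_stalkSpecializes_apply, Scheme.Hom.germ_stalkMap_apply]
  rfl

/-- The generic point of Y lies over U, where h is an isomorphism, so its stalk map is bijective. -/
theorem functionFieldMap_surjective
    (hb : ∃ U : C.Opens, (U : Set C).Nonempty ∧ IsIso (h ∣_ U)) :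
    Function.Surjective (functionFieldMap h hη) := by
  obtain ⟨U, ⟨c, hc⟩, hU⟩ := hb
  have hηU : genericPoint Y ∈ h ⁻¹ᵁ U := map_genericPoint_mem h hη (genericPoint_mem hc)
  have hiso : IsIso (h.stalkMap (genericPoint Y)) := by
    have h1 : ∀ y : (h ⁻¹ᵁ U).toScheme, IsIso ((h ∣_ U).stalkMap y) := fun y ↦ inferInstance
    exact ((MorphismProperty.isomorphisms CommRingCat).arrow_mk_iso_iff
      (morphismRestrictStalkMap h U ⟨genericPoint Y, hηU⟩)).1 (h1 _)
  intro x
  obtain ⟨b, rfl⟩ := (ConcreteCategory.bijective_of_isIso (h.stalkMap (genericPoint Y))).2 x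
  obtain ⟨V, hV, a, rfl⟩ := C.presheaf.exists_germ_eq b
  have hV' : genericPoint C ∈ V := by rwa [hη] at hV
  refine ⟨C.presheaf.germ V _ hV' a, ?_⟩
  rw [functionFieldMap_germ, Scheme.Hom.germ_stalkMap_apply]
  rfl

/-- The map from a local ring of `C` to the function field of `Y`. -/
def stalkToFunctionField (c : C) : C.presheaf.stalk c →+* Y.functionField :=
  (functionFieldMap h hη).comp (algebraMap (C.presheaf.stalk c) C.functionField)

theorem stalkToFunctionField_germ {V : C.Opens} {c : C} (hc : c ∈ V) (a : Γ(C, V)) :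
    stalkToFunctionField h hη c (C.presheaf.germ V c hc a) =
      pullGerm h (map_genericPoint_mem h hη (genericPoint_mem hc)) a := by
  rw [stalkToFunctionField, RingHom.comp_apply, algebraMap_germ, functionFieldMap_germ]

theorem stalkToFunctionField_stalkMap (y : Y) (a : C.presheaf.stalk (h y)) :
    stalkToFunctionField h hη (h y) a =
      algebraMap (Y.presheaf.stalk y) Y.functionField (h.stalkMap y a) := by
  obtain ⟨V, hV, a, rfl⟩ := C.presheaf.exists_germ_eq a
  rw [stalkToFunctionField_germ, Scheme.Hom.germ_stalkMap_apply]
  exact (algebraMap_germ (V := h ⁻¹ᵁ V) y hV _).symm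

include hη in
theorem surjective_of_isIntegralHom [IsIntegralHom h] : Function.Surjective h := by
  rw [← Set.range_eq_univ]
  have hcl : IsClosed (Set.range h) := h.isClosedMap.isClosed_range
  refine Set.eq_univ_of_forall fun c ↦ ?_
  have : closure {genericPoint C} ⊆ Set.range h :=
    hcl.closure_subset_iff.2 (by rintro _ rfl; exact ⟨_, hη⟩)
  exact this ((genericPoint_specializes c).mem_closure)

end Birational

/-! ### Images of the closed points of the line -/

section Line

attribute [local instance] MvPolynomial.gradedAlgebra

theorem locallyOfFiniteType_projSpaceToSpec (k : Type u) [Field k] (n : ℕ) :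
    LocallyOfFiniteType (projSpaceToSpec k n) := by
  let 𝒜 := MvPolynomial.homogeneousSubmodule (Fin (n + 1)) k
  have hs : Function.Surjective (algebraMap k (𝒜 0)) := by
    rintro ⟨p, hp⟩
    have hp' : p ∈ MvPolynomial.homogeneousSubmodule (Fin (n + 1)) k 0 := hp
    rw [MvPolynomial.homogeneousSubmodule_zero, Submodule.mem_one] at hp'
    obtain ⟨c, rfl⟩ := hp'
    exact ⟨c, rfl⟩
  have : IsScalarTower k (𝒜 0) (MvPolynomial (Fin (n + 1)) k) :=
    IsScalarTower.of_algebraMap_eq (R := k) (S := 𝒜 0) (A := MvPolynomial (Fin (n + 1)) k)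
      fun c ↦ rfl
  have : Algebra.FiniteType (𝒜 0) (MvPolynomial (Fin (n + 1)) k) :=
    Algebra.FiniteType.of_restrictScalars_finiteType k _ _
  have h1 : LocallyOfFiniteType (Proj.toSpecZero 𝒜) := inferInstance
  have h2 : LocallyOfFiniteType (Spec.map (CommRingCat.ofHom (algebraMap k (𝒜 0)))) := by
    rw [HasRingHomProperty.Spec_iff (P := @LocallyOfFiniteType)]
    exact RingHom.FiniteType.of_surjective _ hs
  exact inferInstanceAs (LocallyOfFiniteType (Proj.toSpecZero 𝒜 ≫ Spec.map _))

variable {k : Type u} [Field k] [IsAlgClosed k] [IsIntegral (projLine k)]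

theorem exists_lineVal_le_one_and_lt {q q' : Option k} (hne : q ≠ q') :
    ∃ x, lineVal k q' x ≤ 1 ∧ 1 < lineVal k q x := by
  have hv := isLineValuation k
  cases q with
  | none =>
    cases q' with
    | none => exact absurd rfl hne
    | some a =>
      obtain ⟨g, -, h1, h2⟩ := hv.exists_of_divisor (Finsupp.single a 1)
      refine ⟨g, ?_, ?_⟩
      · rw [h1, ← exp_zero, exp_le_exp]; simp
      · rw [h2, ← exp_zero, exp_lt_exp]; simp
  | some a =>
    obtain ⟨g, -, h1, h2⟩ := hv.exists_of_divisor (Finsupp.single a (-1))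
    refine ⟨g, ?_, ?_⟩
    · cases q' with
      | none => rw [h2, ← exp_zero, exp_le_exp, Finsupp.sum_single_index rfl]; simp
      | some b =>
        have hab : a ≠ b := fun e ↦ hne (by rw [e])
        rw [h1, ← exp_zero, exp_le_exp, Finsupp.single_eq_of_ne hab.symm]
        simp
    · rw [h1, ← exp_zero, exp_lt_exp]; simp

/-- If pt q specialized to another closed point pt q', every function regular at q' would be regular
at q; powers of t - a contradict this. -/
theorem isClosed_singleton_pt (q : Option k) : IsClosed ({pt k q} : Set (projLine k)) := by
  rw [← closure_subset_iff_isClosed]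
  intro y hy
  have hs : pt k q ⤳ y := specializes_iff_mem_closure.2 hy
  obtain rfl | ⟨q', rfl⟩ := eq_genericPoint_or_exists_pt k y
  · exact absurd (hs.antisymm (genericPoint_specializes _)).eq (pt_ne_genericPoint k q)
  · by_contra hne
    have hne' : q ≠ q' := fun e ↦ hne (by rw [e]; rfl)
    obtain ⟨x, hx, hx'⟩ := exists_lineVal_le_one_and_lt hne'
    obtain ⟨r, rfl⟩ := (lineVal_le_one_iff k q' x).1 hx
    obtain ⟨V, hV, a, rfl⟩ := (projLine k).presheaf.exists_germ_eq r
    rw [algebraMap_germ _ hV] at hx'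
    exact hx'.not_ge (lineVal_germ_le_one k V q (hs.mem_open V.isOpen hV) a)

/-- The orders at finite points of Q are prescribed by a product of linear factors. The order at
infinity is then adjusted by a power of t - a for some a outside Q, available because k is infinite.
-/
theorem exists_lineVal_eq (Q : Finset (Option k)) (n : Option k → ℤ) :
    ∃ x, ∀ q ∈ Q, lineVal k q x = exp (-n q) := by
  classical
  have hv := isLineValuation k
  have : Infinite k := IsAlgClosed.instInfinite
  obtain ⟨a, ha⟩ := Infinite.exists_notMem_finset (Finset.eraseNone Q)
  let m : k →₀ ℤ := Finsupp.onFinset (Finset.eraseNone Q)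
    (fun b ↦ if b ∈ Finset.eraseNone Q then n (some b) else 0) (by intro b hb; by_contra h; simp [h] at hb)
  let m' : k →₀ ℤ := m + Finsupp.single a (-n none - m.sum fun _ j ↦ j)
  obtain ⟨g, -, h1, h2⟩ := hv.exists_of_divisor m'
  refine ⟨g, fun q hq ↦ ?_⟩
  cases q with
  | none =>
    rw [h2]
    congr 1
    rw [Finsupp.sum_add_index' (by simp) (by simp), Finsupp.sum_single_index rfl]
    ring
  | some b =>
    have hb : b ∈ Finset.eraseNone Q := Finset.mem_eraseNone.2 hq
    have hba : b ≠ a := fun e ↦ ha (e ▸ hb)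
    rw [h1]
    simp only [m', m, Finsupp.add_apply, Finsupp.onFinset_apply, if_pos hb,
      Finsupp.single_eq_of_ne hba, add_zero]

theorem isClosed_singleton_map_pt {C : Scheme.{u}} {h : projLine k ⟶ C} [IsIntegralHom h] (q : Option k) :
    IsClosed ({h (pt k q)} : Set C) := by
  have := h.isClosedMap _ (isClosed_singleton_pt q)
  rwa [Set.image_singleton] at this

variable {C : Scheme.{u}} [IsIntegral C] {h : projLine k ⟶ C}
  (hη : h (genericPoint (projLine k)) = genericPoint C)

theorem lineVal_stalkToFunctionField_le_one (q : Option k) {c : C} (hc : h (pt k q) = c)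
    (r : C.presheaf.stalk c) : lineVal k q (stalkToFunctionField h hη c r) ≤ 1 := by
  subst hc
  rw [stalkToFunctionField_stalkMap, lineVal_le_one_iff]
  exact ⟨_, rfl⟩

theorem lineVal_stalkToFunctionField_lt_one (q : Option k)
    (r : C.presheaf.stalk (h (pt k q))) (hr : r ∈ maximalIdeal (C.presheaf.stalk (h (pt k q)))) :
    lineVal k q (stalkToFunctionField h hη _ r) < 1 := by
  refine lt_of_le_of_ne (lineVal_stalkToFunctionField_le_one hη q rfl r) fun h1 ↦ ?_
  rw [stalkToFunctionField_stalkMap] at h1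
  have h2 := (valuation_algebraMap_eq_one_iff _).1 h1
  exact hr ((isUnit_map_iff (h.stalkMap (pt k q)).hom r).1 h2)

variable (hsurj : Function.Surjective (functionFieldMap h hη))

-- If pt q were over the generic point, all of K would come from the stalk of C there and so be
-- integral at q; but K contains functions with a pole at q.
include hsurj in
theorem map_pt_ne_genericPoint (q : Option k) : h (pt k q) ≠ genericPoint C := by
  intro he
  obtain ⟨x, hx⟩ := exists_lineVal_eq {q} (fun _ ↦ (-1 : ℤ))
  have hx' := hx q (Finset.mem_singleton_self q)
  obtain ⟨y, rfl⟩ := hsurj x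
  obtain ⟨r, rfl⟩ := mem_range_algebraMap_of_eq_genericPoint he y
  have := lineVal_stalkToFunctionField_le_one hη q rfl r
  change lineVal k q (functionFieldMap h hη (algebraMap _ _ r)) ≤ 1 at this
  rw [hx', ← exp_zero, exp_le_exp] at this
  omega

include hη in
theorem eq_genericPoint_or_exists_map_pt [IsIntegralHom h] (c : C) :
    c = genericPoint C ∨ ∃ q, c = h (pt k q) := by
  obtain ⟨y, rfl⟩ := surjective_of_isIntegralHom h hη c
  obtain rfl | ⟨q, rfl⟩ := eq_genericPoint_or_exists_pt k y
  · exact Or.inl hη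
  · exact Or.inr ⟨q, rfl⟩

include hsurj in
theorem finite_fibre [IsIntegralHom h] (q₀ : Option k) : {q | h (pt k q) = h (pt k q₀)}.Finite := by
  let V : C.Opens := ⟨{h (pt k q₀)}ᶜ, (isClosed_singleton_map_pt q₀).isOpen_compl⟩
  have hV : genericPoint C ∈ V := fun e ↦ map_pt_ne_genericPoint hη hsurj q₀ e.symm
  refine (finite_pt_notMem k (h ⁻¹ᵁ V) (map_genericPoint_mem h hη hV)).subset fun q hq hq' ↦ ?_
  exact hq' hq

-- The points of C are its generic point and the images of the pt q, which are closed, so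
-- specialization chains have length at most one. This puts the images among the points where
-- `Scheme.ord` is nontrivial.
include hsurj in
theorem coheight_map_pt [IsIntegralHom h] (q : Option k) : Order.coheight (h (pt k q)) = 1 := by
  have hne := map_pt_ne_genericPoint hη hsurj q
  have hmax : ∀ y : C, h (pt k q) < y → y = genericPoint C := by
    intro y hy
    obtain rfl | ⟨q', rfl⟩ := eq_genericPoint_or_exists_map_pt hη y
    · rfl
    · exfalso
      have hs : h (pt k q') ⤳ h (pt k q) := Scheme.le_iff_specializes.1 hy.le
      have : h (pt k q) ∈ ({h (pt k q')} : Set C) := by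
        have := hs.mem_closure
        rwa [(isClosed_singleton_map_pt q').closure_eq] at this
      rw [Set.mem_singleton_iff] at this
      exact hy.ne this
  have hlt : h (pt k q) < genericPoint C := by
    refine lt_of_le_not_ge (Scheme.le_iff_specializes.2 (genericPoint_specializes _)) fun hle ↦ ?_
    exact hne ((Scheme.le_iff_specializes.1 hle).antisymm (genericPoint_specializes _)).eq
  have hη0 : IsMax (genericPoint C) := fun y _ ↦
    Scheme.le_iff_specializes.2 (genericPoint_specializes y)
  refine le_antisymm ?_ ?_
  · refine (Order.coheight_le_coe_iff (n := 1)).2 fun y hy ↦ ?_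
    rw [hmax y hy, Order.coheight_eq_zero.2 hη0]
    exact_mod_cast one_pos
  · have := Order.coheight_add_one_le hlt
    rw [Order.coheight_eq_zero.2 hη0] at this
    simpa using this

theorem coheight_genericPoint : Order.coheight (genericPoint C) = 0 :=
  Order.coheight_eq_zero.2 fun y _ ↦ Scheme.le_iff_specializes.2 (genericPoint_specializes y)

end Line

end

section


/-! ### Orders of vanishing on a rational curve -/

open WithZero IsLocalRing

variable {k : Type u} [Field k] [IsIntegral (projLine k)] {C : Scheme.{u}} [IsIntegral C]
  {h : projLine k ⟶ C} [IsIntegralHom h]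
  (hη : h (genericPoint (projLine k)) = genericPoint C)
  (hsurj : Function.Surjective (functionFieldMap h hη))
  {σ : C ⟶ Spec (CommRingCat.of k)} (hσ : h ≫ σ = projSpaceToSpec k 1)

include hsurj hσ

/-- The line is of finite type over k, so the integral morphism h is finite. Finitely many
generators of the functions on h⁻¹U lie in the fraction field of those on U and have a common
denominator β. -/
theorem exists_common_denominator {U : C.Opens} (hU : IsAffineOpen U) (hηU : genericPoint C ∈ U) :
    ∃ β : Γ(C, U), pullGerm h (map_genericPoint_mem h hη hηU) β ≠ 0 ∧
      ∀ b : Γ(projLine k, h ⁻¹ᵁ U), ∃ a : Γ(C, U),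
        pullGerm h (map_genericPoint_mem h hη hηU) β *
          (projLine k).presheaf.germ (h ⁻¹ᵁ U) _
            (generic_mem_preimage h (map_genericPoint_mem h hη hηU)) b =
          pullGerm h (map_genericPoint_mem h hη hηU) a := by
  have hft : LocallyOfFiniteType h := by
    have : LocallyOfFiniteType (h ≫ σ) := by
      rw [hσ]; exact locallyOfFiniteType_projSpaceToSpec k 1
    exact locallyOfFiniteType_of_comp h σ
  have : IsFinite h := (IsFinite.iff_isIntegralHom_and_locallyOfFiniteType h).2 ⟨inferInstance, hft⟩
  have hfin := IsFinite.finite_app (f := h) U hU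
  have hUne : Nonempty U := ⟨⟨_, hηU⟩⟩
  have hfr := functionField_isFractionRing_of_isAffineOpen C U hU
  have hηY := map_genericPoint_mem h hη hηU
  let g := (projLine k).presheaf.germ (h ⁻¹ᵁ U) _ (generic_mem_preimage h hηY)
  choose ξ hξ using fun b : Γ(projLine k, h ⁻¹ᵁ U) ↦ hsurj (g b)
  let := (h.app U).hom.toAlgebra
  have hfin' : Module.Finite Γ(C, U) Γ(projLine k, h ⁻¹ᵁ U) := hfin
  obtain ⟨S, hS⟩ := hfin'.fg_top
  obtain ⟨β, hβ⟩ := IsLocalization.exist_integer_multiples (nonZeroDivisors Γ(C, U)) S ξ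
  have hmap : ∀ a : Γ(C, U), functionFieldMap h hη (algebraMap Γ(C, U) C.functionField a) =
      pullGerm h hηY a := fun a ↦ functionFieldMap_germ h hη hηU a
  refine ⟨β.1, ?_, fun b ↦ ?_⟩
  · rw [← hmap, Ne, map_eq_zero]
    exact IsFractionRing.to_map_ne_zero_of_mem_nonZeroDivisors β.2
  · have hb : b ∈ Submodule.span Γ(C, U) (S : Set Γ(projLine k, h ⁻¹ᵁ U)) := by
      rw [hS]; trivial
    change ∃ a, pullGerm h hηY β.1 * g b = pullGerm h hηY a
    induction hb using Submodule.span_induction with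
    | mem b hb =>
      obtain ⟨a, ha⟩ := hβ b hb
      refine ⟨a, ?_⟩
      rw [← hmap, ← hmap, ha, Algebra.smul_def, map_mul, hξ]
    | zero => exact ⟨0, by rw [map_zero, map_zero, mul_zero]⟩
    | add b b' _ _ hb hb' =>
      obtain ⟨a, ha⟩ := hb
      obtain ⟨a', ha'⟩ := hb'
      exact ⟨a + a', by rw [map_add, mul_add, ha, ha', map_add]⟩
    | smul r b _ hb =>
      obtain ⟨a, ha⟩ := hb
      refine ⟨r * a, ?_⟩
      have e : g (r • b) = pullGerm h hηY r * g b := by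
        rw [Algebra.smul_def, map_mul]; rfl
      rw [e, map_mul, ← ha]; ring

variable [IsAlgClosed k]

/-- Suppose x vanishes on the fibre at least to the order of β. Then y = x/β is regular along the
fibre. Near the fibre y = b/gᴺ with b regular on h⁻¹U and g a unit at the point of C, and x = βb/gᴺ
lies in the local ring since βb comes from U. -/
theorem exists_conductor (q₀ : Option k) : ∃ n : Option k → ℕ,
    ∀ x : (projLine k).functionField,
      (∀ q, h (pt k q) = h (pt k q₀) → lineVal k q x ≤ exp (-(n q : ℤ))) →
      x ∈ Set.range (stalkToFunctionField h hη (h (pt k q₀))) := by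
  obtain ⟨U, hU, hcU, -⟩ := exists_isAffineOpen_mem_and_subset (X := C) (U := ⊤)
    (x := h (pt k q₀)) trivial
  have hηU := genericPoint_mem hcU
  have hηY := map_genericPoint_mem h hη hηU
  obtain ⟨β, hβ0, hβ⟩ := exists_common_denominator hη hsurj hσ hU hηU
  refine ⟨fun q ↦ (-log (lineVal k q (pullGerm h hηY β))).toNat, fun x hx ↦ ?_⟩
  let y := x / pullGerm h hηY β
  have hy : ∀ q, h (pt k q) = h (pt k q₀) → lineVal k q y ≤ 1 := by
    intro q hq
    have hv0 : lineVal k q (pullGerm h hηY β) ≠ 0 := (lineVal k q).ne_zero_iff.2 hβ0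
    rw [map_div₀]
    refine div_le_one_of_le₀ ((hx q hq).trans ?_) zero_le
    rw [← le_log_iff_exp_le hv0]
    beta_reduce
    omega
  have hZ := (isLineValuation k).finite_one_lt y
  -- The poles of y map to a finite closed set that misses the point under consideration; g is
  -- chosen so that its basic open avoids Z.
  let Z : Set C := (fun q ↦ h (pt k q)) '' {q | ¬ lineVal k q y ≤ 1}
  have hZc : IsClosed Z := by
    have : Z = ⋃ q ∈ {q | ¬ lineVal k q y ≤ 1}, {h (pt k q)} := by
      ext c; simp [Z, eq_comm]
    rw [this]
    exact hZ.isClosed_biUnion fun q _ ↦ isClosed_singleton_map_pt q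
  let V : C.Opens := ⟨Zᶜ, hZc.isOpen_compl⟩
  have hcV : h (pt k q₀) ∈ V := by
    rintro ⟨q, hq, hq'⟩
    exact hq (hy q hq')
  obtain ⟨g, hgV, hcg⟩ := hU.exists_basicOpen_le (V := V) ⟨_, hcV⟩ hcU
  have hηg : genericPoint (projLine k) ∈ h ⁻¹ᵁ C.basicOpen g :=
    generic_mem_preimage h (map_genericPoint_mem h hη (genericPoint_mem hcg))
  have hηg' : genericPoint (projLine k) ∈ (projLine k).basicOpen (h.app U g) := by
    rwa [Scheme.preimage_basicOpen] at hηg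
  obtain ⟨b', hb'⟩ := exists_germ_eq_of_lineVal_le_one k ((projLine k).basicOpen (h.app U g)) hηg' y
    (by
      intro q hq
      rw [← Scheme.preimage_basicOpen] at hq
      by_contra hne
      exact hgV hq ⟨q, hne, rfl⟩)
  have hloc := (hU.preimage h).isLocalization_basicOpen (h.app U g)
  obtain ⟨N, b, hb⟩ := IsLocalization.Away.surj (h.app U g) b'
  have hle : (projLine k).basicOpen (h.app U g) ≤ h ⁻¹ᵁ U := (projLine k).basicOpen_le _
  have hgerm : ∀ z : Γ(projLine k, h ⁻¹ᵁ U),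
      (projLine k).presheaf.germ _ _ hηg' (algebraMap _ Γ(projLine k, (projLine k).basicOpen (h.app U g)) z) =
        (projLine k).presheaf.germ (h ⁻¹ᵁ U) _ (generic_mem_preimage h hηY) z := fun z ↦
    germ_res hle _ hηg' z
  have hb2 := congrArg ((projLine k).presheaf.germ _ _ hηg') hb
  rw [map_mul, map_pow, hb', hgerm, hgerm, ← pullGerm_apply h hηY] at hb2
  obtain ⟨a, ha⟩ := hβ b
  rw [← hb2] at ha
  have hgu : IsUnit (C.presheaf.germ U _ hcU g) := (C.mem_basicOpen g _ hcU).1 hcg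
  obtain ⟨w, hw⟩ := hgu.exists_right_inv
  have hx' : x = pullGerm h hηY β * y := (mul_div_cancel₀ x hβ0).symm
  refine ⟨C.presheaf.germ U _ hcU a * w ^ N, ?_⟩
  have hw' := congrArg (stalkToFunctionField h hη (h (pt k q₀))) hw
  rw [map_mul, stalkToFunctionField_germ, map_one] at hw'
  rw [map_mul, map_pow, stalkToFunctionField_germ, ← ha, hx']
  calc _ = pullGerm h hηY β * y *
        (pullGerm h hηY g * stalkToFunctionField h hη (h (pt k q₀)) w) ^ N := by ring
    _ = _ := by rw [hw', one_pow, mul_one]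

/-- This is `ordFrac_eq_exp_sum` for the places over the point. Its hypotheses hold because residues
are constants in k, orders can be prescribed at finitely many points, and the conductor exists. -/
theorem ord_eq_sum [IsLocallyNoetherian C] (q₀ : Option k) (a : C.functionField) (ha : a ≠ 0) :
    C.ord a (h (pt k q₀)) = ∑ q ∈ (finite_fibre hη hsurj q₀).toFinset,
      -log (lineVal k q (functionFieldMap h hη a)) := by
  have hco := coheight_map_pt hη hsurj q₀
  have hK : Ring.KrullDimLE 1 (C.presheaf.stalk (h (pt k q₀))) :=
    krullDimLE_of_coheight_le hco.le
  have hmem : ∀ q, q ∈ (finite_fibre hη hsurj q₀).toFinset ↔ h (pt k q) = h (pt k q₀) := by simp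
  rw [Scheme.ord_eq_iff hco ha]
  let := (stalkToFunctionField h hη (h (pt k q₀))).toAlgebra
  refine ordFrac_eq_exp_sum (R := C.presheaf.stalk (h (pt k q₀))) (K := (projLine k).functionField)
    (finite_fibre hη hsurj q₀).toFinset (lineVal k)
    (fun q hq r ↦ lineVal_stalkToFunctionField_le_one hη q ((hmem q).1 hq) r)
    (exists_lineVal_eq _) ?_ (functionFieldMap h hη) (fun r ↦ rfl) ?_ a ha
  · intro q hq x hx
    obtain ⟨c, hc⟩ := (isLineValuation k).exists_const_lt q x hx
    refine ⟨C.presheaf.germ ⊤ _ (Opens.mem_top _) (constMap σ ⊤ c), ?_, ?_⟩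
    · by_cases h0 : c = 0
      · left; rw [h0, map_zero, map_zero]
      · right
        exact ((isUnit_iff_ne_zero.2 h0).map (constMap σ ⊤)).map (C.presheaf.germ ⊤ _ (Opens.mem_top _)).hom
    · have : algebraMap (C.presheaf.stalk (h (pt k q₀))) (projLine k).functionField
          (C.presheaf.germ ⊤ _ (Opens.mem_top _) (constMap σ ⊤ c)) = algebraMap k _ c := by
        change stalkToFunctionField h hη (h (pt k q₀)) _ = _
        rw [stalkToFunctionField_germ, pullGerm_apply, app_constMap, hσ, germ_constMap]
      rwa [this]
  · obtain ⟨n, hn⟩ := exists_conductor hη hsurj hσ q₀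
    exact ⟨n, fun x hx ↦ hn x fun q hq ↦ hx q ((hmem q).2 hq)⟩

omit hσ in
/-- The normalization of a nodal curve on a surface is unramified. -/
theorem exists_uniformizer_of_isNodal [IsLocallyNoetherian C] {X : Scheme.{u}} (i : C ⟶ X)
    [IsClosedImmersion i] (hC : IsNodal i) (q : Option k) :
    ∃ a : X.presheaf.stalk ((h ≫ i) (pt k q)),
      lineVal k q (algebraMap _ _ ((h ≫ i).stalkMap (pt k q) a)) = exp (-1) := by
  suffices H : ∃ a : X.presheaf.stalk (i (h (pt k q))), lineVal k q
      (stalkToFunctionField h hη _ (i.stalkMap (h (pt k q)) a)) = exp (-1) by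
    obtain ⟨a, ha⟩ := H
    refine ⟨a, ?_⟩
    rw [stalkToFunctionField_stalkMap] at ha
    rw [← ha, Scheme.Hom.stalkMap_comp]
    rfl
  have hco := coheight_map_pt hη hsurj q
  have hK : Ring.KrullDimLE 1 (C.presheaf.stalk (h (pt k q))) :=
    krullDimLE_of_coheight_le hco.le
  obtain ⟨x, hx⟩ := exists_lineVal_eq {q} (fun _ ↦ (1 : ℤ))
  replace hx := hx q (Finset.mem_singleton_self q)
  have hsi : Function.Surjective (i.stalkMap (h (pt k q))) := i.stalkMap_surjective _
  -- At a regular point the local ring of C is a valuation ring containing a function of order one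
  -- or its inverse, and the inverse has a pole. At a node the blow-up argument applies to the local
  -- ring of X. The stalk map of the closed immersion is surjective, so uniformizers come from X.
  obtain hreg | ⟨f, u, v, hker, hm, hf⟩ := hC (h (pt k q))
  · have hV := valuationRing_of_isRegularLocalRing _ hK
    obtain ⟨x', rfl⟩ := hsurj x
    obtain ⟨r, hr⟩ | ⟨r, hr⟩ := ValuationRing.isInteger_or_isInteger
      (C.presheaf.stalk (h (pt k q))) x'
    · obtain ⟨a, rfl⟩ := hsi r
      refine ⟨a, ?_⟩
      rw [stalkToFunctionField, RingHom.comp_apply, hr, hx]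
    · exfalso
      have h1 := lineVal_stalkToFunctionField_le_one hη q rfl r
      rw [stalkToFunctionField, RingHom.comp_apply, hr, map_inv₀, map_inv₀, hx, ← exp_neg,
        ← exp_zero, exp_le_exp] at h1
      omega
  · refine exists_valuation_eq_exp_neg_one (lineVal k q)
      ((stalkToFunctionField h hη (h (pt k q))).comp (i.stalkMap (h (pt k q))).hom)
      (fun a ↦ lineVal_stalkToFunctionField_le_one hη q rfl _)
      (fun a ha ↦ lineVal_stalkToFunctionField_lt_one hη q _ ?_) (fun z ↦ ?_) ⟨x, hx⟩ hm hf ?_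
    · exact fun hu ↦ ha ((isUnit_map_iff (i.stalkMap (h (pt k q))).hom a).1 hu)
    · obtain ⟨z', rfl⟩ := hsurj z
      obtain ⟨a, b, hb, rfl⟩ := IsFractionRing.div_surjective
        (A := C.presheaf.stalk (h (pt k q))) z'
      obtain ⟨a, rfl⟩ := hsi a
      obtain ⟨b, rfl⟩ := hsi b
      refine ⟨a, b, ?_, map_div₀ _ _ _⟩
      change functionFieldMap h hη (algebraMap _ _ _) ≠ 0
      rw [Ne, map_eq_zero]
      exact IsFractionRing.to_map_ne_zero_of_mem_nonZeroDivisors hb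
    · have : f ∈ RingHom.ker (i.stalkMap (h (pt k q))).hom := by
        rw [hker]; exact Ideal.mem_span_singleton_self f
      rw [RingHom.comp_apply, RingHom.mem_ker.1 this, map_zero]

end

section


/-! ### The generic fibre of the restricted cotangent sheaf -/

section GenericCotangent

theorem KaehlerDifferential_leibniz {A B : CommRingCat.{u}} (φ : A ⟶ B) (a b : B) :
    CommRingCat.KaehlerDifferential.d (f := φ) (a * b) =
      a • CommRingCat.KaehlerDifferential.d b + b • CommRingCat.KaehlerDifferential.d a :=
  ModuleCat.Derivation.d_mul _ _ _

/-- The differential `1 ⊗ da` in an extension of scalars of the module of differentials. -/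
def extendedDiff {A B L : CommRingCat.{u}} (φ : A ⟶ B) (ρ : B →+* L) (a : B) :
    (ModuleCat.extendScalars ρ).obj (CommRingCat.KaehlerDifferential φ) :=
  letI := ρ.toAlgebra
  (1 : L) ⊗ₜ[B] CommRingCat.KaehlerDifferential.d (f := φ) a

variable {A B L : CommRingCat.{u}} (φ : A ⟶ B) (ρ : B →+* L)

theorem extendedDiff_add (a b : B) :
    extendedDiff φ ρ (a + b) = extendedDiff φ ρ a + extendedDiff φ ρ b := by
  let := ρ.toAlgebra
  refine (congrArg (fun z ↦ ((1 : L) ⊗ₜ[B] z : L ⊗[B] CommRingCat.KaehlerDifferential φ))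
    (ModuleCat.Derivation.d_add _ a b)).trans ?_
  exact TensorProduct.tmul_add _ _ _

theorem extendedDiff_mul (a b : B) :
    extendedDiff φ ρ (a * b) = ρ a • extendedDiff φ ρ b + ρ b • extendedDiff φ ρ a := by
  let := ρ.toAlgebra
  refine (congrArg (fun z ↦ ((1 : L) ⊗ₜ[B] z : L ⊗[B] CommRingCat.KaehlerDifferential φ))
    (KaehlerDifferential_leibniz φ a b)).trans ?_
  refine (TensorProduct.tmul_add _ _ _).trans ?_
  have key : ∀ (a : B) (x : CommRingCat.KaehlerDifferential φ),
      ((1 : L) ⊗ₜ[B] (a • x) : L ⊗[B] CommRingCat.KaehlerDifferential φ) =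
        (ρ a * 1 : L) ⊗ₜ[B] x := by
    intro a x
    rw [← TensorProduct.smul_tmul, Algebra.smul_def]
    rfl
  rw [key, key]
  rfl

theorem extendedDiff_map (a : A) : extendedDiff φ ρ (φ a) = 0 := by
  let := ρ.toAlgebra
  refine (congrArg (fun z ↦ ((1 : L) ⊗ₜ[B] z : L ⊗[B] CommRingCat.KaehlerDifferential φ))
    (ModuleCat.Derivation.d_map _ a)).trans ?_
  exact TensorProduct.tmul_zero _ _

theorem extendedDiff_hom_ext {M : ModuleCat.{u} L}
    (α β : (ModuleCat.extendScalars ρ).obj (CommRingCat.KaehlerDifferential φ) ⟶ M)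
    (h : ∀ a, α (extendedDiff φ ρ a) = β (extendedDiff φ ρ a)) : α = β := by
  apply ((ModuleCat.extendRestrictScalarsAdj ρ).homEquiv _ _).injective
  refine CommRingCat.KaehlerDifferential.ext fun b ↦ ?_
  exact h b

/-- Compare the quotient map by N with zero. With `extendedDiff_hom_ext` this shows that
differentials span, using only universal properties. -/
theorem eq_top_of_hom_ext {M : ModuleCat.{u} L} (N : Submodule L M)
    (h : ∀ (M' : ModuleCat.{u} L) (α β : M ⟶ M'), (∀ x ∈ N, α x = β x) → α = β) : N = ⊤ := by
  have := h _ (ModuleCat.ofHom N.mkQ) 0 fun x hx ↦ (Submodule.Quotient.mk_eq_zero N).2 hx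
  rw [eq_top_iff]
  intro x _
  exact (Submodule.Quotient.mk_eq_zero N).1 congr($this x)

/-- A derivation into L is a linear map on the differentials, and hence an L-linear functional after
extension of scalars. -/
theorem exists_extendedDiff_functional (D : B →+ L)
    (hD : ∀ a b, D (a * b) = ρ a * D b + ρ b * D a) (hA : ∀ a, D (φ a) = 0) :
    ∃ δ : (ModuleCat.extendScalars ρ).obj (CommRingCat.KaehlerDifferential φ) →ₗ[L] L,
      ∀ a, δ (extendedDiff φ ρ a) = D a := by
  let D' : ((ModuleCat.restrictScalars ρ).obj (ModuleCat.of L L)).Derivation φ :=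
    ModuleCat.Derivation.mk (fun b ↦ D b) (fun b b' ↦ map_add D b b') hD hA
  let g := ModuleCat.ExtendRestrictScalarsAdj.HomEquiv.fromExtendScalars ρ D'.desc
  refine ⟨g.hom, fun a ↦ ?_⟩
  have h1 : g.hom (extendedDiff φ ρ a) = (1 : L) • (D'.desc (CommRingCat.KaehlerDifferential.d a) : L) :=
    rfl
  rw [h1, one_smul, ModuleCat.Derivation.desc_d]
  rfl

end GenericCotangent

end

section


/-! ### Rational two-forms restricted to a curve -/

theorem alternatingMap_two_combination {R M N : Type*} [CommRing R] [AddCommGroup M] [Module R M]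
    [AddCommGroup N] [Module R N] (f : M [⋀^Fin 2]→ₗ[R] N) (x y : M) (a b c d : R) :
    f ![a • x + b • y, c • x + d • y] = (a * d - b * c) • f ![x, y] := by
  have swap : ∀ x y : M, f ![x, y] = -f ![y, x] := by
    intro x y
    have := f.map_swap ![y, x] (i := 0) (j := 1) (by decide)
    rw [← this]
    congr 1
    ext i
    fin_cases i <;> rfl
  have self : ∀ x : M, f ![x, x] = 0 := fun x ↦
    f.map_eq_zero_of_eq ![x, x] (i := 0) (j := 1) rfl (by decide)
  have lin : ∀ (a b : R) (x y w : M), f ![a • x + b • y, w] = a • f ![x, w] + b • f ![y, w] := by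
    intro a b x y w
    rw [AlternatingMap.map_vecCons_add, AlternatingMap.map_vecCons_smul,
      AlternatingMap.map_vecCons_smul]
  rw [lin, swap x, swap y, lin, lin, self, self, swap y x]
  module

section

variable {S X C : Scheme.{u}} (s : X ⟶ S) (i : C ⟶ X) [IsIntegral C]

/-- Restriction to `C` of a function near `i c`. -/
def restrictedFun (c : C) : X.presheaf.stalk (i c) →+* C.functionField :=
  (i.stalkMap (genericPoint C)).hom.comp
    (X.presheaf.stalkSpecializes ((genericPoint_specializes c).map i.continuous)).hom

theorem restrictedFun_germ (c : C) {V : X.Opens} (hc : i c ∈ V) (a : Γ(X, V)) :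
    restrictedFun i c (X.presheaf.germ V _ hc a) = pullGerm i (mem_of_mem_preimage i hc) a := by
  change i.stalkMap (genericPoint C) (X.presheaf.stalkSpecializes _ (X.presheaf.germ V _ hc a)) = _
  rw [TopCat.Presheaf.germ_stalkSpecializes_apply, Scheme.Hom.germ_stalkMap_apply]
  rfl

theorem restrictedFun_eq (c : C) (a : X.presheaf.stalk (i c)) :
    restrictedFun i c a = algebraMap (C.presheaf.stalk c) C.functionField (i.stalkMap c a) := by
  obtain ⟨V, hV, a, rfl⟩ := X.presheaf.exists_germ_eq a
  rw [restrictedFun_germ, Scheme.Hom.germ_stalkMap_apply]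
  exact (algebraMap_germ (V := i ⁻¹ᵁ V) c hV _).symm

theorem restrictedDiff_eq (c : C) (a : X.presheaf.stalk (i c)) : restrictedDiff s i c a =
    extendedDiff (s.stalkMap (i (genericPoint C))) (i.stalkMap (genericPoint C)).hom
      (X.presheaf.stalkSpecializes ((genericPoint_specializes c).map i.continuous) a) := rfl

theorem restrictedDiff_germ (c : C) {V : X.Opens} (hc : i c ∈ V) (a : Γ(X, V)) :
    restrictedDiff s i c (X.presheaf.germ V _ hc a) =
      extendedDiff (s.stalkMap (i (genericPoint C))) (i.stalkMap (genericPoint C)).hom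
        (X.presheaf.germ V _ (mem_of_mem_preimage i hc) a) := by
  rw [restrictedDiff_eq, TopCat.Presheaf.germ_stalkSpecializes_apply]

theorem restrictedDiff_add (c : C) (a b : X.presheaf.stalk (i c)) :
    restrictedDiff s i c (a + b) = restrictedDiff s i c a + restrictedDiff s i c b := by
  rw [restrictedDiff_eq, map_add]
  exact extendedDiff_add _ _ _ _

theorem restrictedDiff_mul (c : C) (a b : X.presheaf.stalk (i c)) :
    restrictedDiff s i c (a * b) = restrictedFun i c a • restrictedDiff s i c b +
      restrictedFun i c b • restrictedDiff s i c a := by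
  rw [restrictedDiff_eq, map_mul]
  exact extendedDiff_mul _ _ _ _

theorem restrictedDiff_baseMap (c : C) {U : X.Opens} (hc : i c ∈ U) (r : Γ(S, ⊤)) :
    restrictedDiff s i c (X.presheaf.germ U _ hc (baseMap s U r)) = 0 := by
  rw [restrictedDiff_germ, ← stalkMap_germ_top]
  exact extendedDiff_map _ _ _

variable {s}

/-- Expansion of restricted differentials in the coordinates of a chart. -/
theorem restrictedDiff_expand (c : C) (c' : Chart s) (hc : i c ∈ c'.U)
    {d : Fin 2 → X.presheaf.stalk (i c) →+ X.presheaf.stalk (i c)}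
    (hd : ∀ (M : Type u) [AddCommGroup M] [Module (X.presheaf.stalk (i c)) M]
        (d' : X.presheaf.stalk (i c) →+ M),
        (∀ a b, d' (a * b) = a • d' b + b • d' a) →
        (∀ r, d' (X.presheaf.germ c'.U _ hc (baseMap s c'.U r)) = 0) →
        ∀ a, d' a = ∑ j, d j a • d' (X.presheaf.germ c'.U _ hc (c'.w j)))
    (a : X.presheaf.stalk (i c)) :
    restrictedDiff s i c a =
      restrictedFun i c (d 0 a) • restrictedDiff s i c (X.presheaf.germ c'.U _ hc (c'.w 0)) +
      restrictedFun i c (d 1 a) • restrictedDiff s i c (X.presheaf.germ c'.U _ hc (c'.w 1)) := by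
  let : Module (X.presheaf.stalk (i c)) (genericCotangent s i) :=
    Module.compHom _ (restrictedFun i c)
  have h0 : restrictedDiff s i c 0 = 0 := by
    have := restrictedDiff_add s i c 0 0
    rw [add_zero] at this
    exact left_eq_add.1 this
  have := hd (genericCotangent s i)
    { toFun := restrictedDiff s i c, map_zero' := h0, map_add' := restrictedDiff_add s i c }
    (restrictedDiff_mul s i c) (restrictedDiff_baseMap s i c hc) a
  rw [Fin.sum_univ_two] at this
  exact this

variable (c₀ : Chart s) (h₀ : i (genericPoint C) ∈ c₀.U)

/-- The differentials of the coordinates of a chart, as elements of the generic fibre. -/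
def chartDiff (j : Fin 2) : genericCotangent s i :=
  extendedDiff (s.stalkMap (i (genericPoint C))) (i.stalkMap (genericPoint C)).hom
    (X.presheaf.germ c₀.U _ h₀ (c₀.w j))

/-- The form `dw₀ ∧ dw₁` for the coordinates of a chart. -/
def chartForm : RationalTwoForm s i :=
  exteriorPower.ιMulti C.functionField 2 ![chartDiff i c₀ h₀ 0, chartDiff i c₀ h₀ 1]

theorem restrictedDiff_germ_eq_chartDiff (c : C) {V : X.Opens} (hV : V ≤ c₀.U) (hc : i c ∈ V)
    (a : Γ(X, V)) :
    restrictedDiff s i c (X.presheaf.germ V _ hc a) =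
      pullGerm i (mem_of_mem_preimage i hc) ((c₀.e 0).1 ⟨V, hV⟩ a) • chartDiff i c₀ h₀ 0 +
      pullGerm i (mem_of_mem_preimage i hc) ((c₀.e 1).1 ⟨V, hV⟩ a) • chartDiff i c₀ h₀ 1 := by
  obtain ⟨d, -, h2, h3⟩ := c₀.exists_stalk_dual (i c) (hV hc)
  rw [restrictedDiff_expand i c c₀ (hV hc) h3, h2 0 V hV hc, h2 1 V hV hc, restrictedFun_germ,
    restrictedFun_germ, restrictedDiff_germ, restrictedDiff_germ]
  rfl

/-- The entries of the transition matrix are the partial derivatives of the new coordinates, so its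
determinant is the Jacobian. -/
theorem restrictedTwoForm_chart (c : C) (c' : Chart s) (hc : i c ∈ c'.U) :
    restrictedTwoForm s i c (X.presheaf.germ c'.U _ hc (c'.w 0))
      (X.presheaf.germ c'.U _ hc (c'.w 1)) =
      (transition i c₀ c' h₀ (mem_of_mem_preimage i hc)).det • chartForm i c₀ h₀ := by
  let V := c₀.U ⊓ c'.U
  have hV : V ≤ c₀.U := inf_le_left
  have hV' : V ≤ c'.U := inf_le_right
  have hη : i (genericPoint C) ∈ V := ⟨h₀, mem_of_mem_preimage i hc⟩
  have key : ∀ j, restrictedDiff s i c (X.presheaf.germ c'.U _ hc (c'.w j)) =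
      transition i c₀ c' h₀ (mem_of_mem_preimage i hc) 0 j • chartDiff i c₀ h₀ 0 +
      transition i c₀ c' h₀ (mem_of_mem_preimage i hc) 1 j • chartDiff i c₀ h₀ 1 := by
    intro j
    have h1 := restrictedDiff_germ_eq_chartDiff i c₀ h₀ (genericPoint C) hV hη
      (res hV' (c'.w j))
    rw [restrictedDiff_germ, germ_res] at h1
    rw [restrictedDiff_germ, transition_apply i c₀ c' h₀ _ V hV hV' hη,
      transition_apply i c₀ c' h₀ _ V hV hV' hη]
    exact h1
  rw [restrictedTwoForm, key, key, alternatingMap_two_combination, Matrix.det_fin_two, chartForm]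
  congr 1
  ring

theorem chartDiff_span_pair (x : genericCotangent s i) : ∃ a b : C.functionField,
    x = a • chartDiff i c₀ h₀ 0 + b • chartDiff i c₀ h₀ 1 := by
  have : Submodule.span C.functionField {chartDiff i c₀ h₀ 0, chartDiff i c₀ h₀ 1} = ⊤ := by
    refine eq_top_of_hom_ext _ fun _ α β hαβ ↦ extendedDiff_hom_ext _ _ α β fun a ↦ hαβ _ ?_
    obtain ⟨V, hV, a, rfl⟩ := X.presheaf.exists_germ_eq a
    have hle : V ⊓ c₀.U ≤ V := inf_le_left
    have hle' : V ⊓ c₀.U ≤ c₀.U := inf_le_right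
    have hη : i (genericPoint C) ∈ V ⊓ c₀.U := ⟨hV, h₀⟩
    have h1 := restrictedDiff_germ_eq_chartDiff i c₀ h₀ (genericPoint C) hle' hη (res hle a)
    rw [restrictedDiff_germ, germ_res] at h1
    exact Submodule.mem_span_pair.2 ⟨_, _, h1.symm⟩
  obtain ⟨a, b, h⟩ := Submodule.mem_span_pair.1 (this.ge (Submodule.mem_top (x := x)))
  exact ⟨a, b, h.symm⟩

theorem exists_eq_smul_chartForm (ω : RationalTwoForm s i) :
    ∃ g : C.functionField, ω = g • chartForm i c₀ h₀ := by
  have hω : ω ∈ Submodule.span C.functionField {chartForm i c₀ h₀} := by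
    have h1 := exteriorPower.ιMulti_span C.functionField 2 (M := genericCotangent s i)
    have h2 : Submodule.span C.functionField (Set.range
        (exteriorPower.ιMulti C.functionField 2 (M := genericCotangent s i))) ≤
        Submodule.span C.functionField {chartForm i c₀ h₀} := by
      rw [Submodule.span_le]
      rintro _ ⟨v, rfl⟩
      obtain ⟨a, b, h0⟩ := chartDiff_span_pair i c₀ h₀ (v 0)
      obtain ⟨a', b', h1⟩ := chartDiff_span_pair i c₀ h₀ (v 1)
      have hv : v = ![v 0, v 1] := by
        ext j; fin_cases j <;> rfl
      rw [hv, h0, h1, alternatingMap_two_combination]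
      exact Submodule.smul_mem _ _ (Submodule.mem_span_singleton_self _)
    exact h2 (h1.ge (Submodule.mem_top (x := ω)))
  obtain ⟨g, hg⟩ := Submodule.mem_span_singleton.1 hω
  exact ⟨g, hg.symm⟩

/-- The dual derivations give functionals dual to the two differentials; the determinant built from
these takes the value 1 on the pair. -/
theorem chartForm_ne_zero [Subsingleton S] : chartForm i c₀ h₀ ≠ 0 := by
  obtain ⟨d, h1, h2, -⟩ := c₀.exists_stalk_dual (i (genericPoint C)) h₀
  have hδ : ∀ l, ∃ δ : genericCotangent s i →ₗ[C.functionField] C.functionField,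
      ∀ j, δ (chartDiff i c₀ h₀ j) = if l = j then 1 else 0 := by
    intro l
    obtain ⟨δ, hδ⟩ := exists_extendedDiff_functional (s.stalkMap (i (genericPoint C)))
      (i.stalkMap (genericPoint C)).hom
      ((i.stalkMap (genericPoint C)).hom.toAddMonoidHom.comp (d l))
      (fun a b ↦ by
        change (i.stalkMap (genericPoint C)).hom (d l (a * b)) = _
        rw [h1, map_add, map_mul, map_mul]
        rfl)
      (fun r ↦ by
        obtain ⟨r, rfl⟩ := germ_top_surjective (s (i (genericPoint C))) r
        change (i.stalkMap (genericPoint C)).hom (d l _) = 0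
        rw [stalkMap_germ_top c₀.U _ h₀, h2 l c₀.U le_rfl h₀]
        have : (c₀.e l).1 ⟨c₀.U, le_rfl⟩ (baseMap s c₀.U r) = 0 :=
          (c₀.e l).2.2.2 ⟨c₀.U, le_rfl⟩ ⊤ (le_preimage_top s c₀.U) r
        rw [this, map_zero, map_zero])
    refine ⟨δ, fun j ↦ (hδ _).trans ?_⟩
    change (i.stalkMap (genericPoint C)).hom (d l _) = _
    have h3 := c₀.dual l j ⟨c₀.U, le_rfl⟩
    rw [res_self] at h3
    rw [h2 l c₀.U le_rfl h₀, h3]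
    split_ifs <;> simp
  choose δ hδ using hδ
  let D : genericCotangent s i [⋀^Fin 2]→ₗ[C.functionField] C.functionField :=
    (Matrix.detRowAlternating (n := Fin 2) (R := C.functionField)).compLinearMap (LinearMap.pi δ)
  intro h0
  have h3 := congrArg (exteriorPower.alternatingMapLinearEquiv D) h0
  rw [chartForm, exteriorPower.alternatingMapLinearEquiv_apply_ιMulti, map_zero] at h3
  have h4 : D ![chartDiff i c₀ h₀ 0, chartDiff i c₀ h₀ 1] = 1 := by
    refine (Matrix.det_fin_two (Matrix.of fun a b ↦
      δ b (![chartDiff i c₀ h₀ 0, chartDiff i c₀ h₀ 1] a))).trans ?_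
    simp [hδ]
  exact one_ne_zero (h4.symm.trans h3)

/-- Two local coordinate systems differ by a unit determinant. -/
theorem exists_unit_restrictedTwoForm [Subsingleton S] (c : C) (c' : Chart s) (hc : i c ∈ c'.U)
    (u v : X.presheaf.stalk (i c)) (huv : IsLocalCoordinates s (i c) u v) :
    ∃ b : X.presheaf.stalk (i c), IsUnit b ∧ restrictedTwoForm s i c u v =
      restrictedFun i c b • restrictedTwoForm s i c (X.presheaf.germ c'.U _ hc (c'.w 0))
        (X.presheaf.germ c'.U _ hc (c'.w 1)) := by
  obtain ⟨d, h1, h2, h3⟩ := c'.exists_stalk_dual (i c) hc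
  refine ⟨d 0 u * d 1 v - d 1 u * d 0 v, ?_, ?_⟩
  · have hδ : ∀ l, ∃ δ : CommRingCat.KaehlerDifferential (s.stalkMap (i c)) →ₗ[X.presheaf.stalk (i c)]
        X.presheaf.stalk (i c), ∀ a, δ (CommRingCat.KaehlerDifferential.d a) = d l a := by
      intro l
      let D : (ModuleCat.of (X.presheaf.stalk (i c)) (X.presheaf.stalk (i c))).Derivation
          (s.stalkMap (i c)) :=
        ModuleCat.Derivation.mk (fun a ↦ d l a) (map_add (d l)) (h1 l) (fun r ↦ by
          obtain ⟨r, rfl⟩ := germ_top_surjective (s (i c)) r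
          rw [stalkMap_germ_top c'.U _ hc, h2 l c'.U le_rfl hc]
          have : (c'.e l).1 ⟨c'.U, le_rfl⟩ (baseMap s c'.U r) = 0 :=
            (c'.e l).2.2.2 ⟨c'.U, le_rfl⟩ ⊤ (le_preimage_top s c'.U) r
          rw [this, map_zero])
      exact ⟨D.desc.hom, fun a ↦ ModuleCat.Derivation.desc_d D a⟩
    choose δ hδ using hδ
    -- As du and dv generate, the coordinate differentials of the chart are combinations of them.
    -- The coefficients form an inverse of the matrix of derivatives of u and v, whose determinant
    -- is therefore a unit.
    have hex : ∀ j, ∃ α β : X.presheaf.stalk (i c), ∀ l,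
        (if l = j then 1 else 0) = α * d l u + β * d l v := by
      intro j
      obtain ⟨α, β, hαβ⟩ := Submodule.mem_span_pair.1 (huv.ge (Submodule.mem_top
        (x := CommRingCat.KaehlerDifferential.d (f := s.stalkMap (i c))
          (X.presheaf.germ c'.U _ hc (c'.w j)))))
      refine ⟨α, β, fun l ↦ ?_⟩
      have h4 := congrArg (δ l) hαβ
      rw [map_add, map_smul, map_smul, hδ, hδ, hδ, h2 l c'.U le_rfl hc] at h4
      have h5 := c'.dual l j ⟨c'.U, le_rfl⟩
      rw [res_self] at h5
      rw [h5] at h4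
      rw [← smul_eq_mul, ← smul_eq_mul, h4]
      split_ifs <;> simp
    obtain ⟨α, β, h4⟩ := hex 0
    obtain ⟨α', β', h5⟩ := hex 1
    have e00 := h4 0
    have e10 := h4 1
    have e01 := h5 0
    have e11 := h5 1
    simp only [if_true, Fin.isValue, one_ne_zero, zero_ne_one, if_false] at e00 e10 e01 e11
    refine IsUnit.of_mul_eq_one (α * β' - β * α') ?_
    have : (d 0 u * d 1 v - d 1 u * d 0 v) * (α * β' - β * α') =
        (α * d 0 u + β * d 0 v) * (α' * d 1 u + β' * d 1 v) -
        (α * d 1 u + β * d 1 v) * (α' * d 0 u + β' * d 0 v) := by ring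
    rw [this, ← e00, ← e10, ← e01, ← e11]
    ring
  · rw [restrictedTwoForm, restrictedDiff_expand i c c' hc h3 u,
      restrictedDiff_expand i c c' hc h3 v, alternatingMap_two_combination, map_sub, map_mul,
      map_mul]
    rfl

/-- The order of a rational two-form, in terms of transition determinants. -/
theorem exists_formOrd_eq [Subsingleton S] [SmoothOfRelativeDimension 2 s] [IsLocallyNoetherian C]
    (g : C.functionField) (hg : g ≠ 0) (c : C) : ∃ a : C.functionField, a ≠ 0 ∧
      formOrd s i (g • chartForm i c₀ h₀) c = C.ord a c ∧
      ∀ (c' : Chart s) (hc : i c ∈ c'.U), ∃ b : X.presheaf.stalk (i c), IsUnit b ∧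
        g = a * restrictedFun i c b *
          (transition i c₀ c' h₀ (mem_of_mem_preimage i hc)).det := by
  obtain ⟨c₁, hc₁⟩ := exists_chart s (i c)
  have hdet := det_transition_ne_zero i c₀ c₁ h₀ (mem_of_mem_preimage i hc₁)
  have hex : ∃ a : C.functionField, ∃ u v : X.presheaf.stalk (i c),
      IsLocalCoordinates s (i c) u v ∧
        g • chartForm i c₀ h₀ = a • restrictedTwoForm s i c u v := by
    refine ⟨g / (transition i c₀ c₁ h₀ (mem_of_mem_preimage i hc₁)).det, _, _,
      c₁.isLocalCoordinates (i c) hc₁, ?_⟩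
    rw [restrictedTwoForm_chart i c₀ h₀, smul_smul, div_mul_cancel₀ _ hdet]
  have hform : formOrd s i (g • chartForm i c₀ h₀) c = C.ord hex.choose c := dif_pos hex
  obtain ⟨u, v, huv, hω⟩ := hex.choose_spec
  -- The coefficient selected by `formOrd` refers to unspecified coordinates u, v. Against any chart
  -- at the point it is off by a unit of the local ring, which does not affect orders.
  have key : ∀ (c' : Chart s) (hc : i c ∈ c'.U), ∃ b : X.presheaf.stalk (i c), IsUnit b ∧
        g = hex.choose * restrictedFun i c b *
          (transition i c₀ c' h₀ (mem_of_mem_preimage i hc)).det := by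
    intro c' hc
    obtain ⟨b, hb, hb'⟩ := exists_unit_restrictedTwoForm i c c' hc u v huv
    refine ⟨b, hb, ?_⟩
    rw [hb', restrictedTwoForm_chart i c₀ h₀, smul_smul, smul_smul] at hω
    exact smul_left_injective _ (chartForm_ne_zero i c₀ h₀) hω
  refine ⟨hex.choose, fun h0 ↦ hg ?_, hform, key⟩
  obtain ⟨b, -, hb⟩ := key c₁ hc₁
  rw [hb, h0, zero_mul, zero_mul]

end

end

section


/-! ### The anticanonical degree of a rational curve -/

open WithZero IsLineValuation

/-- G is the push-forward of the divisor F along p, and pushing forward preserves degrees. -/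
theorem finsum_eq_finsum_of_fibre_sum {α β : Type*} (p : α → β) (F : α → ℤ)
    (hF : (Function.support F).Finite) (G : β → ℤ) (hfib : ∀ a₀, {a | p a = p a₀}.Finite)
    (h0 : ∀ b, (∀ a, b ≠ p a) → G b = 0)
    (hG : ∀ a₀, G (p a₀) = ∑ a ∈ (hfib a₀).toFinset, F a) :
    ∑ᶠ b, G b = ∑ᶠ a, F a := by
  classical
  have hGs : ∀ a₀, G (p a₀) = ∑ a ∈ hF.toFinset with p a = p a₀, F a := by
    intro a₀
    rw [hG]
    refine (Finset.sum_subset (fun a ha ↦ ?_) fun a ha ha' ↦ ?_).symm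
    · simpa using (Finset.mem_filter.1 ha).2
    · by_contra hne
      exact ha' (Finset.mem_filter.2 ⟨hF.mem_toFinset.2 hne, by simpa using ha⟩)
  rw [finsum_eq_sum_of_support_subset (s := hF.toFinset.image p),
    finsum_eq_sum_of_support_subset (s := hF.toFinset) F (by simp),
    ← Finset.sum_fiberwise_of_maps_to (g := p) (t := hF.toFinset.image p)
      fun a ha ↦ Finset.mem_image_of_mem p ha]
  · refine Finset.sum_congr rfl fun b hb ↦ ?_
    obtain ⟨a, -, rfl⟩ := Finset.mem_image.1 hb
    exact hGs a
  · intro b hb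
    by_cases hex : ∃ a, b = p a
    · obtain ⟨a₀, rfl⟩ := hex
      by_contra hn
      refine hb ((hGs a₀).trans (Finset.sum_eq_zero fun a ha ↦ absurd ?_ hn))
      rw [Finset.coe_image]
      exact ⟨a, (Finset.mem_filter.1 ha).1, (Finset.mem_filter.1 ha).2⟩
    · exact absurd (h0 b fun a ha ↦ hex ⟨a, ha⟩) hb

theorem IsLineValuation.finite_support_log {k K : Type*} [Field k] [Field K] [Algebra k K] {t : K}
    {v : Option k → Valuation K ℤᵐ⁰} (hv : IsLineValuation t v) {x : K} (hx : x ≠ 0) :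
    (Function.support fun q ↦ -log (v q x)).Finite := by
  obtain ⟨n, hn, -⟩ := hv.exists_divisor x hx
  refine ((n.support.finite_toSet.image some).union (Set.finite_singleton none)).subset ?_
  rintro (_ | a) hq
  · simp
  · refine Or.inl ⟨a, ?_, rfl⟩
    rw [Finset.mem_coe, Finsupp.mem_support_iff]
    intro h
    exact hq (by simp [hn, h])

/-- A rational function has as many zeros as poles. -/
theorem IsLineValuation.finsum_log_eq_zero {k K : Type*} [Field k] [Field K] [Algebra k K] {t : K}
    {v : Option k → Valuation K ℤᵐ⁰} (hv : IsLineValuation t v) {x : K} (hx : x ≠ 0) :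
    ∑ᶠ q, -log (v q x) = 0 := by
  classical
  obtain ⟨n, hn, hn'⟩ := hv.exists_divisor x hx
  rw [finsum_eq_sum_of_support_subset (s := n.support.insertNone), Finset.sum_insertNone, hn',
    log_exp]
  · simp_rw [hn, log_exp, neg_neg]
    exact neg_add_cancel _
  · rintro (_ | a) hq
    · simp
    · rw [Finset.mem_coe, Finset.some_mem_insertNone, Finsupp.mem_support_iff]
      intro h
      exact hq (by simp [hn, h])

section

variable {X Y C S : Scheme.{u}} [IsIntegral Y] [IsIntegral C] (h : Y ⟶ C) (i : C ⟶ X)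
  (hη : h (genericPoint Y) = genericPoint C)

include hη in
theorem comp_genericPoint_mem {U : X.Opens} (hU : i (genericPoint C) ∈ U) :
    (h ≫ i) (genericPoint Y) ∈ U := by
  rw [Scheme.Hom.comp_apply, hη]
  exact hU

theorem functionFieldMap_pullGerm {U : X.Opens} (hU : i (genericPoint C) ∈ U) (a : Γ(X, U)) :
    functionFieldMap h hη (pullGerm i hU a) =
      pullGerm (h ≫ i) (comp_genericPoint_mem h i hη hU) a := by
  rw [pullGerm_apply i, functionFieldMap_germ, pullGerm_apply, pullGerm_apply, Scheme.Hom.comp_app]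
  rfl

theorem functionFieldMap_det_transition {s : X ⟶ S} (c c' : Chart s)
    (hc : i (genericPoint C) ∈ c.U) (hc' : i (genericPoint C) ∈ c'.U) :
    functionFieldMap h hη (transition i c c' hc hc').det =
      (transition (h ≫ i) c c' (comp_genericPoint_mem h i hη hc)
        (comp_genericPoint_mem h i hη hc')).det := by
  rw [RingHom.map_det]
  congr 1
  ext a b
  exact functionFieldMap_pullGerm h i hη _ _

theorem functionFieldMap_restrictedFun (c : C) (a : X.presheaf.stalk (i c)) :
    functionFieldMap h hη (restrictedFun i c a) =
      stalkToFunctionField h hη c (i.stalkMap c a) := by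
  rw [restrictedFun_eq]
  rfl

end

section

variable {k : Type u} [Field k] [IsAlgClosed k] [IsIntegral (projLine k)]
  {X C : Scheme.{u}} [IsIntegral C] {s : X ⟶ Spec (CommRingCat.of k)}
  [SmoothOfRelativeDimension 2 s] {h : projLine k ⟶ C}
  (hη : h (genericPoint (projLine k)) = genericPoint C)
  (i : C ⟶ X) (hsurj : Function.Surjective (functionFieldMap h hη))
  (c₀ : Chart s) (h₀ : i (genericPoint C) ∈ c₀.U)
  (c : Option k → Chart s) (hc : ∀ q, (h ≫ i) (pt k q) ∈ (c q).U)

theorem lineVal_functionFieldMap_restrictedFun (q : Option k) {x : C} (hx : h (pt k q) = x)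
    {b : X.presheaf.stalk (i x)} (hb : IsUnit b) :
    lineVal k q (functionFieldMap h hη (restrictedFun i x b)) = 1 := by
  obtain ⟨b', hb'⟩ := hb.exists_right_inv
  have h1 := lineVal_stalkToFunctionField_le_one hη q hx (i.stalkMap x b)
  have h2 := lineVal_stalkToFunctionField_le_one hη q hx (i.stalkMap x b')
  rw [← functionFieldMap_restrictedFun] at h1 h2
  refine le_antisymm h1 ?_
  rw [← map_one (lineVal k q), ← map_one (functionFieldMap h hη), ← map_one (restrictedFun i x),
    ← hb', map_mul, map_mul, map_mul]
  exact mul_le_of_le_one_right' h2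

include hsurj in
/-- The order of a rational two-form, computed on the normalization. -/
theorem formOrd_map_pt [IsIntegralHom h] [IsLocallyNoetherian C] {σ : C ⟶ Spec (CommRingCat.of k)}
    (hσ : h ≫ σ = projSpaceToSpec k 1) {g : C.functionField} (hg : g ≠ 0) (q₀ : Option k) :
    formOrd s i (g • chartForm i c₀ h₀) (h (pt k q₀)) =
      ∑ q ∈ (finite_fibre hη hsurj q₀).toFinset, (-log (lineVal k q (functionFieldMap h hη g)) +
        log (lineVal k q
          (lineTransition c₀ (comp_genericPoint_mem h i hη h₀) c hc q).det)) := by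
  obtain ⟨a, ha, hord, hex⟩ := exists_formOrd_eq i c₀ h₀ g hg (h (pt k q₀))
  rw [hord, ord_eq_sum hη hsurj hσ q₀ a ha]
  refine Finset.sum_congr rfl fun q hq ↦ ?_
  have hq' : h (pt k q) = h (pt k q₀) := by simpa using hq
  have hcq : i (h (pt k q₀)) ∈ (c q).U := by
    rw [← hq']
    exact hc q
  obtain ⟨b, hb, hgb⟩ := hex (c q) hcq
  have hdet := det_transition_ne_zero i c₀ (c q) h₀ (mem_of_mem_preimage i hcq)
  have hM : functionFieldMap h hη
      (transition i c₀ (c q) h₀ (mem_of_mem_preimage i hcq)).det =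
      (lineTransition c₀ (comp_genericPoint_mem h i hη h₀) c hc q).det :=
    functionFieldMap_det_transition h i hη c₀ (c q) h₀ _
  rw [hgb, ← hM, map_mul, map_mul, map_mul, map_mul,
    lineVal_functionFieldMap_restrictedFun hη i q hq' hb, mul_one, log_mul]
  · ring
  · exact (Valuation.ne_zero_iff _).2 ((map_ne_zero _).2 ha)
  · exact (Valuation.ne_zero_iff _).2 ((map_ne_zero _).2 hdet)

-- Write the chosen form as g times the chart form. Over the normalization its divisor is that of g
-- minus the orders of the Jacobians det M_q. A rational function on the line has degree zero, so
-- only the Jacobians remain.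
include hsurj in
theorem canonicalDegree_eq_neg_latticeDegree [IsIntegralHom h] [IsLocallyNoetherian C]
    {σ : C ⟶ Spec (CommRingCat.of k)} (hσ : h ≫ σ = projSpaceToSpec k 1)
    (hc₀ : ∀ q, (h ≫ i) (pt k q) ∈ c₀.U → c q = c₀) :
    canonicalDegree s i = -latticeDegree (lineVal k)
      (lineTransition c₀ (comp_genericPoint_mem h i hη h₀) c hc) := by
  have hω : (Classical.epsilon fun ω : RationalTwoForm s i ↦ ω ≠ 0) ≠ 0 :=
    Classical.epsilon_spec (p := fun ω : RationalTwoForm s i ↦ ω ≠ 0)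
      ⟨_, chartForm_ne_zero i c₀ h₀⟩
  obtain ⟨g, hg⟩ := exists_eq_smul_chartForm i c₀ h₀
    (Classical.epsilon fun ω : RationalTwoForm s i ↦ ω ≠ 0)
  have hg0 : g ≠ 0 := by
    rintro rfl
    exact hω (hg.trans (zero_smul _ _))
  have hκg : functionFieldMap h hη g ≠ 0 := (map_ne_zero _).2 hg0
  have h₁ := comp_genericPoint_mem h i hη h₀
  have hfin : (Function.support fun q ↦
      log (lineVal k q (lineTransition c₀ h₁ c hc q).det)).Finite := by
    refine (finite_pt_notMem k ((h ≫ i) ⁻¹ᵁ c₀.U) h₁).subset fun q hq hq' ↦ hq ?_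
    have aux : ∀ (c' : Chart s) (hc' : (h ≫ i) (genericPoint (projLine k)) ∈ c'.U), c' = c₀ →
        (transition (h ≫ i) c₀ c' h₁ hc').det = 1 := by
      rintro c' hc' rfl
      rw [transition_self, Matrix.det_one]
    have : (lineTransition c₀ h₁ c hc q).det = 1 := aux _ _ (hc₀ q hq')
    simp [this]
  have hfin' := (isLineValuation k).finite_support_log hκg
  rw [canonicalDegree, hg, finsum_eq_finsum_of_fibre_sum (fun q ↦ h (pt k q))
    (fun q ↦ -log (lineVal k q (functionFieldMap h hη g)) +
        log (lineVal k q (lineTransition c₀ h₁ c hc q).det))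
    ((hfin'.union hfin).subset (Function.support_add _ _)) _ (finite_fibre hη hsurj) _
    (formOrd_map_pt hη i hsurj c₀ h₀ c hc hσ hg0), finsum_add_distrib hfin' hfin,
    (isLineValuation k).finsum_log_eq_zero hκg, zero_add, latticeDegree, finsum_neg_distrib,
    neg_neg]
  -- The only point of C that is not the image of a closed point is the generic one, where the order
  -- is zero because its coheight is not one.
  intro x hx
  obtain rfl : x = genericPoint C :=
    (eq_genericPoint_or_exists_map_pt hη x).resolve_right fun ⟨q, hq⟩ ↦ hx q hq
  obtain ⟨a, -, hord, -⟩ := exists_formOrd_eq i c₀ h₀ g hg0 (genericPoint C)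
  rw [hord]
  exact Scheme.ord_eq_zero_of_coheight_neq_one (by rw [coheight_genericPoint]; simp) _

end

end

end

end FreeCurves

/-! ### The numerical criterion for very freeness -/

theorem mainTheorem3 {k : Type u} [Field k] [IsAlgClosed k]
    -- a smooth projective integral surface
    {X : Scheme.{u}} [IsIntegral X] (s : X ⟶ Spec (CommRingCat.of k))
    [SmoothOfRelativeDimension 2 s] (hX : FreeCurves.IsProjective s)
    -- an integral curve on it whose only singularities are ordinary double points
    {C : Scheme.{u}} [IsIntegral C] (i : C ⟶ X) [IsClosedImmersion i] (hC : FreeCurves.IsNodal i)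
    -- its normalization is the projective line
    (h : FreeCurves.projLine k ⟶ C) (hh : FreeCurves.IsNormalization h)
    (hk : h ≫ i ≫ s = FreeCurves.projSpaceToSpec k 1) :
    3 ≤ FreeCurves.anticanonicalDegree s i ↔ FreeCurves.VeryFree s (h ≫ i) := by
  classical
  have := hh.isIntegral
  have := hh.isIntegralHom
  have := FreeCurves.curve_isLocallyNoetherian s i
  have hη := FreeCurves.map_genericPoint h hh.birational
  have hsurj := FreeCurves.functionFieldMap_surjective h hη hh.birational
  obtain ⟨c₀, h₀⟩ := FreeCurves.exists_chart s (i (genericPoint C))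
  choose c hc using fun q ↦ FreeCurves.exists_chart s ((h ≫ i) (FreeCurves.pt k q))
  -- The base chart is reused wherever it applies, so all but finitely many transition matrices are
  -- the identity and the sum defining the lattice degree is finite.
  let c' : Option k → FreeCurves.Chart s := fun q ↦
    if (h ≫ i) (FreeCurves.pt k q) ∈ c₀.U then c₀ else c q
  have hc' : ∀ q, (h ≫ i) (FreeCurves.pt k q) ∈ (c' q).U := by
    intro q
    by_cases hq : (h ≫ i) (FreeCurves.pt k q) ∈ c₀.U
    · rwa [show c' q = c₀ from if_pos hq]
    · rw [show c' q = c q from if_neg hq]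
      exact hc q
  have hc₀ : ∀ q, (h ≫ i) (FreeCurves.pt k q) ∈ c₀.U → c' q = c₀ := fun q hq ↦ if_pos hq
  have hdeg : FreeCurves.anticanonicalDegree s i = FreeCurves.IsLineValuation.latticeDegree
      (FreeCurves.lineVal k) (FreeCurves.lineTransition c₀
        (FreeCurves.comp_genericPoint_mem h i hη h₀) c' hc') := by
    rw [FreeCurves.anticanonicalDegree,
      FreeCurves.canonicalDegree_eq_neg_latticeDegree hη i hsurj c₀ h₀ c' hc' hk hc₀, neg_neg]
  rw [hdeg]
  exact (FreeCurves.veryFree_iff_three_le_latticeDegree c₀ _ c' hc'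
    (by rw [Category.assoc]; exact hk) hc₀
    (FreeCurves.exists_uniformizer_of_isNodal hη hsurj i hC)).symm
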